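/- **Lattice and reshaping.** Let $d_j$ ($j\in\mathbb Z/12$) be the unit vector of the plane in direction $15^\circ+30^\circ j$, and let $\Lambda=\sum_j\mathbb Z d_j$, which is free of rank 4 with basis $d_0,d_1,d_2,d_3$. The parity of $d_j$ is that of $j$. Let $\lambda:\Lambda\to\Lambda$ be multiplication by $2+\sqrt3$. The *reshaping* is the additive map $\varphi:\Lambda\to\mathbb Z[i]\subset\mathbb C$ with $\varphi(d_0)=1$, $\varphi(d_1)=1+i$, $\varphi(d_2)=\varphi(d_3)=i$ (hence $\varphi(d_4)=-1+i$, $\varphi(d_5)=-1$). It turns every unit equilateral triangle with edges among the $d_j$ into an isosceles right triangle with legs $1$, the unit squares on $d_1,d_4$ into squares of side $\sqrt2$, and the unit squares on $d_0,d_3$ and on $d_2,d_5$ into unit squares. **Marked triangles.** Corners carry a mark $0$ (white) or $1$ (black). The marked triangles, each an isosceles right triangle with legs $1$, are, up to translation and rotation by $180^\circ$: (i) reshaped equilateral triangles with edges of parity $k\in\{0,1\}$ and marked corners, such that the number of corners whose mark differs from $k$ is not $1$ (10 triangles); (ii) the four pieces into which its two diagonals cut a reshaped square on $d_1,d_4$,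 with marks at the two ends of the hypotenuse (8 triangles); (iii) the two pieces of a reshaped square on $d_0,d_3$ or on $d_2,d_5$, cut along a diagonal, with three marked corners (16 triangles). In (iii) fix $\delta\in\{0,1\}$: for $\delta=0$ the cuts join the ends of $d_0+d_3$, respectively of $d_2+d_5$; for $\delta=1$ they are the other diagonals. These are 34 marked triangles; reflection in a vertical axis together with exchanging white and black groups them into 17 pairs. **Rules.** Fix also $\varepsilon\in\{0,1\}$. In the unreshaped lattice picture, a corner at $v$ with mark $c$ is replaced by a dodecagonal wheel centred at $\lambda v$: six unit triangles around the centre, surrounded alternately by six unit squares (centred in the directions $d_j$ of parity $c$) and six unit triangles (in the other directions). The wheels at the two ends of an edge share an edge; an equilateral triangle contains one further unit triangle between its three wheels, and a square contains one further unit square with a unit triangle on each side between its four wheels. New marks: the six inner vertices of the wheel get $c$; its centre gets $c$ if $\varepsilon=0$ and $1-c$ if $\varepsilon=1$; the two vertices common to the wheels at the ends of an edge in direction $d_j$ with end marks $x,y$ get the opposite of the majority of $x$, $y$, $j\bmod 2$; the vertex of a wheel that is a corner of the further square inside a square gets $1-c$. The tiles of a wheel that straddle an edge belong to the tile on the left of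 this edge (seen from the wheel's centre) if $c=0$, and to that on its right if $c=1$. All new squares are cut into marked triangles as above. The rule of a piece of a square takes the wheel parts on its side of the cutting diagonals, the further triangles at its sides of the square, and the corresponding piece of the further square. Positions are then reshaped by $\varphi$. A triangle rotated by $180^\circ$ is replaced by the rotated patch; no other rotations and no flips are used. Iterating $n$ times from a marked triangle gives its level-$n$ supertile. A tiling of the plane by marked triangles (no gaps, no overlaps) is *generated by the rules* if each of its finite patches is contained in a translate of a supertile. A set of tiles is *aperiodic* if it has no nonzero translational period and, for each vector $v\ne0$, there is an $R$ such that inside no disc of radius $R$ the set has period $v$. **Theorem.** For each choice of $\varepsilon,\delta\in\{0,1\}$: 1. There are 34 rules; the patches of the rules consist of the 34 marked triangles only, and the rules form 17 pairs, in each of which the two different rules are mirror images of each other with white and black exchanged. 2. The rules do not overlap: in each supertile different triangles have disjoint interiors and are replaced by disjoint patches. 3. There is a tiling of the plane generated by the rules. 4. Every tiling of the plane generated by the rules consists of copies of one isosceles right triangle in at most four orientations, is edge-to-edge, and is aperiodic; it remains aperiodic after all marks are erased, that is, as a set of plain triangles. -/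

import Mathlib

namespace OneTriangle

/-! ### Addresses: the edge labels and the reshaping

The square-triangle tiling has unit edges in the twelve directions `15° + 30° j`; opposite
directions carry the same edge label, which gives six labels.  Its vertices are integer
combinations of these unit vectors.  The address `(a, b, c, d)` stands for the combination
`a d₀ + b d₁ + c d₂ + d d₃`, where `d_j` is the unit vector in direction `15° + 30° j`. -/

/-- Vertices of the square-triangle tiling, in the basis `d₀, d₁, d₂, d₃`. -/
abbrev Addr := ℤ × ℤ × ℤ × ℤ

/-- Rotation by 30 degrees of the square-triangle lattice (`d₄ = d₂ - d₀`). -/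
def turn (p : Addr) : Addr :=
  (-p.2.2.2, p.1, p.2.1 + p.2.2.2, p.2.2.1)

/-- The unit edge `d_j` in direction `15° + 30° j` (only `j` modulo 12 matters). -/
def dir (j : ℕ) : Addr := turn^[j] (1, 0, 0, 0)

/-- Multiplication by `2 + √3 = 2 + e^{iπ/6} + e^{-iπ/6}`, the inflation of the square-triangle
tiling. -/
def inflate (p : Addr) : Addr := p + p + turn p + turn^[11] p

/-- The reshaping of edges: the labels at 15° and 165° become horizontal unit edges, those at
75° and 105° vertical unit edges, those at 45° and 135° edges of length `√2` with unchanged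
direction.  So the equilateral triangles become isosceles right triangles with unit legs, the
square at 45° becomes a square with side `√2`, and the two other squares become unit squares. -/
noncomputable def reshape (p : Addr) : ℂ :=
  ((p.1 + p.2.1 : ℤ) : ℂ) + ((p.2.1 + p.2.2.1 + p.2.2.2 : ℤ) : ℂ) * Complex.I

/-! ### Marked triangles

Corners are marked white (`false`) or black (`true`).  There are three families, each in two
colours, exchanged by the mirror image:
* `tri k`: a reshaped equilateral triangle, with edges in directions `j` of parity `k`
  (`k = false`: 15°, 75°, 135°; `k = true`: 45°, 105°, 165°), all three corners marked;
* `quarter k`: one of the four pieces into which its diagonals cut the square of side `√2`,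
  given by a side of the square in direction 135° (`k = false`) or 45° (`k = true`), whose two
  end points are marked;
* `half k`: one of the two pieces of a unit square that comes from the square at 15° and 105°
  (`k = false`) or from that at 75° and 165° (`k = true`), cut along a diagonal, all three
  corners marked, the right angle being at the second one. -/
inductive Kind where
  | tri (k x y z : Bool)
  | quarter (k x y : Bool)
  | half (k x y z : Bool)
  deriving DecidableEq, Fintype

/-- The marked triangles for which there is a rule: in a `tri`, the number of corners whose mark
differs from the parity of the edges is not 1. -/
def Kind.HasRule : Kind → Prop
  | .tri k x y z => (x != k).toNat + (y != k).toNat + (z != k).toNat ≠ 1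
  | _ => True

instance : DecidablePred Kind.HasRule := fun κ => by
  cases κ <;> unfold Kind.HasRule <;> infer_instance

/-- Direction of the first side (from the first corner to the second one) of an unrotated
marked triangle.  `δ` selects along which diagonal the unit squares are cut. -/
def Kind.firstDir (δ : Bool) : Kind → ℕ
  | .tri k _ _ _ => if k then 1 else 0
  | .quarter k _ _ => if k then 1 else 4
  | .half k _ _ _ => (if k then 2 else 0) + (if δ then 3 else 0)

/-- A marked triangle, rotated by 0 (`rot = false`) or 180 degrees (`rot = true`), with the
address of its first corner. -/
structure LTile where
  kind : Kind
  rot : Bool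
  pos : Addr
  deriving DecidableEq

/-- Direction of the first side. -/
def LTile.firstDir (δ : Bool) (t : LTile) : ℕ :=
  t.kind.firstDir δ + (if t.rot then 6 else 0)

/-! The following functions give the placed marked triangle with first corner `p`, first side in
direction `j` and the given marks at the corners, in counterclockwise order. -/

/-- The reshaped equilateral triangle `p, p + d_j, p + d_{j+2}`; any of the corners may be named
first. -/
def mkTri (p : Addr) (j : ℕ) (x y z : Bool) : LTile :=
  let k := decide (j % 2 = 1)
  match j % 12 / 2 with
  | 0 => ⟨.tri k x y z, false, p⟩
  | 3 => ⟨.tri k x y z, true, p⟩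
  | 2 => ⟨.tri k z x y, false, p + dir (j + 2)⟩
  | 5 => ⟨.tri k z x y, true, p + dir (j + 2)⟩
  | 4 => ⟨.tri k y z x, false, p + dir j⟩
  | _ => ⟨.tri k y z x, true, p + dir j⟩

/-- The quarter of the square `p, p + d_j, p + d_j + d_{j+3}, p + d_{j+3}` at its first side
(`j ≡ 1` modulo 3). -/
def mkQuarter (p : Addr) (j : ℕ) (x y : Bool) : LTile :=
  ⟨.quarter (decide (j % 2 = 1)) x y, decide (6 ≤ j % 12), p⟩

/-- The half `p, p + d_j, p + d_j + d_{j+3}` of a square (`j ≡ 0` or `2` modulo 3). -/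
def mkHalf (p : Addr) (j : ℕ) (x y z : Bool) : LTile :=
  ⟨.half (decide (j % 3 = 2)) x y z, decide (6 ≤ j % 12), p⟩

/-- The square `p, p + d_j, p + d_j + d_{j+3}, p + d_{j+3}` with marks `x, y, z, w`, cut into
marked triangles. -/
def mkSquare (δ : Bool) (p : Addr) (j : ℕ) (x y z w : Bool) : List LTile :=
  let p₁ := p + dir j
  let p₂ := p + dir j + dir (j + 3)
  let p₃ := p + dir (j + 3)
  if j % 3 = 1 then
    [mkQuarter p j x y, mkQuarter p₁ (j + 3) y z, mkQuarter p₂ (j + 6) z w,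
      mkQuarter p₃ (j + 9) w x]
  else if decide (3 ≤ j % 6) = δ then
    [mkHalf p j x y z, mkHalf p₂ (j + 6) z w x]
  else
    [mkHalf p₁ (j + 3) y z w, mkHalf p₃ (j + 9) w x y]

/-! ### The substitution

A corner at `v` with mark `c` becomes a dodecagonal wheel around `inflate v`: six triangles
around the centre, then, alternately, six squares in the directions of parity `c` and six
triangles in the other directions.  The wheels at the ends of an edge share an edge.  What
remains is one triangle inside each triangle, and a square with a triangle on each of its sides
inside each square. -/

/-- The vertex of the wheel around `v` between the directions `j` and `j + 1`. -/
def rim (v : Addr) (j : ℕ) : Addr := v + dir j + dir (j + 1)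

/-- The mark of the two vertices shared by the wheels at the ends of an edge in direction `j`
whose ends are marked `x` and `y`: the opposite of the majority of `x`, `y` and the parity
of `j`. -/
def edgeMark (x y : Bool) (j : ℕ) : Bool :=
  let k := decide (j % 2 = 1)
  !((x && y) || (x && k) || (y && k))

/-- The tiles of the wheel around `v` that lie in direction `j`; the rim vertices to the right
and to the left of this direction are marked `r` and `l`, the inner hexagon is marked `c`, the
centre is marked `c` if `ε = false` and the opposite if `ε = true`. -/
def wheelPart (ε δ : Bool) (v : Addr) (c : Bool) (j : ℕ) (r l : Bool) : List LTile :=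
  if decide (j % 2 = 1) = c then
    mkTri v (j + 11) (c ^^ ε) c c :: mkSquare δ (v + dir (j + 11)) j c r l c
  else
    [mkTri (v + dir j) (j + 11) c r l]

/-- The part of the wheel that the rule of a `tri` contains at a corner marked `c` where the
triangle starts in direction `j`, the corners in directions `j` and `j + 2` being marked `n`
and `m`.  The tiles that straddle a side go to the triangle on their left if `c` is white, and
to the one on their right if `c` is black, seen from the corner. -/
def triCorner (ε δ : Bool) (v : Addr) (c : Bool) (j : ℕ) (n m : Bool) : List LTile :=
  let e := edgeMark c n j
  let f := edgeMark c m (j + 2)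
  if c then wheelPart ε δ v c (j + 1) e f ++ wheelPart ε δ v c (j + 2) f f
  else wheelPart ε δ v c j e e ++ wheelPart ε δ v c (j + 1) e f

/-- At a corner of a square marked `c`, the part of the wheel between the side in direction `j`,
at whose other end the mark is `n`, and the diagonal counterclockwise from it. -/
def squareCornerFst (ε δ : Bool) (v : Addr) (c : Bool) (j : ℕ) (n : Bool) : List LTile :=
  let e := edgeMark c n j
  if c then wheelPart ε δ v c (j + 1) e (!c)
  else wheelPart ε δ v c j e e ++ wheelPart ε δ v c (j + 1) e (!c)

/-- At a corner of a square marked `c`, the part of the wheel between the side in direction `j`,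
at whose other end the mark is `m`, and the diagonal clockwise from it. -/
def squareCornerSnd (ε δ : Bool) (v : Addr) (c : Bool) (j : ℕ) (m : Bool) : List LTile :=
  let e := edgeMark c m j
  if c then wheelPart ε δ v c (j + 11) (!c) e ++ wheelPart ε δ v c j e e
  else wheelPart ε δ v c (j + 11) (!c) e

/-- What the rules of the pieces of a square contain along a side of the square in direction `j`
from the corner with wheel centre `a`, marked `x`, to that with wheel centre `b`, marked `y`. -/
def squareSide (ε δ : Bool) (a b : Addr) (j : ℕ) (x y : Bool) : List LTile :=
  squareCornerFst ε δ a x j y ++ squareCornerSnd ε δ b y (j + 6) x ++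
    [mkTri (rim a j) (j + 2) (edgeMark x y j) (!y) (!x)]

/-- The substitution rules, for marked triangles with first corner at the origin. -/
def rule (ε δ : Bool) (κ : Kind) : List LTile :=
  let j := κ.firstDir δ
  let a : Addr := 0
  let b := inflate (dir j)
  match κ with
  | .tri _ x y z =>
      triCorner ε δ a x j y z ++ triCorner ε δ b y (j + 4) z x ++
        triCorner ε δ (inflate (dir (j + 2))) z (j + 8) x y ++
        [mkTri (rim a j) (j + 2) (edgeMark x y j) (edgeMark y z (j + 4)) (edgeMark z x (j + 8))]
  | .quarter _ x y =>
      squareSide ε δ a b j x y ++ [mkQuarter (rim a (j + 1)) j (!x) (!y)]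
  | .half _ x y z =>
      squareSide ε δ a b j x y ++
        squareSide ε δ b (inflate (dir j + dir (j + 3))) (j + 3) y z ++
        [mkHalf (rim a (j + 1)) j (!x) (!y) (!z)]

/-- The rule applied to a placed marked triangle: a rotated copy is replaced by the rotated
patch. -/
def subst (ε δ : Bool) (t : LTile) : Finset LTile :=
  ((rule ε δ t.kind).map fun s =>
    (⟨s.kind, t.rot ^^ s.rot, inflate t.pos + (if t.rot then -s.pos else s.pos)⟩ : LTile)).toFinset

/-- The patch obtained from one marked triangle by applying the rules `n` times. -/
def supertile (ε δ : Bool) (κ : Kind) : ℕ → Finset LTile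
  | 0 => {⟨κ, false, 0⟩}
  | n + 1 => (supertile ε δ κ n).biUnion (subst ε δ)

/-- The mirror image in the vertical axis on addresses: direction `15° + 30° j` becomes
`15° + 30° (5 - j)`. -/
def flipAddr (p : Addr) : Addr :=
  (-p.2.1, -p.1, p.2.1 + p.2.2.2, p.1 + p.2.2.1)

/-- The mirror image in the vertical axis, with white and black exchanged. -/
def mirror (δ : Bool) (t : LTile) : LTile :=
  let j := t.firstDir δ
  match t.kind with
  | .tri _ x y z => mkTri (flipAddr t.pos) (15 - j) (!x) (!z) (!y)
  | .quarter _ x y => mkQuarter (flipAddr (t.pos + dir j)) (23 - j) (!y) (!x)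
  | .half _ x y z => mkHalf (flipAddr (t.pos + dir j + dir (j + 3))) (20 - j) (!z) (!y) (!x)

/-! ### Tilings of the plane `ℂ` -/

/-- A marked triangle in the plane, rotated by 0 or 180 degrees, with its first corner. -/
structure PTile where
  kind : Kind
  rot : Bool
  pos : ℂ

/-- The three corners of a marked triangle in the plane. -/
noncomputable def PTile.corners (δ : Bool) (t : PTile) : Set ℂ :=
  let j := t.kind.firstDir δ + (if t.rot then 6 else 0)
  {t.pos, t.pos + reshape (dir j),
    t.pos + match t.kind with
      | .tri _ _ _ _ => reshape (dir (j + 2))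
      | .quarter _ _ _ => (reshape (dir j) + reshape (dir (j + 3))) / 2
      | .half _ _ _ _ => reshape (dir j) + reshape (dir (j + 3))}

/-- The triangle without its marks. -/
noncomputable def PTile.region (δ : Bool) (t : PTile) : Set ℂ := convexHull ℝ (t.corners δ)

/-- Translation of a marked triangle. -/
noncomputable def PTile.shift (v : ℂ) (t : PTile) : PTile := ⟨t.kind, t.rot, v + t.pos⟩

/-- The marked triangle in the plane with a given address, the plane being translated by `w`. -/
noncomputable def LTile.place (w : ℂ) (t : LTile) : PTile := ⟨t.kind, t.rot, w + reshape t.pos⟩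

/-- No gaps and no overlaps. -/
def IsTiling (δ : Bool) (T : Set PTile) : Prop :=
  (⋃ t ∈ T, t.region δ) = Set.univ ∧
    T.Pairwise fun s t => Disjoint (interior (s.region δ)) (interior (t.region δ))

/-- A tiling generated by the rules: each of its finite patches occurs in a supertile. -/
def IsGenerated (ε δ : Bool) (T : Set PTile) : Prop :=
  IsTiling δ T ∧ ∀ F : Set PTile, F.Finite → F ⊆ T →
    ∃ (κ : Kind) (n : ℕ) (w : ℂ), κ.HasRule ∧
      F ⊆ LTile.place w '' (supertile ε δ κ n : Set LTile)

/-- Two different tiles meet in nothing, in a common corner, or in a common full side. -/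
def IsEdgeToEdge (δ : Bool) (T : Set PTile) : Prop :=
  T.Pairwise fun s t =>
    s.region δ ∩ t.region δ = convexHull ℝ (s.corners δ ∩ t.corners δ) ∧
      (s.corners δ ∩ t.corners δ).ncard ≤ 2

/-- A set `T` of tiles has period `v` inside the set `B` (for `B = univ`: `T` has period `v`). -/
def HasPeriodIn {α : Type} (region : α → Set ℂ) (shift : ℂ → α → α) (T : Set α) (v : ℂ)
    (B : Set ℂ) : Prop :=
  ∀ t : α, region t ⊆ B → region (shift v t) ⊆ B → (t ∈ T ↔ shift v t ∈ T)

/-- A set of tiles is aperiodic if it has no nonzero period and, moreover, no vector is a period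
of arbitrarily large patches. -/
def IsAperiodic {α : Type} (region : α → Set ℂ) (shift : ℂ → α → α) (T : Set α) : Prop :=
  (∀ v : ℂ, v ≠ 0 → ¬ HasPeriodIn region shift T v Set.univ) ∧
    ∀ v : ℂ, v ≠ 0 → ∃ R : ℝ, ∀ x : ℂ, ¬ HasPeriodIn region shift T v (Metric.closedBall x R)

end OneTriangle

namespace OneTriangle

/-! ### Counting the rules and their mirror symmetry -/

/-! The first claims (34 rules, 17 mirror pairs, closure) are finite computations. The rest combines
a discrete Stokes formula, which controls patches of every level by finite checks, with a lift of
the square grid to the rank 4 lattice.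

No overlaps, no gaps. Every side of a triangle is a marked directed edge, and the substitution
replaces an edge by a path that depends on this edge alone. `cancel_boundary` checks for each rule
that the sides of the new triangles cancel in pairs except for the paths of the old sides. Hence the
sum of an antisymmetric edge function over all triangles of a patch equals its sum over the boundary
(`listSum_iter_wheel`). The patches that grow from a dodecagonal wheel at the origin have receding
boundaries (`boundary_far`): inflation multiplies the physical embedding by `2 + √3` and the
conjugate one by `2 - √3`, so conjugates stay bounded, and the reshaping is a similarity of the
physical position plus a bounded error (`reshape_eq`). For the signed indicator of a grid segment,
Stokes then says that the quarter cells on its two sides are covered equally often. So the covering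
number is constant away from the boundary. It is computed at one quarter cell next to the origin,
which only descendants of the hub of the wheel can reach; the hub reproduces itself and the number
is 1 (`mult_eq_one`). Every supertile occurs inside arbitrarily large wheel patches, and wheel
patches occur in supertiles. This gives disjointness, edge-to-edge matching, and a tiling as the
union of nested patches. The indicator of a marked edge in place of a segment shows that
neighbouring triangles also agree in the lattice lift of their common side (`supertile_match`).

Aperiodicity. By this matching, the grid points of a supertile have consistent lifts to the lattice,
with bounded conjugates (`exists_lift`). The directions of the hypotenuses, visible without marks,
determine the labels (lifts) of all vertical grid edges if `δ = false`, and of all horizontal ones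
if `δ = true`. Suppose that the plain triangles have period `(p, q)` on a large box, and let `δ =
false`. The displacement of the lift under this period is then constant along columns. If it changed
from one column to the next, the horizontal label between them would be the same in many rows,
because the differences of the three possible labels are distinct; this would force the vertical
labels there to be all centre labels or all other labels, and a linear functional of the conjugate
would grow without bound (`displacement_row`). So the displacement is one nonzero lattice vector
`b`. Iterating the period makes the conjugate of `b` arbitrarily small while its physical length
stays bounded, against `one_le_norm_mul_norm`, an integrality statement. The size of the box depends
on the period only, which gives the local form of aperiodicity. -/

theorem card_hasRule : (Finset.univ.filter Kind.HasRule).card = 34 := by decide +kernel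

theorem hasRule_of_mem_rule : ∀ (ε δ : Bool) (κ : Kind), κ.HasRule →
    ∀ t ∈ rule ε δ κ, t.kind.HasRule := by decide +kernel

theorem mirror_pairs : ∀ (δ : Bool) (κ : Kind), κ.HasRule →
    (mirror δ ⟨κ, false, 0⟩).kind.HasRule ∧ (mirror δ ⟨κ, false, 0⟩).kind ≠ κ ∧
      mirror δ (mirror δ ⟨κ, false, 0⟩) = ⟨κ, false, 0⟩ := by decide +kernel

/-! ### The action of translations and of the half turn -/

/-- The half turn (if `r`) on addresses. -/
def halfTurn (r : Bool) (p : Addr) : Addr := if r then -p else p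

/-- The half turn (if `r`) about the origin followed by the translation by `q`. -/
def LTile.act (r : Bool) (q : Addr) (t : LTile) : LTile :=
  ⟨t.kind, r ^^ t.rot, q + halfTurn r t.pos⟩

/-- The substituted patch as a list. -/
def substList (ε δ : Bool) (t : LTile) : List LTile :=
  (rule ε δ t.kind).map (LTile.act t.rot (inflate t.pos))

theorem mem_subst {ε δ : Bool} {s t : LTile} : s ∈ subst ε δ t ↔ s ∈ substList ε δ t := by
  simp only [subst, substList, List.mem_toFinset]
  rfl

/-- The finset identity of `subst_mirror` is reduced to two inclusions between explicit lists, whose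
orders need not agree. -/
theorem substList_mirror : ∀ (ε δ : Bool) (κ : Kind), κ.HasRule →
    (∀ t ∈ substList ε δ (mirror δ ⟨κ, false, 0⟩),
      t ∈ (substList ε δ ⟨κ, false, 0⟩).map (mirror δ)) ∧
    ∀ t ∈ (substList ε δ ⟨κ, false, 0⟩).map (mirror δ),
      t ∈ substList ε δ (mirror δ ⟨κ, false, 0⟩) := by
  decide +kernel

theorem subst_mirror (ε δ : Bool) (κ : Kind) (hκ : κ.HasRule) :
    subst ε δ (mirror δ ⟨κ, false, 0⟩) = (subst ε δ ⟨κ, false, 0⟩).image (mirror δ) := by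
  obtain ⟨h1, h2⟩ := substList_mirror ε δ κ hκ
  ext t
  rw [mem_subst, Finset.mem_image]
  simp only [mem_subst, ← List.mem_map]
  exact ⟨h1 t, h2 t⟩

/-! ### Marked edges -/

/-- A directed side of a marked triangle: `lat p j x y` is the lattice edge from `p` to
`p + d_j` with end marks `x` and `y`; `leg p j x out` joins the corner `p` with mark `x` to the
centre of the square on `d_j, d_{j+3}`, directed to the centre if `out`; `diag p j x z` is the
diagonal of the square on `d_j, d_{j+3}` from `p`. -/
inductive Edge where
  | lat (p : Addr) (j : Fin 12) (x y : Bool)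
  | leg (p : Addr) (j : Fin 12) (x out : Bool)
  | diag (p : Addr) (j : Fin 12) (x z : Bool)
  deriving DecidableEq

/-- The same side in the other direction. -/
def Edge.rev : Edge → Edge
  | .lat p j x y => .lat (p + dir j) (j + 6) y x
  | .leg p j x o => .leg p j x (!o)
  | .diag p j x z => .diag (p + dir j + dir (j + 3 : Fin 12)) (j + 6) z x

/-- Rotation of direction indices by a half turn (if `r`). -/
def turnIdx (r : Bool) (j : Fin 12) : Fin 12 := if r then j + 6 else j

/-- The half turn (if `r`) followed by the translation by `q`, on edges. -/
def Edge.act (r : Bool) (q : Addr) : Edge → Edge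
  | .lat p j x y => .lat (q + halfTurn r p) (turnIdx r j) x y
  | .leg p j x o => .leg (q + halfTurn r p) (turnIdx r j) x o
  | .diag p j x z => .diag (q + halfTurn r p) (turnIdx r j) x z

/-- The index of the first direction of an unrotated triangle. -/
def Kind.idx (δ : Bool) (κ : Kind) : Fin 12 := Fin.ofNat 12 (κ.firstDir δ)

/-- The sides of an unrotated triangle at the origin, counterclockwise. -/
def Kind.edges (δ : Bool) (κ : Kind) : List Edge :=
  let j := κ.idx δ
  match κ with
  | .tri _ x y z => [.lat 0 j x y, .lat (dir j) (j + 4) y z, .lat (dir (j + 2 : Fin 12)) (j + 8) z x]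
  | .quarter _ x y => [.lat 0 j x y, .leg (dir j) (j + 3) y true, .leg 0 j x false]
  | .half _ x y z => [.lat 0 j x y, .lat (dir j) (j + 3) y z,
      .diag (dir j + dir (j + 3 : Fin 12)) (j + 6) z x]

/-- The sides of a placed triangle, counterclockwise. -/
def LTile.edges (δ : Bool) (t : LTile) : List Edge :=
  (t.kind.edges δ).map (Edge.act t.rot t.pos)

/-- The path from the centre `0` of a wheel marked `c` to its rim vertex between the directions
`i` and `i + 1`, which is marked `m`. -/
def spoke (ε c : Bool) (i : Fin 12) (m : Bool) : List Edge :=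
  if decide (i.val % 2 = 1) = c then
    [.lat 0 (i + 1) (c ^^ ε) c, .lat (dir (i + 1 : Fin 12)) i c m]
  else
    [.lat 0 i (c ^^ ε) c, .lat (dir i) (i + 1) c m]

/-- A path in the other direction. -/
def revPath (l : List Edge) : List Edge := (l.map Edge.rev).reverse

/-- The path that replaces an edge from the origin. -/
def subEdgeZero (ε : Bool) : Edge → List Edge
  | .lat _ j x y =>
    let m := edgeMark x y j
    spoke ε x (if x then j else j + 11) m ++
      (if x = y then
        if x then [.lat (rim 0 j) (j + 9) m m] else [.lat (rim 0 (j + 11 : Fin 12)) (j + 3) m m]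
      else []) ++
      revPath ((spoke ε y (if y then j + 6 else j + 5) m).map (Edge.act false (inflate (dir j))))
  | .leg _ j x o =>
    let l := spoke ε x (j + 1) (!x) ++ [.leg (rim 0 (j + 1 : Fin 12)) j (!x) true]
    if o then l else revPath l
  | .diag _ j x z =>
    spoke ε x (j + 1) (!x) ++ [.diag (rim 0 (j + 1 : Fin 12)) j (!x) (!z)] ++
      revPath ((spoke ε z (j + 7) (!z)).map
        (Edge.act false (inflate (dir j + dir (j + 3 : Fin 12)))))

/-- The address of the first corner of an edge. -/
def Edge.base : Edge → Addr
  | .lat p _ _ _ => p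
  | .leg p _ _ _ => p
  | .diag p _ _ _ => p

/-- The path that replaces an edge. -/
def subEdge (ε : Bool) (e : Edge) : List Edge :=
  (subEdgeZero ε e).map (Edge.act false (inflate e.base))

/-- Cancel edges that occur in both directions. -/
def cancel : List Edge → List Edge
  | [] => []
  | e :: l => if e.rev ∈ cancel l then (cancel l).erase e.rev else e :: cancel l

/-- The boundary of a substituted triangle consists of the paths that replace its sides. -/
theorem cancel_boundary : ∀ (ε δ : Bool) (κ : Kind), κ.HasRule →
    cancel ((rule ε δ κ).flatMap (LTile.edges δ) ++
      ((κ.edges δ).flatMap (subEdge ε)).map Edge.rev) = [] := by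
  decide +kernel

/-! ### Sums of antisymmetric functions over boundaries -/

/-- The sum of the values of a function over a list. -/
def listSum {α : Type} (F : α → ℤ) (l : List α) : ℤ := (l.map F).sum

@[simp] theorem listSum_nil {α : Type} (F : α → ℤ) : listSum F [] = 0 := rfl

@[simp] theorem listSum_cons {α : Type} (F : α → ℤ) (a : α) (l : List α) :
    listSum F (a :: l) = F a + listSum F l := by simp [listSum]

@[simp] theorem listSum_append {α : Type} (F : α → ℤ) (l l' : List α) :
    listSum F (l ++ l') = listSum F l + listSum F l' := by simp [listSum]

theorem listSum_map {α β : Type} (F : β → ℤ) (f : α → β) (l : List α) :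
    listSum F (l.map f) = listSum (fun a => F (f a)) l := by
  simp [listSum, Function.comp_def]

theorem listSum_flatMap {α β : Type} (F : β → ℤ) (f : α → List β) (l : List α) :
    listSum F (l.flatMap f) = listSum (fun a => listSum F (f a)) l := by
  induction l with
  | nil => rfl
  | cons a l ih => simp [ih]

theorem listSum_congr {α : Type} {F G : α → ℤ} {l : List α} (h : ∀ a ∈ l, F a = G a) :
    listSum F l = listSum G l := by
  unfold listSum
  rw [List.map_congr_left h]

theorem listSum_perm {α : Type} (F : α → ℤ) {l l' : List α} (h : l.Perm l') :
    listSum F l = listSum F l' := (h.map F).sum_eq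

theorem listSum_neg {α : Type} (F : α → ℤ) (l : List α) :
    listSum (fun a => - F a) l = - listSum F l := by
  induction l with
  | nil => rfl
  | cons a l ih => simp [ih]; ring

theorem listSum_sub {α : Type} (F G : α → ℤ) (l : List α) :
    listSum (fun a => F a - G a) l = listSum F l - listSum G l := by
  induction l with
  | nil => rfl
  | cons a l ih => simp [ih]; ring

theorem listSum_eq_zero {α : Type} {F : α → ℤ} {l : List α} (h : ∀ a ∈ l, F a = 0) :
    listSum F l = 0 := by
  rw [listSum_congr h]
  induction l with
  | nil => rfl
  | cons a l ih =>
    simp only [listSum_cons, zero_add]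
    exact ih fun b hb => h b (List.mem_cons_of_mem _ hb)

/-- Functions on directed edges that change sign with the direction. -/
def Antisymm (F : Edge → ℤ) : Prop := ∀ e, F e.rev = - F e

/-- An edge and its reverse contribute opposite values. Thus one computation showing that `cancel`
returns the empty list proves an identity for all antisymmetric functions at once. -/
theorem listSum_cancel {F : Edge → ℤ} (hF : Antisymm F) (l : List Edge) :
    listSum F (cancel l) = listSum F l := by
  induction l with
  | nil => rfl
  | cons e l ih =>
    rw [cancel]
    split_ifs with h
    · have := listSum_perm F (List.perm_cons_erase h)
      rw [listSum_cons, hF] at this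
      rw [listSum_cons]
      linarith
    · simp [ih]

theorem listSum_map_rev {F : Edge → ℤ} (hF : Antisymm F) (l : List Edge) :
    listSum F (l.map Edge.rev) = - listSum F l := by
  rw [listSum_map, ← listSum_neg]
  exact listSum_congr fun e _ => hF e

/-! ### Compatibility of edges and their substitution with translations and the half turn. -/

theorem dir_add_six : ∀ j : Fin 12, dir (j + 6 : Fin 12) = - dir j := by decide +kernel

theorem dir_add_nine : ∀ j : Fin 12, dir (j + 9 : Fin 12) = - dir (j + 3 : Fin 12) := by
  decide +kernel

theorem add_six_add_six (j : Fin 12) : j + 6 + 6 = j := by revert j; decide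

theorem add_six_add_three (j : Fin 12) : j + 6 + 3 = j + 9 := by revert j; decide

theorem Edge.rev_rev (e : Edge) : e.rev.rev = e := by
  cases e <;> simp [Edge.rev, dir_add_six, dir_add_nine, add_six_add_six, add_six_add_three]
  abel

theorem Edge.act_act (r r' : Bool) (q q' : Addr) (e : Edge) :
    (e.act r' q').act r q = e.act (r ^^ r') (q + halfTurn r q') := by
  cases e <;> cases r <;> cases r' <;>
    simp [Edge.act, halfTurn, turnIdx, add_six_add_six] <;> abel

theorem Edge.rev_act (r : Bool) (q : Addr) (e : Edge) : (e.act r q).rev = e.rev.act r q := by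
  cases e <;> cases r <;>
    simp [Edge.act, Edge.rev, halfTurn, turnIdx, dir_add_six, dir_add_nine,
      add_six_add_three] <;> abel

theorem Antisymm.act {F : Edge → ℤ} (hF : Antisymm F) (r : Bool) (q : Addr) :
    Antisymm fun e => F (e.act r q) := fun e => by
  rw [← hF, Edge.rev_act]

theorem LTile.edges_act (δ r : Bool) (q : Addr) (t : LTile) :
    (t.act r q).edges δ = (t.edges δ).map (Edge.act r q) := by
  simp only [LTile.edges, LTile.act, List.map_map]
  refine List.map_congr_left fun e _ => ?_
  simp only [Function.comp, Edge.act_act]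

theorem turn_add (p q : Addr) : turn (p + q) = turn p + turn q := by
  obtain ⟨a, b, c, d⟩ := p
  obtain ⟨a', b', c', d'⟩ := q
  simp only [turn, Prod.mk_add_mk, Prod.mk.injEq, true_and, and_true]
  constructor <;> ring

theorem turn_iterate_add (n : ℕ) (p q : Addr) : turn^[n] (p + q) = turn^[n] p + turn^[n] q := by
  induction n generalizing p q with
  | zero => rfl
  | succ n ih => simp only [Function.iterate_succ, Function.comp, turn_add, ih]

theorem inflate_add (p q : Addr) : inflate (p + q) = inflate p + inflate q := by
  simp only [inflate, turn_add, turn_iterate_add]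
  abel

theorem inflate_zero : inflate 0 = 0 := by decide

theorem inflate_neg (p : Addr) : inflate (-p) = - inflate p := by
  have := inflate_add p (-p)
  rw [add_neg_cancel, inflate_zero] at this
  exact (neg_eq_of_add_eq_zero_right this.symm).symm

theorem inflate_halfTurn (r : Bool) (p : Addr) : inflate (halfTurn r p) = halfTurn r (inflate p) := by
  cases r <;> simp [halfTurn, inflate_neg]

theorem subEdgeZero_lat_halfTurn : ∀ (ε : Bool) (j : Fin 12) (x y : Bool),
    subEdgeZero ε (.lat 0 (j + 6) x y) = (subEdgeZero ε (.lat 0 j x y)).map (Edge.act true 0) := by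
  decide +kernel

theorem subEdgeZero_leg_halfTurn : ∀ (ε : Bool) (j : Fin 12) (x y : Bool),
    subEdgeZero ε (.leg 0 (j + 6) x y) = (subEdgeZero ε (.leg 0 j x y)).map (Edge.act true 0) := by
  decide +kernel

theorem subEdgeZero_diag_halfTurn : ∀ (ε : Bool) (j : Fin 12) (x y : Bool),
    subEdgeZero ε (.diag 0 (j + 6) x y) =
      (subEdgeZero ε (.diag 0 j x y)).map (Edge.act true 0) := by
  decide +kernel

theorem Edge.act_false_zero (e : Edge) : e.act false 0 = e := by
  cases e <;> simp [Edge.act, halfTurn, turnIdx]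

/-- `subEdgeZero` ignores the base of the edge, so the translation part disappears and only the half
turn needs the three finite checks above. -/
theorem subEdgeZero_act (ε r : Bool) (q : Addr) (e : Edge) :
    subEdgeZero ε (e.act r q) = (subEdgeZero ε e).map (Edge.act r 0) := by
  cases r
  · have : (subEdgeZero ε e).map (Edge.act false 0) = subEdgeZero ε e := by
      conv_rhs => rw [← List.map_id (subEdgeZero ε e)]
      exact List.map_congr_left fun e _ => Edge.act_false_zero e
    rw [this]
    cases e <;> rfl
  · cases e with
    | lat p j x y => exact subEdgeZero_lat_halfTurn ε j x y
    | leg p j x y => exact subEdgeZero_leg_halfTurn ε j x y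
    | diag p j x y => exact subEdgeZero_diag_halfTurn ε j x y

theorem Edge.base_act (r : Bool) (q : Addr) (e : Edge) :
    (e.act r q).base = q + halfTurn r e.base := by
  cases e <;> rfl

theorem subEdge_act (ε r : Bool) (q : Addr) (e : Edge) :
    subEdge ε (e.act r q) = (subEdge ε e).map (Edge.act r (inflate q)) := by
  simp only [subEdge, subEdgeZero_act, Edge.base_act, List.map_map]
  refine List.map_congr_left fun f _ => ?_
  simp only [Function.comp, Edge.act_act, inflate_add, inflate_halfTurn]
  congr 1
  · cases r <;> rfl
  · simp [halfTurn]

/-! ### The Stokes formula for one substituted triangle. -/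

theorem listSum_boundary_rule {F : Edge → ℤ} (hF : Antisymm F) (ε δ : Bool) {κ : Kind}
    (hκ : κ.HasRule) :
    listSum F ((rule ε δ κ).flatMap (LTile.edges δ)) =
      listSum F ((κ.edges δ).flatMap (subEdge ε)) := by
  have h := listSum_cancel hF ((rule ε δ κ).flatMap (LTile.edges δ) ++
      ((κ.edges δ).flatMap (subEdge ε)).map Edge.rev)
  rw [cancel_boundary ε δ κ hκ, listSum_append, listSum_map_rev hF, listSum_nil] at h
  linarith

/-- The boundary of a substituted triangle, evaluated on an antisymmetric function. -/
theorem listSum_boundary {F : Edge → ℤ} (hF : Antisymm F) (ε δ : Bool) {t : LTile}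
    (ht : t.kind.HasRule) :
    listSum (fun s => listSum F (s.edges δ)) (substList ε δ t) =
      listSum (fun e => listSum F (subEdge ε e)) (t.edges δ) := by
  have h := listSum_boundary_rule (hF.act t.rot (inflate t.pos)) ε δ ht
  rw [listSum_flatMap, listSum_flatMap] at h
  rw [substList, listSum_map, LTile.edges, listSum_map]
  simp only [LTile.edges_act, subEdge_act, listSum_map]
  exact h

theorem subEdge_rev_lat : ∀ (ε : Bool) (j : Fin 12) (x y : Bool),
    cancel (subEdge ε (Edge.lat 0 j x y).rev ++ subEdge ε (.lat 0 j x y)) = [] := by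
  decide +kernel

theorem subEdge_rev_diag : ∀ (ε : Bool) (j : Fin 12) (x y : Bool),
    cancel (subEdge ε (Edge.diag 0 j x y).rev ++ subEdge ε (.diag 0 j x y)) = [] := by
  decide +kernel

theorem subEdge_rev_leg : ∀ (ε : Bool) (j : Fin 12) (x y : Bool),
    cancel (subEdge ε (Edge.leg 0 j x y).rev ++ subEdge ε (.leg 0 j x y)) = [] := by
  decide +kernel

/-- The paths of an edge and of its reverse cancel each other; this is checked at the origin and
carried over by translation. It allows an antisymmetric function to be pulled back along the
substitution, which drives the induction of `listSum_iter_wheel`. -/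
theorem antisymm_listSum_subEdge {F : Edge → ℤ} (hF : Antisymm F) (ε : Bool) :
    Antisymm fun e => listSum F (subEdge ε e) := fun e => by
  obtain ⟨e₀, he, h⟩ : ∃ e₀ : Edge, e = e₀.act false e.base ∧
      cancel (subEdge ε e₀.rev ++ subEdge ε e₀) = [] := by
    cases e with
    | lat p j x y => exact ⟨.lat 0 j x y, by simp [Edge.act, Edge.base, halfTurn, turnIdx],
        subEdge_rev_lat ε j x y⟩
    | leg p j x y => exact ⟨.leg 0 j x y, by simp [Edge.act, Edge.base, halfTurn, turnIdx],
        subEdge_rev_leg ε j x y⟩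
    | diag p j x y => exact ⟨.diag 0 j x y, by simp [Edge.act, Edge.base, halfTurn, turnIdx],
        subEdge_rev_diag ε j x y⟩
  have h' := listSum_cancel (hF.act false (inflate e.base))
    (subEdge ε e₀.rev ++ subEdge ε e₀)
  rw [h, listSum_nil, listSum_append] at h'
  have h1 : subEdge ε e.rev = (subEdge ε e₀.rev).map (Edge.act false (inflate e.base)) := by
    conv_lhs => rw [he, Edge.rev_act, subEdge_act]
  have h2 : subEdge ε e = (subEdge ε e₀).map (Edge.act false (inflate e.base)) := by
    conv_lhs => rw [he, subEdge_act]
  show listSum F (subEdge ε e.rev) = - listSum F (subEdge ε e)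
  rw [h1, h2, listSum_map, listSum_map]
  linarith

/-! ### The two embeddings of the lattice -/

/-- The position of an address in the square-triangle tiling (turned by `-15°`). -/
noncomputable def phys (p : Addr) : ℂ :=
  ⟨p.1 + p.2.2.1 / 2 + p.2.1 * (√3 / 2), p.2.1 / 2 + p.2.2.1 * (√3 / 2) + p.2.2.2⟩

/-- The conjugate position, with `√3` replaced by `-√3`. -/
noncomputable def internal (p : Addr) : ℂ :=
  ⟨p.1 + p.2.2.1 / 2 - p.2.1 * (√3 / 2), p.2.1 / 2 - p.2.2.1 * (√3 / 2) + p.2.2.2⟩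

theorem phys_add (p q : Addr) : phys (p + q) = phys p + phys q := by
  apply Complex.ext <;> simp [phys] <;> ring

theorem internal_add (p q : Addr) : internal (p + q) = internal p + internal q := by
  apply Complex.ext <;> simp [internal] <;> ring

theorem phys_neg (p : Addr) : phys (-p) = - phys p := by
  apply Complex.ext <;> simp [phys] <;> ring

theorem internal_neg (p : Addr) : internal (-p) = - internal p := by
  apply Complex.ext <;> simp [internal] <;> ring

/-! ### Inflation, lengths and the reshaping in terms of the two embeddings. -/

theorem inflate_eq (a b c d : ℤ) :
    inflate (a, b, c, d) = (2 * a + b - d, 2 * a + 2 * b + c, b + 2 * c + 2 * d, 2 * d + c - a) := by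
  simp only [inflate, turn, Function.iterate_succ, Function.iterate_zero, Function.comp, id,
    Prod.mk_add_mk, Prod.mk.injEq]
  refine ⟨?_, ?_, ?_, ?_⟩ <;> ring

theorem sqrt_three_sq : √3 * √3 = 3 := Real.mul_self_sqrt (by norm_num)

theorem phys_inflate (p : Addr) : phys (inflate p) = ((2 + √3 : ℝ) : ℂ) * phys p := by
  obtain ⟨a, b, c, d⟩ := p
  rw [inflate_eq]
  apply Complex.ext <;> simp [phys] <;> ring_nf <;> simp <;> ring

theorem internal_inflate (p : Addr) : internal (inflate p) = ((2 - √3 : ℝ) : ℂ) * internal p := by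
  obtain ⟨a, b, c, d⟩ := p
  rw [inflate_eq]
  apply Complex.ext <;> simp [internal] <;> ring_nf <;> simp <;> ring

/-- The rational part of the squared length. -/
def ratPart (p : Addr) : ℤ :=
  p.1 * p.1 + p.2.1 * p.2.1 + p.2.2.1 * p.2.2.1 + p.2.2.2 * p.2.2.2 + p.1 * p.2.2.1 +
    p.2.1 * p.2.2.2

/-- The coefficient of `√3` in the squared length. -/
def irrPart (p : Addr) : ℤ := p.1 * p.2.1 + p.2.1 * p.2.2.1 + p.2.2.1 * p.2.2.2

theorem norm_phys_sq (p : Addr) : ‖phys p‖ ^ 2 = ratPart p + irrPart p * √3 := by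
  rw [← Complex.normSq_eq_norm_sq, Complex.normSq_apply]
  simp only [phys, ratPart, irrPart]
  push_cast
  linear_combination (p.2.1 ^ 2 / 4 + p.2.2.1 ^ 2 / 4 : ℝ) * sqrt_three_sq

theorem norm_internal_sq (p : Addr) : ‖internal p‖ ^ 2 = ratPart p - irrPart p * √3 := by
  rw [← Complex.normSq_eq_norm_sq, Complex.normSq_apply]
  simp only [internal, ratPart, irrPart]
  push_cast
  linear_combination (p.2.1 ^ 2 / 4 + p.2.2.1 ^ 2 / 4 : ℝ) * sqrt_three_sq

theorem sqrt_three_bounds : 1.73205 < √3 ∧ √3 < 1.73206 :=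
  ⟨Real.lt_sqrt_of_sq_lt (by norm_num), (Real.sqrt_lt' (by norm_num)).2 (by norm_num)⟩

/-- A sufficient condition for `u + v √3 ≤ 0`. -/
def surdNonpos (u v : ℤ) : Prop := 100000 * u + 173205 * v ≤ 0 ∧ 100000 * u + 173206 * v ≤ 0

instance (u v : ℤ) : Decidable (surdNonpos u v) := inferInstanceAs (Decidable (_ ∧ _))

/-- The expression is affine in `√3`, so it suffices to test it at the two decimal bounds; the sign
of `v` decides which one is relevant. This makes the length estimates below decidable. -/
theorem surdNonpos.le {u v : ℤ} (h : surdNonpos u v) : (u : ℝ) + v * √3 ≤ 0 := by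
  obtain ⟨h1, h2⟩ := h
  have h1' : (100000 * u + 173205 * v : ℝ) ≤ 0 := by exact_mod_cast h1
  have h2' : (100000 * u + 173206 * v : ℝ) ≤ 0 := by exact_mod_cast h2
  obtain ⟨h3, h4⟩ := sqrt_three_bounds
  rcases le_total (0 : ℝ) v with hv | hv <;> nlinarith

/-- The factors of the reshaping along the two embeddings. -/
noncomputable def physFactor : ℂ := ⟨1 / 2 + √3 / 3, √3 / 6⟩

/-- The factor of the reshaping along the conjugate embedding. -/
noncomputable def internalFactor : ℂ := ⟨1 / 2 - √3 / 3, - (√3 / 6)⟩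

/-- A general additive map to `ℂ` would also involve the complex conjugates of both embeddings; here
they do not occur. As `internal` is bounded on the vertices of interest, the reshaped picture stays
within bounded distance of a similar copy of the square-triangle picture. -/
theorem reshape_eq (p : Addr) :
    reshape p = physFactor * phys p + internalFactor * internal p := by
  apply Complex.ext
  · simp [reshape, physFactor, internalFactor, phys, internal]
    linear_combination (p.2.2.1 / 6 - p.2.1 / 3 : ℝ) * sqrt_three_sq
  · simp [reshape, physFactor, internalFactor, phys, internal]
    linear_combination (- (p.2.1 / 6 + p.2.2.1 / 3) : ℝ) * sqrt_three_sq

theorem le_norm_physFactor : 1.115 ≤ ‖physFactor‖ := by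
  refine le_of_sq_le_sq ?_ (norm_nonneg _)
  rw [← Complex.normSq_eq_norm_sq, Complex.normSq_apply]
  simp only [physFactor]
  nlinarith [sqrt_three_bounds.1, sqrt_three_sq]

theorem norm_internalFactor_le : ‖internalFactor‖ ≤ 0.3 := by
  refine le_of_sq_le_sq ?_ (by norm_num)
  rw [← Complex.normSq_eq_norm_sq, Complex.normSq_apply]
  simp only [internalFactor]
  nlinarith [sqrt_three_bounds.1, sqrt_three_sq]

theorem norm_reshape_ge (p : Addr) : 1.115 * ‖phys p‖ - 0.3 * ‖internal p‖ ≤ ‖reshape p‖ := by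
  have h1 : ‖physFactor * phys p‖ ≤ ‖reshape p‖ + ‖internalFactor * internal p‖ := by
    have : physFactor * phys p = reshape p - internalFactor * internal p := by
      rw [reshape_eq]; ring
    rw [this]
    exact norm_sub_le _ _
  rw [norm_mul, norm_mul] at h1
  have h2 := mul_le_mul_of_nonneg_right le_norm_physFactor (norm_nonneg (phys p))
  have h3 := mul_le_mul_of_nonneg_right norm_internalFactor_le (norm_nonneg (internal p))
  linarith

theorem norm_phys_halfTurn (r : Bool) (p : Addr) : ‖phys (halfTurn r p)‖ = ‖phys p‖ := by
  cases r <;> simp [halfTurn, phys_neg]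

theorem norm_internal_halfTurn (r : Bool) (p : Addr) :
    ‖internal (halfTurn r p)‖ = ‖internal p‖ := by
  cases r <;> simp [halfTurn, internal_neg]

theorem norm_phys_inflate_add (p q : Addr) :
    (2 + √3) * ‖phys p‖ - ‖phys q‖ ≤ ‖phys (inflate p + q)‖ := by
  rw [phys_add, phys_inflate]
  have h := norm_sub_le (((2 + √3 : ℝ) : ℂ) * phys p + phys q) (phys q)
  rw [add_sub_cancel_right, norm_mul, Complex.norm_real, Real.norm_of_nonneg (by positivity)] at h
  linarith

/-- The bound 1.9 reproduces itself because `(2 - √3) * 1.9 + 1.37 < 1.9`, where 1.37 bounds the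
conjugates of all offsets in the rules. -/
theorem norm_internal_inflate_add {p q : Addr} (hp : ‖internal p‖ ≤ 1.9)
    (hq : ‖internal q‖ ≤ 1.37) : ‖internal (inflate p + q)‖ ≤ 1.9 := by
  rw [internal_add, internal_inflate]
  refine (norm_add_le _ _).trans ?_
  obtain ⟨h1, h2⟩ := sqrt_three_bounds
  rw [norm_mul, Complex.norm_real, Real.norm_of_nonneg (by linarith)]
  nlinarith [norm_nonneg (internal p)]

/-! ### Bounds for the offsets in the rules -/

/-- The squared conjugate length is at most `1.37²`. -/
def SmallInternal (p : Addr) : Prop := surdNonpos (10000 * ratPart p - 18769) (- 10000 * irrPart p)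

instance (p : Addr) : Decidable (SmallInternal p) := inferInstanceAs (Decidable (surdNonpos _ _))

theorem SmallInternal.norm_le {p : Addr} (h : SmallInternal p) : ‖internal p‖ ≤ 1.37 := by
  refine le_of_sq_le_sq ?_ (by norm_num)
  rw [norm_internal_sq]
  have := surdNonpos.le h
  push_cast at this
  linarith

/-- The physical bound is `14 + 8√3 = (1 + √3)² (2 + √3)`, that is, `1 + √3` times the radius `√(2 +
√3)` of the rim of a wheel. It is exactly what keeps far triangles far. -/
theorem rule_offsets : ∀ (ε δ : Bool) (κ : Kind), κ.HasRule → ∀ s ∈ rule ε δ κ,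
    surdNonpos (ratPart s.pos - 14) (irrPart s.pos - 8) ∧ SmallInternal s.pos := by
  decide +kernel

/-- Lattice edges. -/
def Edge.isLat : Edge → Bool
  | .lat _ _ _ _ => true
  | _ => false

theorem subEdgeZero_offsets : ∀ (ε : Bool) (j : Fin 12) (x y : Bool),
    ∀ e ∈ subEdgeZero ε (.lat 0 j x y), e.isLat = true ∧
      surdNonpos (ratPart e.base - 9) (irrPart e.base) ∧ SmallInternal e.base := by
  decide +kernel

/-! ### Wheels and the patches that grow from them -/

/-- The complete wheel around the origin, with rim vertices marked opposite to the inner ones. -/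
def wheel (ε δ c : Bool) : List LTile :=
  (List.range 12).flatMap fun j => wheelPart ε δ 0 c j (!c) (!c)

/-- The boundary of the wheel. -/
def rimEdges (c : Bool) : List Edge :=
  (List.finRange 12).map fun j => .lat (rim 0 (j + 11 : Fin 12)) (j + 3) (!c) (!c)

/-- Apply the rules `n` times to a list of marked triangles. -/
def iter (ε δ : Bool) (l : List LTile) : ℕ → List LTile
  | 0 => l
  | n + 1 => (iter ε δ l n).flatMap (substList ε δ)

/-- The boundary of the `n`-th patch that grows from a wheel. -/
def boundary (ε c : Bool) : ℕ → List Edge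
  | 0 => rimEdges c
  | n + 1 => (boundary ε c n).flatMap (subEdge ε)

theorem iter_succ' (ε δ : Bool) (l : List LTile) (n : ℕ) :
    iter ε δ l (n + 1) = iter ε δ (l.flatMap (substList ε δ)) n := by
  induction n with
  | zero => rfl
  | succ n ih => rw [iter, ih]; rfl

theorem iter_append (ε δ : Bool) (l l' : List LTile) (n : ℕ) :
    iter ε δ (l ++ l') n = iter ε δ l n ++ iter ε δ l' n := by
  induction n with
  | zero => rfl
  | succ n ih => simp only [iter, ih, List.flatMap_append]

theorem iter_perm (ε δ : Bool) {l l' : List LTile} (h : l.Perm l') (n : ℕ) :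
    (iter ε δ l n).Perm (iter ε δ l' n) := by
  induction n with
  | zero => exact h
  | succ n ih => exact ih.flatMap_right _

theorem iter_subset (ε δ : Bool) {l l' : List LTile} (h : l ⊆ l') (n : ℕ) :
    iter ε δ l n ⊆ iter ε δ l' n := by
  induction n with
  | zero => exact h
  | succ n ih =>
    intro t ht
    simp only [iter, List.mem_flatMap] at ht ⊢
    obtain ⟨s, hs, hst⟩ := ht
    exact ⟨s, ih hs, hst⟩

theorem iter_iter (ε δ : Bool) (l : List LTile) (m n : ℕ) :
    iter ε δ (iter ε δ l m) n = iter ε δ l (m + n) := by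
  induction n with
  | zero => rfl
  | succ n ih => rw [iter, ih]; rfl

/-- A property of triangles inherited by their substitutes. -/
theorem iter_forall {ε δ : Bool} {P : LTile → Prop}
    (hP : ∀ t, P t → ∀ s ∈ substList ε δ t, P s) {l : List LTile} (hl : ∀ t ∈ l, P t) (n : ℕ) :
    ∀ t ∈ iter ε δ l n, P t := by
  induction n with
  | zero => exact hl
  | succ n ih =>
    intro s hs
    obtain ⟨t, ht, hst⟩ := List.mem_flatMap.1 hs
    exact hP t (ih t ht) s hst

/-- Triangles that have a rule and whose first corner has a small conjugate. -/
def LTile.Good (t : LTile) : Prop := t.kind.HasRule ∧ ‖internal t.pos‖ ≤ 1.9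

theorem LTile.Good.subst {ε δ : Bool} (t : LTile) (ht : t.Good) :
    ∀ s ∈ substList ε δ t, s.Good := by
  intro s hs
  obtain ⟨u, hu, rfl⟩ := List.mem_map.1 hs
  refine ⟨hasRule_of_mem_rule ε δ t.kind ht.1 u hu, norm_internal_inflate_add ht.2 ?_⟩
  rw [norm_internal_halfTurn]
  exact (rule_offsets ε δ t.kind ht.1 u hu).2.norm_le

theorem wheel_table : ∀ (ε δ c : Bool), ∀ t ∈ wheel ε δ c,
    t.kind.HasRule ∧ SmallInternal t.pos := by decide +kernel

theorem wheel_good (ε δ c : Bool) : ∀ t ∈ wheel ε δ c, t.Good := fun t ht =>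
  ⟨(wheel_table ε δ c t ht).1, (wheel_table ε δ c t ht).2.norm_le.trans (by norm_num)⟩

theorem iter_wheel_good (ε δ c : Bool) (n : ℕ) : ∀ t ∈ iter ε δ (wheel ε δ c) n, t.Good :=
  iter_forall LTile.Good.subst (wheel_good ε δ c) n

theorem cancel_wheel : ∀ (ε δ c : Bool),
    cancel ((wheel ε δ c).flatMap (LTile.edges δ) ++ (rimEdges c).map Edge.rev) = [] := by
  decide +kernel

/-- The discrete Stokes formula for patches of all levels. Only the wheel itself and the single
rules were checked by computation. -/
theorem listSum_iter_wheel {F : Edge → ℤ} (hF : Antisymm F) (ε δ c : Bool) (n : ℕ) :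
    listSum (fun t => listSum F (t.edges δ)) (iter ε δ (wheel ε δ c) n) =
      listSum F (boundary ε c n) := by
  induction n generalizing F with
  | zero =>
    have h := listSum_cancel hF ((wheel ε δ c).flatMap (LTile.edges δ) ++
      (rimEdges c).map Edge.rev)
    rw [cancel_wheel, listSum_append, listSum_map_rev hF, listSum_nil, listSum_flatMap] at h
    show listSum _ (wheel ε δ c) = listSum F (rimEdges c)
    linarith
  | succ n ih =>
    -- The induction hypothesis is used for the pulled-back function, whose value at an edge is the
    -- sum of `F` over the substituted path.
    rw [iter, boundary, listSum_flatMap, listSum_flatMap, ← ih (antisymm_listSum_subEdge hF ε)]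
    exact listSum_congr fun t ht => listSum_boundary hF ε δ (iter_wheel_good ε δ c n t ht).1

theorem rimEdges_table : ∀ (c : Bool), ∀ e ∈ rimEdges c, e.isLat = true ∧
    SmallInternal e.base ∧ ratPart e.base = 2 ∧ irrPart e.base = 1 := by
  decide +kernel

/-- The boundary recedes from the origin. -/
theorem boundary_far (ε c : Bool) (n : ℕ) : ∀ e ∈ boundary ε c n, e.isLat = true ∧
    1.9 + 2 * n ≤ ‖phys e.base‖ ∧ ‖internal e.base‖ ≤ 1.9 := by
  induction n with
  | zero =>
    intro e he
    obtain ⟨h1, h2, h3, h4⟩ := rimEdges_table c e he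
    refine ⟨h1, le_of_sq_le_sq ?_ (norm_nonneg _), h2.norm_le.trans (by norm_num)⟩
    rw [norm_phys_sq, h3, h4]
    norm_num
    linarith [sqrt_three_bounds.1]
  | succ n ih =>
    intro e he
    obtain ⟨e', he', h⟩ := List.mem_flatMap.1 he
    obtain ⟨h1, h2, h3⟩ := ih e' he'
    obtain ⟨f, hf, rfl⟩ := List.mem_map.1 h
    cases e' with
    | leg => simp [Edge.isLat] at h1
    | diag => simp [Edge.isLat] at h1
    | lat p j x y =>
      obtain ⟨h4, h5, h6⟩ := subEdgeZero_offsets ε j x y f hf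
      refine ⟨?_, ?_, ?_⟩
      · cases f <;> simp_all [Edge.isLat, Edge.act]
      · rw [Edge.base_act]
        have h7 := norm_phys_inflate_add p f.base
        have h8 : ‖phys f.base‖ ≤ 3 := by
          refine le_of_sq_le_sq ?_ (by norm_num)
          rw [norm_phys_sq]
          have := h5.le
          push_cast at this
          linarith
        have h9 : (1.9 : ℝ) + 2 * n ≤ ‖phys p‖ := h2
        show _ ≤ ‖phys (inflate p + f.base)‖
        push_cast
        have := sqrt_three_bounds.1
        -- `(2 + √3) r - 3 ≥ r + 2` as soon as `r ≥ 1.9`.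
        nlinarith
      · rw [Edge.base_act]
        exact norm_internal_inflate_add h3 h6.norm_le

/-- By `norm_reshape_ge`, since `1.115 * (1.9 + 2 n) - 0.3 * 1.9 ≥ 1 + 2 n`. -/
theorem norm_reshape_boundary (ε c : Bool) (n : ℕ) : ∀ e ∈ boundary ε c n,
    1 + 2 * n ≤ ‖reshape e.base‖ := by
  intro e he
  obtain ⟨-, h1, h2⟩ := boundary_far ε c n e he
  have := norm_reshape_ge e.base
  have : (0 : ℝ) ≤ n := n.cast_nonneg
  linarith

/-! ### Triangles that stay away from the origin -/

/-- The first corner is at least as far from the origin as the rim of the wheel. -/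
def LTile.IsFar (t : LTile) : Prop := surdNonpos (2 - ratPart t.pos) (1 - irrPart t.pos)

instance (t : LTile) : Decidable t.IsFar := inferInstanceAs (Decidable (surdNonpos _ _))

/-- With `ρ = √(2 + √3)`, a corner at distance at least `ρ` moves to distance at least `(2 + √3) ρ`,
and the offset takes away at most `(1 + √3) ρ`, which leaves `ρ`. -/
theorem LTile.Good.norm_phys_subst {ε δ : Bool} {t : LTile} (ht : t.Good)
    (h : 2 + √3 ≤ ‖phys t.pos‖ ^ 2) : ∀ s ∈ substList ε δ t, 2 + √3 ≤ ‖phys s.pos‖ ^ 2 := by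
  intro s hs
  obtain ⟨u, hu, rfl⟩ := List.mem_map.1 hs
  have h1 := norm_phys_inflate_add t.pos (halfTurn t.rot u.pos)
  rw [norm_phys_halfTurn] at h1
  have h2 := (rule_offsets ε δ t.kind ht.1 u hu).1.le
  push_cast at h2
  have h3 : 0 ≤ √3 := Real.sqrt_nonneg _
  set ρ := √(2 + √3) with hρ
  have hρ2 : ρ ^ 2 = 2 + √3 := Real.sq_sqrt (by positivity)
  have hρ0 : 0 ≤ ρ := Real.sqrt_nonneg _
  have h4 : ‖phys u.pos‖ ≤ (1 + √3) * ρ := by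
    refine le_of_sq_le_sq ?_ (by positivity)
    rw [norm_phys_sq, mul_pow, hρ2]
    nlinarith [sqrt_three_sq]
  have h5 : ρ ≤ ‖phys t.pos‖ := by
    refine le_of_sq_le_sq ?_ (norm_nonneg _)
    rwa [hρ2]
  have h6 : ρ ≤ ‖phys (inflate t.pos + halfTurn t.rot u.pos)‖ := by nlinarith
  rw [← hρ2]
  exact pow_le_pow_left₀ hρ0 h6 2

/-- Descendants of far triangles do not come close to the origin. -/
theorem norm_reshape_iter_far {ε δ : Bool} {l : List LTile} (hl : ∀ t ∈ l, t.Good)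
    (hfar : ∀ t ∈ l, t.IsFar) (n : ℕ) : ∀ t ∈ iter ε δ l n, 1.5 < ‖reshape t.pos‖ := by
  have h := iter_forall (ε := ε) (δ := δ) (P := fun t => t.Good ∧ 2 + √3 ≤ ‖phys t.pos‖ ^ 2)
    (fun t ht s hs => ⟨LTile.Good.subst t ht.1 s hs, ht.1.norm_phys_subst ht.2 s hs⟩)
    (l := l) (fun t ht => ⟨hl t ht, by
      have := surdNonpos.le (hfar t ht)
      rw [norm_phys_sq]
      push_cast at this
      linarith⟩) n
  intro t ht
  obtain ⟨h1, h2⟩ := h t ht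
  have h3 : 1.93 ≤ ‖phys t.pos‖ := by
    refine le_of_sq_le_sq ?_ (norm_nonneg _)
    linarith [sqrt_three_bounds.1]
  have := norm_reshape_ge t.pos
  linarith [h1.2]

/-- The triangles of the wheel whose first corner is not on the rim. -/
def hub (ε δ c : Bool) : List LTile := (wheel ε δ c).filter fun t => ¬ t.IsFar

/-- The centre of the wheel marked `c` carries the mark `c ^^ ε` and is itself replaced by a wheel
with that inner mark. Apart from triangles that are already far, the substituted hub is therefore
again a hub. -/
theorem hub_subst : ∀ (ε δ c : Bool),
    (((hub ε δ c).flatMap (substList ε δ)).filter fun t => ¬ t.IsFar).Perm (hub ε δ (c ^^ ε)) := by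
  decide +kernel

/-- The edges at the centre have end marks `c ^^ ε` and `c` and a parity different from `c`. The
opposite of their majority is `!(c ^^ ε)` in both cases, so the rim of the new wheel has the marks
that `wheel` requires. -/
theorem wheel_subset : ∀ (ε δ c : Bool),
    wheel ε δ (c ^^ ε) ⊆ (wheel ε δ c).flatMap (substList ε δ) := by
  decide +kernel

/-! ### The corners of a triangle in the lattice

All corners are doubled, so that the centres of squares are included. -/

/-- The lifted corner at the right angle of an unrotated triangle at the origin. -/
def Kind.apexLift (δ : Bool) : Kind → Addr
  | .tri k _ _ _ => if k then (0, 0, 0, 2) else 0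
  | .quarter k _ _ => if k then (-1, 1, 1, 0) else (-1, -1, 1, 0)
  | .half k _ _ _ =>
    if k then (if δ then (0, -2, 0, 2) else (0, 0, 2, 0))
    else (if δ then (0, 0, 0, 2) else (2, 0, 0, 0))

/-- The orientation of an unrotated triangle: in direction `i ^ k` from the right angle there is
one leg, and the other one follows counterclockwise. -/
def Kind.ori (δ : Bool) : Kind → Fin 4
  | .tri k _ _ _ => if k then 3 else 0
  | .quarter k _ _ => if k then 3 else 0
  | .half k _ _ _ => if k then (if δ then 3 else 2) else (if δ then 2 else 1)

/-- The lift of the horizontal leg, from left to right. -/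
def Kind.hor : Kind → Addr
  | .tri k _ _ _ => if k then (0, 2, 0, -2) else (2, 0, 0, 0)
  | .quarter _ _ _ => (1, 1, -1, 0)
  | .half k _ _ _ => if k then (0, 2, 0, -2) else (2, 0, 0, 0)

/-- The lift of the vertical leg, upwards. -/
def Kind.ver : Kind → Addr
  | .tri k _ _ _ => if k then (0, 0, 0, 2) else (0, 0, 2, 0)
  | .quarter _ _ _ => (-1, 1, 1, 0)
  | .half k _ _ _ => if k then (0, 0, 2, 0) else (0, 0, 0, 2)

/-- The lift of the leg in direction `i ^ k`. -/
def Kind.leg (κ : Kind) (k : Fin 4) : Addr :=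
  match k with
  | 0 => κ.hor
  | 1 => κ.ver
  | 2 => - κ.hor
  | 3 => - κ.ver

/-- The end points of an edge. -/
def Edge.ends : Edge → Addr × Addr
  | .lat p j _ _ => (p + p, p + p + (dir j + dir j))
  | .leg p j _ o =>
    if o then (p + p, p + p + (dir j + dir (j + 3 : Fin 12)))
    else (p + p + (dir j + dir (j + 3 : Fin 12)), p + p)
  | .diag p j _ _ =>
    (p + p, p + p + (dir j + dir (j + 3 : Fin 12) + (dir j + dir (j + 3 : Fin 12))))

def LTile.apexLift (δ : Bool) (t : LTile) : Addr :=
  t.pos + t.pos + halfTurn t.rot (t.kind.apexLift δ)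

def LTile.ori (δ : Bool) (t : LTile) : Fin 4 := t.kind.ori δ + if t.rot then 2 else 0

/-- The three directed sides of a triangle given by the lift `a` of its right angle, and the
lifts of its legs. -/
def sides (a u v : Addr) : List (Addr × Addr) := [(a, a + u), (a + u, a + v), (a + v, a)]

/-- This passes from the three families with their own kinds of sides to a uniform description by
right angle and legs; only the latter is used in the geometry of the square grid. -/
theorem Kind.ends_edges : ∀ (δ : Bool) (κ : Kind), ((κ.edges δ).map Edge.ends).Perm
    (sides (κ.apexLift δ) (κ.leg (κ.ori δ)) (κ.leg (κ.ori δ + 1))) := by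
  decide +kernel

theorem Kind.leg_add_two (κ : Kind) (k : Fin 4) : κ.leg (k + 2) = - κ.leg k := by
  fin_cases k <;> simp [Kind.leg]

theorem Edge.ends_act (r : Bool) (q : Addr) (e : Edge) :
    (e.act r q).ends = (q + q + halfTurn r e.ends.1, q + q + halfTurn r e.ends.2) := by
  cases e with
  | lat p j x y =>
    cases r <;> simp [Edge.act, Edge.ends, halfTurn, turnIdx, dir_add_six] <;>
      constructor <;> abel
  | leg p j x o =>
    cases r <;> cases o <;> simp [Edge.act, Edge.ends, halfTurn, turnIdx, dir_add_six,
      add_six_add_three, dir_add_nine] <;> constructor <;> abel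
  | diag p j x z =>
    cases r <;> simp [Edge.act, Edge.ends, halfTurn, turnIdx, dir_add_six,
      add_six_add_three, dir_add_nine] <;> constructor <;> abel

theorem Edge.ends_rev (e : Edge) : e.rev.ends = (e.ends.2, e.ends.1) := by
  cases e with
  | lat p j x y => simp [Edge.rev, Edge.ends, dir_add_six]; constructor <;> abel
  | leg p j x o => cases o <;> simp [Edge.rev, Edge.ends]
  | diag p j x z =>
    simp [Edge.rev, Edge.ends, dir_add_six, add_six_add_three, dir_add_nine]
    constructor <;> abel

theorem LTile.ends_edges (δ : Bool) (t : LTile) : ((t.edges δ).map Edge.ends).Perm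
    (sides (t.apexLift δ) (t.kind.leg (t.ori δ)) (t.kind.leg (t.ori δ + 1))) := by
  have h := (Kind.ends_edges δ t.kind).map fun x : Addr × Addr =>
    (t.pos + t.pos + halfTurn t.rot x.1, t.pos + t.pos + halfTurn t.rot x.2)
  rw [List.map_map] at h
  have h1 : (t.edges δ).map Edge.ends = (t.kind.edges δ).map ((fun x : Addr × Addr =>
      (t.pos + t.pos + halfTurn t.rot x.1, t.pos + t.pos + halfTurn t.rot x.2)) ∘ Edge.ends) := by
    rw [LTile.edges, List.map_map]
    exact List.map_congr_left fun e _ => Edge.ends_act _ _ e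
  rw [h1]
  refine h.trans (List.Perm.of_eq ?_)
  have h2 : t.kind.ori δ + 2 + 1 = t.kind.ori δ + 1 + 2 := add_right_comm _ _ _
  cases hr : t.rot
  · simp [sides, LTile.apexLift, LTile.ori, hr, halfTurn, add_assoc]
  · simp only [LTile.ori, hr, if_true, h2, Kind.leg_add_two]
    simp [sides, LTile.apexLift, hr, halfTurn, add_assoc, add_comm]

/-! ### Cells of the square lattice -/

/-- The reshaping in integer coordinates. -/
def flat (p : Addr) : ℤ × ℤ := (p.1 + p.2.1, p.2.1 + p.2.2.1 + p.2.2.2)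

theorem flat_add (p q : Addr) : flat (p + q) = flat p + flat q := by
  simp only [flat, Prod.fst_add, Prod.snd_add, Prod.mk_add_mk, Prod.mk.injEq]
  constructor <;> ring

theorem flat_neg (p : Addr) : flat (-p) = - flat p := by
  simp only [flat, Prod.fst_neg, Prod.snd_neg, Prod.neg_mk, Prod.mk.injEq]
  constructor <;> ring

/-- The unit step in direction `i ^ k`. -/
def step (k : Fin 4) : ℤ × ℤ :=
  match k with
  | 0 => (1, 0)
  | 1 => (0, 1)
  | 2 => (-1, 0)
  | 3 => (0, -1)

/-- The right angle of a triangle in the square lattice, relative to its first corner. -/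
def Kind.apexOff (δ : Bool) : Kind → ℤ × ℤ
  | .tri k _ _ _ => if k then (0, 1) else 0
  | .quarter k _ _ => if k then (0, 1) else (-1, 0)
  | .half k _ _ _ =>
    if k then (if δ then (-1, 0) else (0, 1)) else (if δ then (0, 1) else (1, 0))

/-- The right angle of a triangle in the square lattice. -/
def LTile.apex (δ : Bool) (t : LTile) : ℤ × ℤ :=
  flat t.pos + if t.rot then - t.kind.apexOff δ else t.kind.apexOff δ

theorem Kind.flat_leg : ∀ (κ : Kind) (k : Fin 4), flat (κ.leg k) = step k + step k := by
  decide +kernel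

theorem Kind.flat_apexLift : ∀ (δ : Bool) (κ : Kind),
    flat (κ.apexLift δ) = κ.apexOff δ + κ.apexOff δ := by
  decide +kernel

theorem LTile.flat_apexLift (δ : Bool) (t : LTile) :
    flat (t.apexLift δ) = t.apex δ + t.apex δ := by
  rw [LTile.apexLift, LTile.apex, flat_add, flat_add]
  cases t.rot <;> simp [halfTurn, flat_neg, Kind.flat_apexLift] <;> abel

/-- The lower left corner of the unit cell that contains the triangle. -/
def cellOf (a : ℤ × ℤ) (k : Fin 4) : ℤ × ℤ :=
  match k with
  | 0 => a
  | 1 => (a.1 - 1, a.2)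
  | 2 => (a.1 - 1, a.2 - 1)
  | 3 => (a.1, a.2 - 1)

/-- The triangle covers the quarter `q` of the cell with lower left corner `z`; the quarters cut
out by the two diagonals are numbered west, south, east, north. -/
def LTile.Covers (δ : Bool) (t : LTile) (z : ℤ × ℤ) (q : Fin 4) : Prop :=
  cellOf (t.apex δ) (t.ori δ) = z ∧ (q = t.ori δ ∨ q = t.ori δ + 1)

instance (δ : Bool) (t : LTile) (z : ℤ × ℤ) (q : Fin 4) : Decidable (t.Covers δ z q) :=
  inferInstanceAs (Decidable (_ ∧ _))

/-- Indicator function of the quarters covered by a triangle with right angle `a` and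
orientation `k`. -/
def covAt (a : ℤ × ℤ) (k : Fin 4) (z : ℤ × ℤ) (q : Fin 4) : ℤ :=
  if cellOf a k = z ∧ (q = k ∨ q = k + 1) then 1 else 0

/-- Indicator function of `Covers`. -/
def LTile.cov (δ : Bool) (z : ℤ × ℤ) (q : Fin 4) (t : LTile) : ℤ :=
  covAt (t.apex δ) (t.ori δ) z q

theorem LTile.cov_eq (δ : Bool) (z : ℤ × ℤ) (q : Fin 4) (t : LTile) :
    t.cov δ z q = if t.Covers δ z q then 1 else 0 := rfl

/-- Signed indicator of the directed segment from `u` to `u + w`, in doubled coordinates. -/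
def crossing (u w : ℤ × ℤ) (x y : ℤ × ℤ) : ℤ :=
  (if x = u + u ∧ y - x = w + w then 1 else 0) - (if y = u + u ∧ x - y = w + w then 1 else 0)

/-- Signed indicator of the edges above a directed segment of the square lattice. -/
def Edge.crossing (u w : ℤ × ℤ) (e : Edge) : ℤ :=
  OneTriangle.crossing u w (flat e.ends.1) (flat e.ends.2)

theorem antisymm_crossing (u w : ℤ × ℤ) : Antisymm (Edge.crossing u w) := fun e => by
  simp [Edge.crossing, crossing, Edge.ends_rev]

/-- The sum of `crossing` over the sides of the triangle with right angle `a` and orientation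
`k`. -/
def crossingAt (u w a : ℤ × ℤ) (k : Fin 4) : ℤ :=
  crossing u w (a + a) (a + a + (step k + step k)) +
    (crossing u w (a + a + (step k + step k)) (a + a + (step (k + 1) + step (k + 1))) +
      crossing u w (a + a + (step (k + 1) + step (k + 1))) (a + a))

theorem listSum_crossing (δ : Bool) (t : LTile) (u w : ℤ × ℤ) :
    listSum (Edge.crossing u w) (t.edges δ) = crossingAt u w (t.apex δ) (t.ori δ) := by
  have h : listSum (Edge.crossing u w) (t.edges δ) =
      listSum (fun x : Addr × Addr => crossing u w (flat x.1) (flat x.2))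
        ((t.edges δ).map Edge.ends) := by rw [listSum_map]; rfl
  rw [h, listSum_perm _ (t.ends_edges δ)]
  simp only [sides, listSum_cons, listSum_nil, flat_add, LTile.flat_apexLift, Kind.flat_leg,
    crossingAt, add_zero]

/-- Triangles are traversed counterclockwise, so a segment counts positively for the triangle on its
left and negatively for that on its right. For an upward segment the left quarter is the east one of
the cell before it, and the right quarter is the west one of the cell after it. -/
theorem crossing_vertical (a : ℤ × ℤ) (k : Fin 4) (x y : ℤ) :
    crossingAt (x, y) (0, 1) a k = covAt a k (x - 1, y) 2 - covAt a k (x, y) 0 := by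
  obtain ⟨a, b⟩ := a
  fin_cases k <;> simp [crossingAt, crossing, covAt, step, cellOf] <;> split_ifs <;> omega

theorem crossing_horizontal (a : ℤ × ℤ) (k : Fin 4) (x y : ℤ) :
    crossingAt (x, y) (1, 0) a k = covAt a k (x, y) 1 - covAt a k (x, y - 1) 3 := by
  obtain ⟨a, b⟩ := a
  fin_cases k <;> simp [crossingAt, crossing, covAt, step, cellOf] <;> split_ifs <;> omega

theorem crossing_rising (a : ℤ × ℤ) (k : Fin 4) (x y : ℤ) :
    crossingAt (x, y) (1, 1) a k = covAt a k (x, y) 3 - covAt a k (x, y) 2 := by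
  obtain ⟨a, b⟩ := a
  fin_cases k <;> simp [crossingAt, crossing, covAt, step, cellOf] <;> split_ifs <;> omega

theorem crossing_falling (a : ℤ × ℤ) (k : Fin 4) (x y : ℤ) :
    crossingAt (x + 1, y) (-1, 1) a k = covAt a k (x, y) 0 - covAt a k (x, y) 3 := by
  obtain ⟨a, b⟩ := a
  fin_cases k <;> simp [crossingAt, crossing, covAt, step, cellOf] <;> split_ifs <;> omega

/-- A diagonal has two quarters on each side, and a triangle with this hypotenuse covers both on its
side. The second form, together with the first one and the rising diagonal, links all four quarters
of a cell. -/
theorem crossing_falling' (a : ℤ × ℤ) (k : Fin 4) (x y : ℤ) :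
    crossingAt (x + 1, y) (-1, 1) a k = covAt a k (x, y) 1 - covAt a k (x, y) 2 := by
  obtain ⟨a, b⟩ := a
  fin_cases k <;> simp [crossingAt, crossing, covAt, step, cellOf] <;> split_ifs <;> omega

/-! ### Every quarter of a cell is covered exactly once -/

/-- The `n`-th patch that grows from a wheel. -/
def patch (ε δ c : Bool) (n : ℕ) : List LTile := iter ε δ (wheel ε δ c) n

/-- How often a quarter of a cell is covered by the `n`-th patch. -/
def mult (ε δ c : Bool) (n : ℕ) (z : ℤ × ℤ) (q : Fin 4) : ℤ :=
  listSum (LTile.cov δ z q) (patch ε δ c n)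

theorem reshape_eq_flat (p : Addr) :
    reshape p = ((flat p).1 : ℂ) + ((flat p).2 : ℂ) * Complex.I := rfl

theorem norm_reshape_le (p : Addr) : ‖reshape p‖ ≤ |((flat p).1 : ℝ)| + |((flat p).2 : ℝ)| := by
  rw [reshape_eq_flat]
  refine (norm_add_le _ _).trans ?_
  rw [norm_mul, Complex.norm_I, mul_one, Complex.norm_intCast, Complex.norm_intCast]

/-- Both ends of the segment have coordinates of absolute value at most `n`, hence norm at most `2
n`, whereas every boundary edge starts at distance at least `1 + 2 n`. The start of a boundary edge
would have to be one of the two ends. -/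
theorem crossing_boundary (ε c : Bool) {n : ℕ} {u w : ℤ × ℤ} (hu1 : |u.1| < n) (hu2 : |u.2| < n)
    (hw1 : |w.1| ≤ 1) (hw2 : |w.2| ≤ 1) :
    listSum (Edge.crossing u w) (boundary ε c n) = 0 := by
  refine listSum_eq_zero fun e he => ?_
  obtain ⟨h1, -⟩ := boundary_far ε c n e he
  have h2 := norm_reshape_boundary ε c n e he
  have key : ∀ v : ℤ × ℤ, |v.1| ≤ n → |v.2| ≤ n → flat e.ends.1 ≠ v + v := by
    intro v hv1 hv2 hv
    cases e with
    | leg => simp [Edge.isLat] at h1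
    | diag => simp [Edge.isLat] at h1
    | lat p j x y =>
      have h3 : flat p = v := by
        simp only [Edge.ends, flat_add, Prod.ext_iff, Prod.fst_add, Prod.snd_add] at hv
        ext <;> omega
      have h4 := norm_reshape_le p
      rw [h3] at h4
      have h5 : |(v.1 : ℝ)| ≤ n := by exact_mod_cast hv1
      have h6 : |(v.2 : ℝ)| ≤ n := by exact_mod_cast hv2
      have h7 : (1 : ℝ) + 2 * n ≤ ‖reshape p‖ := h2
      linarith
  have k1 := key u hu1.le hu2.le
  have k2 := key (u + w) (by rw [Prod.fst_add]; have := abs_add_le u.1 w.1; omega)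
    (by rw [Prod.snd_add]; have := abs_add_le u.2 w.2; omega)
  rw [Edge.crossing, crossing, if_neg (fun h => k1 h.1), if_neg, sub_zero]
  rintro ⟨h3, h4⟩
  refine k2 ?_
  rw [sub_eq_iff_eq_add.1 h4, h3]
  abel

theorem crossing_patch (ε δ c : Bool) {n : ℕ} {u w : ℤ × ℤ} (hu1 : |u.1| < n) (hu2 : |u.2| < n)
    (hw1 : |w.1| ≤ 1) (hw2 : |w.2| ≤ 1) :
    listSum (fun t : LTile => crossingAt u w (t.apex δ) (t.ori δ)) (patch ε δ c n) = 0 := by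
  rw [← crossing_boundary ε c hu1 hu2 hw1 hw2, ← listSum_iter_wheel (antisymm_crossing u w) ε δ]
  exact listSum_congr fun t _ => (listSum_crossing δ t u w).symm

theorem mult_vertical (ε δ c : Bool) {n : ℕ} {x y : ℤ} (hx : |x| < n) (hy : |y| < n) :
    mult ε δ c n (x - 1, y) 2 = mult ε δ c n (x, y) 0 := by
  have h := crossing_patch ε δ c (u := (x, y)) (w := (0, 1)) hx hy (by simp) (by simp)
  simp only [crossing_vertical] at h
  rw [listSum_sub] at h
  exact sub_eq_zero.1 h

theorem mult_horizontal (ε δ c : Bool) {n : ℕ} {x y : ℤ} (hx : |x| < n) (hy : |y| < n) :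
    mult ε δ c n (x, y) 1 = mult ε δ c n (x, y - 1) 3 := by
  have h := crossing_patch ε δ c (u := (x, y)) (w := (1, 0)) hx hy (by simp) (by simp)
  simp only [crossing_horizontal] at h
  rw [listSum_sub] at h
  exact sub_eq_zero.1 h

theorem mult_quarter (ε δ c : Bool) {n : ℕ} {x y : ℤ} (hx : |x| < n) (hx' : |x + 1| < n)
    (hy : |y| < n) (q : Fin 4) : mult ε δ c n (x, y) q = mult ε δ c n (x, y) 0 := by
  have h := crossing_patch ε δ c (u := (x, y)) (w := (1, 1)) hx hy (by simp) (by simp)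
  have h' := crossing_patch ε δ c (u := (x + 1, y)) (w := (-1, 1)) hx' hy (by simp) (by simp)
  have h'' := h'
  simp only [crossing_rising] at h
  simp only [crossing_falling] at h'
  simp only [crossing_falling'] at h''
  rw [listSum_sub] at h h' h''
  change mult ε δ c n (x, y) 3 - mult ε δ c n (x, y) 2 = 0 at h
  change mult ε δ c n (x, y) 0 - mult ε δ c n (x, y) 3 = 0 at h'
  change mult ε δ c n (x, y) 1 - mult ε δ c n (x, y) 2 = 0 at h''
  fin_cases q <;> simp <;> omega

/-- The covering number does not change across sides and diagonals of cells, so one can walk within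
the box, first along the row and then along the column of the origin. -/
theorem mult_eq_zero_zero (ε δ c : Bool) {n : ℕ} {x y : ℤ} (hx : |x| + 1 < n) (hy : |y| + 1 < n)
    (q : Fin 4) : mult ε δ c n (x, y) q = mult ε δ c n (0, 0) 0 := by
  have hq : ∀ {x y : ℤ}, |x| + 1 < n → |y| + 1 < n → ∀ q,
      mult ε δ c n (x, y) q = mult ε δ c n (x, y) 0 := fun {x y} h1 h2 q =>
    mult_quarter ε δ c (by omega) (by have := abs_add_le x 1; rw [abs_one] at this; omega)
      (by omega) q
  have hv : ∀ {x y : ℤ}, |x| + 1 < n → |x - 1| + 1 < n → |y| + 1 < n →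
      mult ε δ c n (x - 1, y) 0 = mult ε δ c n (x, y) 0 := fun {x y} h1 h1' h2 => by
    rw [← hq h1' h2 2]
    exact mult_vertical ε δ c (by omega) (by omega)
  have hh : ∀ {x y : ℤ}, |x| + 1 < n → |y| + 1 < n → |y - 1| + 1 < n →
      mult ε δ c n (x, y) 0 = mult ε δ c n (x, y - 1) 0 := fun {x y} h1 h1' h2 => by
    rw [← hq h1 h2 3, ← hq h1 h1' 1]
    exact mult_horizontal ε δ c (by omega) (by omega)
  rw [hq hx hy]
  have h1 : ∀ x : ℤ, |x| + 1 < n → mult ε δ c n (x, y) 0 = mult ε δ c n (0, y) 0 := by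
    intro x
    induction x using Int.induction_on with
    | zero => intro _; rfl
    | succ i ih =>
      intro hi
      have e1 : |(i : ℤ)| + 1 < n := by
        rw [abs_of_nonneg (by positivity)] at hi ⊢; omega
      rw [← ih e1, ← hv hi (by simpa using e1) hy]
      simp
    | pred i ih =>
      intro hi
      have e1 : |(-(i : ℤ))| + 1 < n := by
        rw [abs_of_nonpos (by omega)] at hi ⊢; omega
      rw [← ih e1, ← hv e1 hi hy]
  have h2 : ∀ y : ℤ, |y| + 1 < n → mult ε δ c n (0, y) 0 = mult ε δ c n (0, 0) 0 := by
    have h0 : |(0 : ℤ)| + 1 < n := by rw [abs_zero]; have := abs_nonneg x; omega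
    intro y
    induction y using Int.induction_on with
    | zero => intro _; rfl
    | succ i ih =>
      intro hi
      have e1 : |(i : ℤ)| + 1 < n := by
        rw [abs_of_nonneg (by positivity)] at hi ⊢; omega
      rw [← ih e1, hh h0 hi (by simpa using e1)]
      simp
    | pred i ih =>
      intro hi
      have e1 : |(-(i : ℤ))| + 1 < n := by
        rw [abs_of_nonpos (by omega)] at hi ⊢; omega
      rw [← ih e1, hh h0 e1 hi]
  rw [h1 x hx, h2 y hy]

/-- The first corner of a triangle that covers this quarter is one of the four corners of the unit
cell at the origin, at distance at most `√2 < 1.5`. -/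
theorem cov_far {δ : Bool} {t : LTile} (h : 1.5 < ‖reshape t.pos‖) :
    t.cov δ (0, 0) 0 = 0 := by
  rw [LTile.cov_eq, if_neg]
  rintro ⟨h1, h2⟩
  have h3 : (flat t.pos).1 ∈ ({0, 1} : Finset ℤ) ∧ (flat t.pos).2 ∈ ({0, 1} : Finset ℤ) := by
    revert h1 h2
    rw [LTile.apex, LTile.ori]
    generalize flat t.pos = p
    obtain ⟨a, b⟩ := p
    rcases t with ⟨κ, r, p⟩
    cases κ with
    | tri k x y z =>
      cases r <;> cases k <;> simp [Kind.ori, Kind.apexOff, cellOf] <;> omega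
    | quarter k x y =>
      cases r <;> cases k <;> simp [Kind.ori, Kind.apexOff, cellOf] <;> omega
    | half k x y z =>
      cases r <;> cases k <;> cases δ <;> simp [Kind.ori, Kind.apexOff, cellOf] <;> omega
  have h4 : ‖reshape t.pos‖ ^ 2 ≤ 2 := by
    rw [reshape_eq_flat, ← Complex.normSq_eq_norm_sq, Complex.normSq_apply]
    simp only [Finset.mem_insert, Finset.mem_singleton] at h3
    rcases h3 with ⟨h3 | h3, h4 | h4⟩ <;> rw [h3, h4] <;> norm_num
  nlinarith

theorem hub_cov : ∀ (ε δ c : Bool), listSum (LTile.cov δ (0, 0) 0) (hub ε δ c) = 1 := by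
  decide +kernel

theorem listSum_iter_split {ε δ : Bool} {l : List LTile} (hl : ∀ t ∈ l, t.Good) (n : ℕ) :
    listSum (LTile.cov δ (0, 0) 0) (iter ε δ l n) =
      listSum (LTile.cov δ (0, 0) 0) (iter ε δ (l.filter fun t => ¬ t.IsFar) n) := by
  have hp := List.filter_append_perm (fun t : LTile => decide (¬ t.IsFar)) l
  rw [← listSum_perm _ (iter_perm ε δ hp n), iter_append, listSum_append, add_eq_left]
  refine listSum_eq_zero fun t ht => cov_far (norm_reshape_iter_far (l := l.filter _) ?_ ?_ n t ht)
  · exact fun t ht => hl t (List.mem_filter.1 ht).1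
  · intro t ht
    have := (List.mem_filter.1 ht).2
    simpa using this

theorem hub_good (ε δ c : Bool) : ∀ t ∈ hub ε δ c, t.Good := fun t ht =>
  wheel_good ε δ c t (List.mem_filter.1 ht).1

/-- Among the substitutes of the hub, only the next hub has descendants near the origin, so the
count is that of `hub_cov` at every level. The colour has to vary in the induction because it
changes if `ε` is true. -/
theorem listSum_iter_hub (ε δ c : Bool) (n : ℕ) :
    listSum (LTile.cov δ (0, 0) 0) (iter ε δ (hub ε δ c) n) = 1 := by
  induction n generalizing c with
  | zero => exact hub_cov ε δ c
  | succ n ih =>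
    rw [iter_succ', listSum_iter_split, listSum_perm _ (iter_perm ε δ (hub_subst ε δ c) n), ih]
    intro s hs
    obtain ⟨t, ht, h⟩ := List.mem_flatMap.1 hs
    exact LTile.Good.subst t (hub_good ε δ c t ht) s h

theorem mult_eq_one (ε δ c : Bool) {n : ℕ} {z : ℤ × ℤ} (hx : |z.1| + 1 < n) (hy : |z.2| + 1 < n)
    (q : Fin 4) : mult ε δ c n z q = 1 := by
  rw [← listSum_iter_hub ε δ c n, hub, ← listSum_iter_split (wheel_good ε δ c)]
  exact mult_eq_zero_zero ε δ c hx hy q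

theorem listSum_nonneg {α : Type} {F : α → ℤ} (hF : ∀ a, 0 ≤ F a) (l : List α) :
    0 ≤ listSum F l := by
  induction l with
  | nil => simp
  | cons a l ih => rw [listSum_cons]; exact add_nonneg (hF a) ih

theorem le_listSum {α : Type} [DecidableEq α] {F : α → ℤ} (hF : ∀ a, 0 ≤ F a) {l : List α} {a : α}
    (ha : a ∈ l) : F a ≤ listSum F l := by
  rw [listSum_perm F (List.perm_cons_erase ha), listSum_cons]
  linarith [listSum_nonneg hF (l.erase a)]

theorem two_le_listSum {α : Type} [DecidableEq α] {F : α → ℤ} (hF : ∀ a, 0 ≤ F a) {l : List α}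
    {a b : α} (ha : a ∈ l) (hb : b ∈ l) (hab : a ≠ b) (h1 : 1 ≤ F a) (h2 : 1 ≤ F b) :
    2 ≤ listSum F l := by
  rw [listSum_perm F (List.perm_cons_erase ha), listSum_cons]
  linarith [le_listSum hF ((List.mem_erase_of_ne hab.symm).2 hb)]

theorem LTile.cov_nonneg (δ : Bool) (z : ℤ × ℤ) (q : Fin 4) (t : LTile) : 0 ≤ t.cov δ z q := by
  rw [LTile.cov_eq]; split_ifs <;> simp

theorem LTile.Covers.cov {δ : Bool} {z : ℤ × ℤ} {q : Fin 4} {t : LTile} (h : t.Covers δ z q) :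
    t.cov δ z q = 1 := if_pos h

/-! ### Uniqueness in patches -/

theorem patch_exists_covers (ε δ c : Bool) {n : ℕ} {z : ℤ × ℤ} (hx : |z.1| + 1 < n)
    (hy : |z.2| + 1 < n) (q : Fin 4) : ∃ t ∈ patch ε δ c n, t.Covers δ z q := by
  by_contra! h
  have h1 := mult_eq_one ε δ c hx hy q
  rw [mult, listSum_eq_zero fun t ht => by rw [LTile.cov_eq, if_neg (h t ht)]] at h1
  exact absurd h1 (by norm_num)

theorem patch_unique {ε δ c : Bool} {n : ℕ} {z : ℤ × ℤ} (hx : |z.1| + 1 < n)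
    (hy : |z.2| + 1 < n) {q : Fin 4} {s t : LTile} (hs : s ∈ patch ε δ c n)
    (ht : t ∈ patch ε δ c n) (hs' : s.Covers δ z q) (ht' : t.Covers δ z q) : s = t := by
  by_contra hst
  have h := two_le_listSum (LTile.cov_nonneg δ z q) hs ht hst hs'.cov.ge ht'.cov.ge
  have h1 := mult_eq_one ε δ c hx hy q
  rw [mult] at h1
  omega

theorem LTile.exists_covers (δ : Bool) (t : LTile) :
    t.Covers δ (cellOf (t.apex δ) (t.ori δ)) (t.ori δ) := ⟨rfl, Or.inl rfl⟩

/-- Different triangles of a patch are replaced by disjoint patches. -/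
theorem patch_subst_unique {ε δ c : Bool} {n : ℕ} {s t u : LTile} (hs : s ∈ patch ε δ c n)
    (ht : t ∈ patch ε δ c n) (hus : u ∈ substList ε δ s) (hut : u ∈ substList ε δ t)
    (hx : |(cellOf (u.apex δ) (u.ori δ)).1| + 1 < (n + 1 : ℕ))
    (hy : |(cellOf (u.apex δ) (u.ori δ)).2| + 1 < (n + 1 : ℕ)) : s = t := by
  by_contra hst
  -- If `s` and `t` were different, both of their patches would contribute `u` to the covering
  -- number at level `n + 1`, which is 1.
  have h1 := mult_eq_one ε δ c hx hy (u.ori δ)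
  rw [mult, patch, iter, listSum_flatMap] at h1
  change listSum _ (patch ε δ c n) = 1 at h1
  have key : ∀ v, u ∈ substList ε δ v →
      1 ≤ listSum (LTile.cov δ (cellOf (u.apex δ) (u.ori δ)) (u.ori δ)) (substList ε δ v) :=
    fun v hv => (u.exists_covers δ).cov.ge.trans (le_listSum (LTile.cov_nonneg δ _ _) hv)
  have := two_le_listSum (fun v => listSum_nonneg (LTile.cov_nonneg δ _ _) (substList ε δ v))
    hs ht hst (key s hus) (key t hut)
  omega

/-- The flattened sides of the triangle with right angle `a` and orientation `k`. -/
def flatSides (a : ℤ × ℤ) (k : Fin 4) : List ((ℤ × ℤ) × (ℤ × ℤ)) :=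
  [(a + a, a + a + (step k + step k)),
    (a + a + (step k + step k), a + a + (step (k + 1) + step (k + 1))),
    (a + a + (step (k + 1) + step (k + 1)), a + a)]

/-- The projection of the end points of an edge. -/
def Edge.flatEnds (e : Edge) : (ℤ × ℤ) × (ℤ × ℤ) := (flat e.ends.1, flat e.ends.2)

theorem LTile.flatEnds_edges (δ : Bool) (t : LTile) :
    ((t.edges δ).map Edge.flatEnds).Perm (flatSides (t.apex δ) (t.ori δ)) := by
  have h := (t.ends_edges δ).map fun x : Addr × Addr => (flat x.1, flat x.2)
  rw [List.map_map] at h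
  refine h.trans (List.Perm.of_eq ?_)
  simp [sides, flatSides, flat_add, LTile.flat_apexLift, Kind.flat_leg]

theorem flatSides_nodup (a : ℤ × ℤ) (k : Fin 4) : (flatSides a k).Nodup := by
  obtain ⟨a, b⟩ := a
  fin_cases k <;> simp [flatSides, step]

/-- The three sides of one triangle have different projections, so the projection determines the
side with its marks and lift. -/
theorem LTile.edge_ext {δ : Bool} {t : LTile} {e f : Edge} (he : e ∈ t.edges δ)
    (hf : f ∈ t.edges δ) (h : e.flatEnds = f.flatEnds) : e = f :=
  List.inj_on_of_nodup_map ((t.flatEnds_edges δ).nodup_iff.2 (flatSides_nodup _ _)) he hf h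

/-- A quarter to the left of a directed segment, in doubled coordinates. -/
def leftQuarter (x : (ℤ × ℤ) × (ℤ × ℤ)) : (ℤ × ℤ) × Fin 4 :=
  let d := x.2 - x.1
  let a := x.1.1 / 2
  let b := x.1.2 / 2
  if d = (2, 0) then ((a, b), 1)
  else if d = (0, 2) then ((a - 1, b), 2)
  else if d = (-2, 0) then ((a - 1, b - 1), 3)
  else if d = (0, -2) then ((a, b - 1), 0)
  else if d = (2, 2) then ((a, b), 3)
  else if d = (-2, 2) then ((a - 1, b), 0)
  else if d = (-2, -2) then ((a - 1, b - 1), 2)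
  else ((a, b - 1), 3)

theorem covers_leftQuarter_aux {a : ℤ × ℤ} {k : Fin 4} {x : (ℤ × ℤ) × (ℤ × ℤ)}
    (hx : x ∈ flatSides a k) :
    cellOf a k = (leftQuarter x).1 ∧ ((leftQuarter x).2 = k ∨ (leftQuarter x).2 = k + 1) := by
  obtain ⟨a, b⟩ := a
  simp only [flatSides, List.mem_cons, List.not_mem_nil, or_false] at hx
  fin_cases k <;> rcases hx with rfl | rfl | rfl <;>
    simp [leftQuarter, step, cellOf, Prod.ext_iff] <;> omega

theorem LTile.covers_leftQuarter {δ : Bool} {t : LTile} {e : Edge} (he : e ∈ t.edges δ) :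
    t.Covers δ (leftQuarter e.flatEnds).1 (leftQuarter e.flatEnds).2 :=
  covers_leftQuarter_aux ((t.flatEnds_edges δ).mem_iff.1 (List.mem_map_of_mem he))

/-- Signed indicator of a marked edge. -/
def edgeIndicator (e f : Edge) : ℤ := (if f = e then 1 else 0) - (if f = e.rev then 1 else 0)

theorem antisymm_edgeIndicator (e : Edge) : Antisymm (edgeIndicator e) := fun f => by
  have h1 : f.rev = e ↔ f = e.rev := by
    constructor
    · rintro rfl; rw [Edge.rev_rev]
    · rintro rfl; rw [Edge.rev_rev]
  have h2 : f.rev = e.rev ↔ f = e := by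
    constructor
    · intro h; rw [← Edge.rev_rev f, h, Edge.rev_rev]
    · rintro rfl; rfl
  simp only [edgeIndicator, h1, h2]
  ring

/-- In the interior of a patch every side of a triangle is, in the other direction, a side of
another triangle, with the same marks and the same lift. -/
theorem patch_exists_rev {ε δ c : Bool} {n : ℕ} {t : LTile} (ht : t ∈ patch ε δ c n) {e : Edge}
    (he : e ∈ t.edges δ) (h1 : ‖reshape e.base‖ < 1 + 2 * n) (h2 : ‖reshape e.rev.base‖ < 1 + 2 * n) :
    ∃ s ∈ patch ε δ c n, e.rev ∈ s.edges δ := by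
  by_contra! hno
  -- Without `e.rev` the indicator of `e` has a positive sum over the patch, but the boundary is too
  -- far away to contain `e` or `e.rev`.
  have h := listSum_iter_wheel (antisymm_edgeIndicator e) ε δ c n
  rw [listSum_eq_zero (l := boundary ε c n)] at h
  · have key : ∀ s ∈ patch ε δ c n, listSum (edgeIndicator e) (s.edges δ) =
        listSum (fun f => if f = e then 1 else 0) (s.edges δ) := fun s hs =>
      listSum_congr fun f hf => by
        rw [edgeIndicator, if_neg (c := f = e.rev) (fun h => hno s hs (h ▸ hf)), sub_zero]
    rw [show iter ε δ (wheel ε δ c) n = patch ε δ c n from rfl, listSum_congr key] at h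
    have hn : ∀ f : Edge, (0 : ℤ) ≤ if f = e then 1 else 0 := fun f => by split_ifs <;> simp
    have h3 := le_listSum (fun s : LTile => listSum_nonneg hn (s.edges δ)) ht
    have h4 := le_listSum hn he
    rw [if_pos rfl] at h4
    omega
  · intro f hf
    have h3 := norm_reshape_boundary ε c n f hf
    rw [edgeIndicator, if_neg, if_neg, sub_zero]
    · rintro rfl; linarith
    · rintro rfl; linarith

/-- Triangles that meet along a side have the same lift of this side. -/
theorem patch_match {ε δ c : Bool} {n : ℕ} {s t : LTile} (hs : s ∈ patch ε δ c n)
    (ht : t ∈ patch ε δ c n) {e f : Edge} (he : e ∈ s.edges δ) (hf : f ∈ t.edges δ)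
    (h1 : ‖reshape e.base‖ < 1 + 2 * n) (h2 : ‖reshape e.rev.base‖ < 1 + 2 * n)
    (hx : |(leftQuarter f.flatEnds).1.1| + 1 < n) (hy : |(leftQuarter f.flatEnds).1.2| + 1 < n)
    (h : f.flatEnds = e.rev.flatEnds) : f = e.rev := by
  obtain ⟨u, hu, heu⟩ := patch_exists_rev hs he h1 h2
  have h3 := LTile.covers_leftQuarter heu
  rw [← h] at h3
  -- The triangle `u` that has `e.rev` as a side lies on the same side of the segment as `t`, so
  -- they coincide by unique covering.
  obtain rfl := patch_unique hx hy ht hu (LTile.covers_leftQuarter hf) h3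
  exact LTile.edge_ext hf heu h

/-! ### Supertiles inside patches -/

theorem LTile.act_act (r r' : Bool) (q q' : Addr) (t : LTile) :
    (t.act r' q').act r q = t.act (r ^^ r') (q + halfTurn r q') := by
  simp only [LTile.act, Bool.xor_assoc, LTile.mk.injEq, true_and]
  cases r <;> cases r' <;> simp [halfTurn] <;> abel

theorem substList_act (ε δ r : Bool) (q : Addr) (t : LTile) :
    substList ε δ (t.act r q) = (substList ε δ t).map (LTile.act r (inflate q)) := by
  simp only [substList, List.map_map]
  refine List.map_congr_left fun s _ => ?_
  simp only [Function.comp, LTile.act_act]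
  simp only [LTile.act, inflate_add, inflate_halfTurn]

theorem iter_act (ε δ r : Bool) (q : Addr) (l : List LTile) (n : ℕ) :
    iter ε δ (l.map (LTile.act r q)) n = (iter ε δ l n).map (LTile.act r (inflate^[n] q)) := by
  induction n with
  | zero => rfl
  | succ n ih =>
    rw [iter, iter, ih, List.flatMap_map, List.map_flatMap, Function.iterate_succ_apply']
    simp only [substList_act]

theorem mem_supertile {ε δ : Bool} {κ : Kind} {n : ℕ} {t : LTile} :
    t ∈ supertile ε δ κ n ↔ t ∈ iter ε δ [⟨κ, false, 0⟩] n := by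
  induction n generalizing t with
  | zero => simp [supertile, iter]
  | succ n ih =>
    simp only [supertile, iter, Finset.mem_biUnion, List.mem_flatMap, ih, mem_subst]

theorem supertile_good {ε δ : Bool} {κ : Kind} (hκ : κ.HasRule) {n : ℕ} {t : LTile}
    (ht : t ∈ supertile ε δ κ n) : t.Good := by
  refine iter_forall LTile.Good.subst ?_ n t (mem_supertile.1 ht)
  intro s hs
  obtain rfl := List.mem_singleton.1 hs
  refine ⟨hκ, ?_⟩
  have : internal 0 = 0 := by apply Complex.ext <;> simp [internal]
  rw [this]
  norm_num

/-- Two substitutions of a white wheel already produce every marked triangle in unrotated position.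
This is what transfers results from wheel patches to all supertiles. -/
theorem exists_kind_wheel : ∀ (ε δ : Bool) (κ : Kind), κ.HasRule →
    ∃ t ∈ wheel ε δ false, ∃ s ∈ rule ε δ t.kind, ∃ u ∈ rule ε δ s.kind,
      u.kind = κ ∧ (t.rot ^^ (s.rot ^^ u.rot)) = false := by
  decide +kernel

theorem exists_kind_patch (ε δ : Bool) {κ : Kind} (hκ : κ.HasRule) :
    ∃ p, (⟨κ, false, p⟩ : LTile) ∈ patch ε δ false 2 := by
  obtain ⟨t, ht, s, hs, u, hu, rfl, hr⟩ := exists_kind_wheel ε δ κ hκ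
  have h1 : s.act t.rot (inflate t.pos) ∈ patch ε δ false 1 :=
    List.mem_flatMap.2 ⟨t, ht, List.mem_map_of_mem hs⟩
  have h2 : u.act (t.rot ^^ s.rot) (inflate (inflate t.pos + halfTurn t.rot s.pos)) ∈
      patch ε δ false 2 := List.mem_flatMap.2 ⟨_, h1, List.mem_map_of_mem hu⟩
  rw [LTile.act, Bool.xor_assoc, hr] at h2
  exact ⟨_, h2⟩

theorem patch_subset_succ (ε δ c : Bool) (n : ℕ) :
    patch ε δ c n ⊆ patch ε δ (c ^^ ε) (n + 1) := by
  have h := iter_subset ε δ (wheel_subset ε δ (c ^^ ε)) n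
  rw [Bool.xor_assoc, Bool.xor_self, Bool.xor_false] at h
  rw [patch, patch, iter_succ']
  exact h

theorem exists_patch_subset (ε δ : Bool) (n k : ℕ) :
    ∃ c, patch ε δ false n ⊆ patch ε δ c (n + k) := by
  induction k with
  | zero => exact ⟨false, fun _ h => h⟩
  | succ k ih =>
    obtain ⟨c, h⟩ := ih
    exact ⟨_, fun _ ht => patch_subset_succ ε δ c (n + k) (h ht)⟩

/-- Each supertile occurs, at a fixed position, in arbitrarily large patches. -/
theorem exists_supertile_patch (ε δ : Bool) {κ : Kind} (hκ : κ.HasRule) (n : ℕ) :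
    ∃ Q : Addr, ∀ M : ℕ, ∃ N ≥ M, ∃ c, ∀ s ∈ supertile ε δ κ n,
      s.act false Q ∈ patch ε δ c N := by
  obtain ⟨p, hp⟩ := exists_kind_patch ε δ hκ
  -- The patch is enlarged by `M` levels while the triangle remains at `p`, and only then the last
  -- `n` substitutions are applied. So the position of the supertile does not depend on `M`.
  refine ⟨inflate^[n] p, fun M => ⟨2 + M + n, by omega, ?_⟩⟩
  obtain ⟨c, hc⟩ := exists_patch_subset ε δ 2 M
  refine ⟨c, fun s hs => ?_⟩
  have h1 : [(⟨κ, false, p⟩ : LTile)] ⊆ patch ε δ c (2 + M) := by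
    simpa using hc hp
  have h2 := iter_subset ε δ h1 n
  rw [patch, iter_iter] at h2
  refine h2 ?_
  have h3 := iter_act ε δ false p [⟨κ, false, 0⟩] n
  have h4 : [(⟨κ, false, 0⟩ : LTile)].map (LTile.act false p) = [⟨κ, false, p⟩] := by
    simp [LTile.act, halfTurn]
  rw [h4] at h3
  rw [h3]
  exact List.mem_map_of_mem (mem_supertile.1 hs)

theorem LTile.ori_act (δ : Bool) (q : Addr) (t : LTile) : (t.act false q).ori δ = t.ori δ := by
  simp [LTile.ori, LTile.act]

theorem LTile.apex_act (δ : Bool) (q : Addr) (t : LTile) :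
    (t.act false q).apex δ = flat q + t.apex δ := by
  simp [LTile.apex, LTile.act, halfTurn, flat_add, add_assoc]

theorem cellOf_add (u a : ℤ × ℤ) (k : Fin 4) : cellOf (u + a) k = u + cellOf a k := by
  fin_cases k <;> simp [cellOf, Prod.ext_iff] <;> omega

theorem LTile.Covers.act {δ : Bool} {t : LTile} {z : ℤ × ℤ} {q : Fin 4} (h : t.Covers δ z q)
    (p : Addr) : (t.act false p).Covers δ (flat p + z) q := by
  obtain ⟨h1, h2⟩ := h
  refine ⟨?_, ?_⟩
  · rw [LTile.apex_act, LTile.ori_act, cellOf_add, h1]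
  · rwa [LTile.ori_act]

theorem LTile.act_false_injective (p : Addr) : Function.Injective (LTile.act false p) := by
  rintro ⟨κ, r, q⟩ ⟨κ', r', q'⟩ h
  simpa [LTile.act, halfTurn] using h

/-- No quarter of a cell is covered by two triangles of a supertile. -/
theorem supertile_unique {ε δ : Bool} {κ : Kind} (hκ : κ.HasRule) {n : ℕ} {s t : LTile}
    (hs : s ∈ supertile ε δ κ n) (ht : t ∈ supertile ε δ κ n) {z : ℤ × ℤ} {q : Fin 4}
    (hs' : s.Covers δ z q) (ht' : t.Covers δ z q) : s = t := by
  obtain ⟨Q, hQ⟩ := exists_supertile_patch ε δ hκ n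
  obtain ⟨N, hN, c, h⟩ := hQ (|(flat Q + z).1| + |(flat Q + z).2| + 2).toNat
  have h1 := abs_nonneg (flat Q + z).1
  have h2 := abs_nonneg (flat Q + z).2
  exact LTile.act_false_injective Q (patch_unique (by omega) (by omega) (h s hs) (h t ht)
    (hs'.act Q) (ht'.act Q))

theorem supertile_subst_disjoint {ε δ : Bool} {κ : Kind} (hκ : κ.HasRule) {n : ℕ} :
    (supertile ε δ κ n : Set LTile).PairwiseDisjoint (subst ε δ) := by
  intro s hs t ht hst
  refine Finset.disjoint_left.2 fun u hus hut => hst ?_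
  obtain ⟨Q, hQ⟩ := exists_supertile_patch ε δ hκ n
  set v := u.act false (inflate Q)
  obtain ⟨N, hN, c, h⟩ := hQ (|(cellOf (v.apex δ) (v.ori δ)).1| +
    |(cellOf (v.apex δ) (v.ori δ)).2| + 2).toNat
  have h1 := abs_nonneg (cellOf (v.apex δ) (v.ori δ)).1
  have h2 := abs_nonneg (cellOf (v.apex δ) (v.ori δ)).2
  refine LTile.act_false_injective Q (patch_subst_unique (u := v) (h s hs) (h t ht) ?_ ?_
    (by push_cast; omega) (by push_cast; omega))
  · rw [substList_act]; exact List.mem_map_of_mem (mem_subst.1 hus)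
  · rw [substList_act]; exact List.mem_map_of_mem (mem_subst.1 hut)

/-- Triangles of a supertile that meet along a side have the same lift of this side. -/
theorem supertile_match {ε δ : Bool} {κ : Kind} (hκ : κ.HasRule) {n : ℕ} {s t : LTile}
    (hs : s ∈ supertile ε δ κ n) (ht : t ∈ supertile ε δ κ n) {a b a' b' : Addr}
    (h1 : (a, b) ∈ sides (s.apexLift δ) (s.kind.leg (s.ori δ)) (s.kind.leg (s.ori δ + 1)))
    (h2 : (b', a') ∈ sides (t.apexLift δ) (t.kind.leg (t.ori δ)) (t.kind.leg (t.ori δ + 1)))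
    (ha : flat a = flat a') (hb : flat b = flat b') : a = a' ∧ b = b' := by
  obtain ⟨e, he, hes⟩ := List.mem_map.1 ((s.ends_edges δ).mem_iff.2 h1)
  obtain ⟨f, hf, hft⟩ := List.mem_map.1 ((t.ends_edges δ).mem_iff.2 h2)
  obtain ⟨Q, hQ⟩ := exists_supertile_patch ε δ hκ n
  set e' := e.act false Q
  set f' := f.act false Q
  obtain ⟨N, hN, c, h⟩ := hQ (|(leftQuarter f'.flatEnds).1.1| + |(leftQuarter f'.flatEnds).1.2| + 2
    + ⌈‖reshape e'.base‖⌉ + ⌈‖reshape e'.rev.base‖⌉).toNat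
  have p1 := abs_nonneg (leftQuarter f'.flatEnds).1.1
  have p2 := abs_nonneg (leftQuarter f'.flatEnds).1.2
  have p3 : 0 ≤ ⌈‖reshape e'.base‖⌉ := Int.ceil_nonneg (norm_nonneg _)
  have p4 : 0 ≤ ⌈‖reshape e'.rev.base‖⌉ := Int.ceil_nonneg (norm_nonneg _)
  have p5 : ‖reshape e'.base‖ ≤ (N : ℤ) := (Int.le_ceil _).trans (by exact_mod_cast (by omega))
  have p6 : ‖reshape e'.rev.base‖ ≤ (N : ℤ) := (Int.le_ceil _).trans (by exact_mod_cast (by omega))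
  rw [Int.cast_natCast] at p5 p6
  have p7 : (0 : ℝ) ≤ N := N.cast_nonneg
  have key : f' = e'.rev := by
    refine patch_match (h s hs) (h t ht) ?_ ?_ (by linarith) (by linarith) (by omega) (by omega) ?_
    · rw [LTile.edges_act]; exact List.mem_map_of_mem he
    · rw [LTile.edges_act]; exact List.mem_map_of_mem hf
    · simp only [e', f', Edge.flatEnds, Edge.ends_rev, Edge.ends_act, hes, hft, flat_add, halfTurn,
        ha, hb, Bool.false_eq_true, if_false]
  have h3 := congrArg Edge.ends key
  simp only [e', f', Edge.ends_rev, Edge.ends_act, hes, hft, halfTurn, Bool.false_eq_true, if_false,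
    Prod.mk.injEq, add_right_inj] at h3
  exact ⟨h3.2.symm, h3.1.symm⟩

/-- A supertile that contains a complete wheel. -/
theorem wheel_subset_supertile : ∀ ε δ : Bool,
    (wheel ε δ false).map (LTile.act false (if ε then (11, 15, 4, -4) else (10, 19, 13, 2))) ⊆
      ((iter ε δ [⟨.tri false false true true, false, 0⟩] 2).filter fun t =>
        2 ≤ t.pos.1 ∧ t.pos.1 ≤ 4 ∧ 4 ≤ t.pos.2.1 ∧ t.pos.2.1 ≤ 6 ∧ -1 ≤ t.pos.2.2.2 ∧
          t.pos.2.2.2 ≤ 1).flatMap (substList ε δ) := by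
  -- The bounds on positions restrict the last substitution to the level 2 triangles near the wheel
  -- that appears; they only reduce the computation.
  decide +kernel

/-- One fixed triangle contains a complete white wheel after three substitutions, and then `n`
further substitutions contain the whole patch that grows from it. -/
theorem patch_subset_supertile (ε δ : Bool) (n : ℕ) : ∃ Q : Addr, ∀ t ∈ patch ε δ false n,
    t.act false Q ∈ supertile ε δ (.tri false false true true) (3 + n) := by
  refine ⟨inflate^[n] (if ε then (11, 15, 4, -4) else (10, 19, 13, 2)), fun t ht => ?_⟩
  rw [mem_supertile, ← iter_iter]
  have h : (wheel ε δ false).map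
      (LTile.act false (if ε then (11, 15, 4, -4) else (10, 19, 13, 2))) ⊆
      iter ε δ [⟨.tri false false true true, false, 0⟩] 3 := by
    intro s hs
    obtain ⟨u, hu, hsu⟩ := List.mem_flatMap.1 (wheel_subset_supertile ε δ hs)
    exact List.mem_flatMap.2 ⟨u, (List.mem_filter.1 hu).1, hsu⟩
  refine iter_subset ε δ h n ?_
  rw [iter_act]
  exact List.mem_map_of_mem ht

/-! ### Half cells in the plane -/

/-- The corners of the isosceles right triangle with right angle at `v` and legs in the directions
`i ^ k` and `i ^ (k + 1)`. -/
def triCorners (v : ℂ) (k : ℕ) : Set ℂ := {v, v + Complex.I ^ k, v + Complex.I ^ (k + 1)}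

/-- A point of the square lattice in the plane. -/
noncomputable def toPlane (z : ℤ × ℤ) : ℂ := (z.1 : ℂ) + (z.2 : ℂ) * Complex.I

theorem toPlane_add (u v : ℤ × ℤ) : toPlane (u + v) = toPlane u + toPlane v := by
  simp [toPlane]; ring

theorem toPlane_flat (p : Addr) : toPlane (flat p) = reshape p := rfl

theorem reshape_add (p q : Addr) : reshape (p + q) = reshape p + reshape q := by
  rw [← toPlane_flat, flat_add, toPlane_add]; rfl

theorem toPlane_step (k : Fin 4) : toPlane (step k) = Complex.I ^ (k : ℕ) := by
  fin_cases k <;> simp [toPlane, step, Complex.I_pow_three]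

theorem toPlane_step_succ (k : Fin 4) : toPlane (step (k + 1)) = Complex.I ^ (k + 1 : ℕ) := by
  fin_cases k <;> simp [toPlane, step, Complex.I_pow_three, Complex.I_pow_four]

/-- The corners of the half cell in the square lattice. -/
def latticeCorners (a : ℤ × ℤ) (k : Fin 4) : Finset (ℤ × ℤ) := {a, a + step k, a + step (k + 1)}

theorem triCorners_eq_image (w : ℂ) (a : ℤ × ℤ) (k : Fin 4) :
    triCorners (w + toPlane a) k = (fun z => w + toPlane z) '' (latticeCorners a k : Set (ℤ × ℤ)) := by
  simp only [triCorners, latticeCorners, Finset.coe_insert, Finset.coe_singleton, Set.image_insert_eq,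
    Set.image_singleton, toPlane_add, toPlane_step_succ, add_assoc]
  rw [toPlane_step]

/-- The third corner of a triangle in the square lattice, relative to the first one. -/
def Kind.thirdOff (κ : Kind) (j : ℕ) : ℤ × ℤ :=
  match κ with
  | .tri _ _ _ _ => flat (dir (j + 2))
  | .quarter _ _ _ =>
    ((flat (dir j) + flat (dir (j + 3))).1 / 2, (flat (dir j) + flat (dir (j + 3))).2 / 2)
  | .half _ _ _ _ => flat (dir j) + flat (dir (j + 3))

theorem latticeCorners_table : ∀ (δ r : Bool) (κ : Kind),
    ({0, flat (dir (κ.firstDir δ + if r then 6 else 0)),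
      κ.thirdOff (κ.firstDir δ + if r then 6 else 0)} : Finset (ℤ × ℤ)) =
    latticeCorners (if r then - κ.apexOff δ else κ.apexOff δ) (κ.ori δ + if r then 2 else 0) := by
  decide +kernel

/-- The integer division in `Kind.thirdOff` is exact: the centre of a square of side `√2` is a point
of the square grid. -/
theorem thirdOff_quarter : ∀ (δ r k x y : Bool),
    (Kind.quarter k x y).thirdOff ((Kind.quarter k x y).firstDir δ + if r then 6 else 0) +
      (Kind.quarter k x y).thirdOff ((Kind.quarter k x y).firstDir δ + if r then 6 else 0) =
    flat (dir ((Kind.quarter k x y).firstDir δ + if r then 6 else 0)) +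
      flat (dir ((Kind.quarter k x y).firstDir δ + (if r then 6 else 0) + 3)) := by
  decide +kernel

theorem corners_eq (δ : Bool) (w : ℂ) (t : LTile) :
    (t.place w).corners δ = triCorners (w + toPlane (t.apex δ)) (t.ori δ) := by
  have h1 : latticeCorners (t.apex δ) (t.ori δ) =
      (latticeCorners (if t.rot then - t.kind.apexOff δ else t.kind.apexOff δ)
        (t.ori δ)).image (flat t.pos + ·) := by
    simp [latticeCorners, LTile.apex, Finset.image_insert, add_assoc]
  rw [triCorners_eq_image, h1, LTile.ori, ← latticeCorners_table]
  simp only [Finset.image_insert, Finset.image_singleton, Finset.coe_insert, Finset.coe_singleton,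
    Set.image_insert_eq, Set.image_singleton, toPlane_add, toPlane_flat, PTile.corners, LTile.place,
    add_assoc, add_zero]
  congr 3
  · rcases t with ⟨κ, r, p⟩
    cases κ with
    | tri k x y z => rfl
    | quarter k x y =>
      have h := congrArg toPlane (thirdOff_quarter δ r k x y)
      rw [toPlane_add, toPlane_add, toPlane_flat, toPlane_flat] at h
      change w + (reshape p + (reshape (dir ((Kind.quarter k x y).firstDir δ + if r then 6 else 0)) +
        reshape (dir ((Kind.quarter k x y).firstDir δ + (if r then 6 else 0) + 3))) / 2) = _
      rw [← h]
      ring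
    | half k x y z =>
      simp only [Kind.thirdOff, toPlane_add, toPlane_flat, add_assoc]
      rfl

/-- The triangle with right angle `v` in coordinates. -/
theorem mem_convexHull_triCorners (v x : ℂ) (k : ℕ) :
    x ∈ convexHull ℝ (triCorners v k) ↔ ∃ a b : ℝ, 0 ≤ a ∧ 0 ≤ b ∧ a + b ≤ 1 ∧
      x = v + (a + b * Complex.I) * Complex.I ^ k := by
  constructor
  · intro hx
    have hc : Convex ℝ {x : ℂ | ∃ a b : ℝ, 0 ≤ a ∧ 0 ≤ b ∧ a + b ≤ 1 ∧
        x = v + (a + b * Complex.I) * Complex.I ^ k} := by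
      rintro _ ⟨a, b, ha, hb, hab, rfl⟩ _ ⟨a', b', ha', hb', hab', rfl⟩ s t hs ht hst
      refine ⟨s * a + t * a', s * b + t * b', by positivity, by positivity, by nlinarith, ?_⟩
      have hst' : (s : ℂ) + t = 1 := by exact_mod_cast hst
      simp only [Complex.real_smul]
      push_cast
      linear_combination v * hst'
    refine convexHull_min ?_ hc hx
    rintro y (rfl | rfl | rfl)
    · exact ⟨0, 0, by simp⟩
    · exact ⟨1, 0, by simp⟩
    · exact ⟨0, 1, by simp [pow_succ']⟩
  · rintro ⟨a, b, ha, hb, hab, rfl⟩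
    have h0 : v ∈ convexHull ℝ (triCorners v k) := subset_convexHull ℝ _ (by simp [triCorners])
    have h1 : v + Complex.I ^ k ∈ convexHull ℝ (triCorners v k) :=
      subset_convexHull ℝ _ (by simp [triCorners])
    have h2 : v + Complex.I ^ (k + 1) ∈ convexHull ℝ (triCorners v k) :=
      subset_convexHull ℝ _ (by simp [triCorners])
    have h := (convex_convexHull ℝ (triCorners v k)).sum_mem (t := Finset.univ)
      (w := ![1 - a - b, a, b]) (z := ![v, v + Complex.I ^ k, v + Complex.I ^ (k + 1)])
      (by intro i _; fin_cases i <;> simp <;> linarith) (by simp [Fin.sum_univ_three]; ring)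
      (by intro i _; fin_cases i <;> simp [h0, h1, h2])
    rw [Fin.sum_univ_three] at h
    simp only [Matrix.cons_val_zero, Matrix.cons_val_one, Matrix.cons_val, Complex.real_smul] at h
    convert h using 1
    push_cast
    ring

theorem region_eq (δ : Bool) (w : ℂ) (t : LTile) :
    (t.place w).region δ = convexHull ℝ (triCorners (w + toPlane (t.apex δ)) (t.ori δ)) := by
  rw [PTile.region, corners_eq]

/-- The cell of a triangle. -/
def LTile.cell (δ : Bool) (t : LTile) : ℤ × ℤ := cellOf (t.apex δ) (t.ori δ)

/-- The half with orientation `k` of the unit cell with lower left corner `c`. -/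
def HalfCell (c : ℤ × ℤ) (k : Fin 4) (x y : ℝ) : Prop :=
  c.1 ≤ x ∧ x ≤ c.1 + 1 ∧ c.2 ≤ y ∧ y ≤ c.2 + 1 ∧
    match k with
    | 0 => (x - c.1) + (y - c.2) ≤ 1
    | 1 => y - c.2 ≤ x - c.1
    | 2 => 1 ≤ (x - c.1) + (y - c.2)
    | 3 => x - c.1 ≤ y - c.2

theorem mem_hull_iff_halfCell (a : ℤ × ℤ) (k : Fin 4) (w x : ℂ) :
    x ∈ convexHull ℝ (triCorners (w + toPlane a) k) ↔
      HalfCell (cellOf a k) k (x - w).re (x - w).im := by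
  rw [mem_convexHull_triCorners]
  have e : ∀ r s : ℝ, x = w + toPlane a + (r + s * Complex.I) * Complex.I ^ (k : ℕ) ↔
      (x - w).re = a.1 + ((r + s * Complex.I) * Complex.I ^ (k : ℕ)).re ∧
      (x - w).im = a.2 + ((r + s * Complex.I) * Complex.I ^ (k : ℕ)).im := by
    intro r s
    rw [Complex.ext_iff]
    simp only [toPlane, Complex.add_re, Complex.add_im, Complex.sub_re, Complex.sub_im,
      Complex.intCast_re, Complex.intCast_im, Complex.mul_re, Complex.mul_im, Complex.I_re,
      Complex.I_im]
    constructor <;> rintro ⟨h1, h2⟩ <;> constructor <;> linarith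
  simp only [e]
  generalize (x - w).re = X
  generalize (x - w).im = Y
  fin_cases k
  · simp [HalfCell, cellOf]
    constructor
    · rintro ⟨r, hr, s, hs, h, rfl, rfl⟩
      refine ⟨?_, ?_, ?_, ?_, ?_⟩ <;> linarith
    · rintro ⟨h1, h2, h3, h4, h5⟩
      exact ⟨X - a.1, by linarith, Y - a.2, by linarith, by linarith, by ring, by ring⟩
  · simp [HalfCell, cellOf]
    constructor
    · rintro ⟨r, hr, s, hs, h, rfl, rfl⟩
      refine ⟨?_, ?_, ?_, ?_, ?_⟩ <;> linarith
    · rintro ⟨h1, h2, h3, h4, h5⟩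
      exact ⟨Y - a.2, by linarith, a.1 - X, by linarith, by linarith, by ring, by ring⟩
  · simp [HalfCell, cellOf]
    constructor
    · rintro ⟨r, hr, s, hs, h, rfl, rfl⟩
      refine ⟨?_, ?_, ?_, ?_, ?_⟩ <;> linarith
    · rintro ⟨h1, h2, h3, h4, h5⟩
      exact ⟨a.1 - X, by linarith, a.2 - Y, by linarith, by linarith, by ring, by ring⟩
  · simp [HalfCell, cellOf, Complex.I_pow_three]
    constructor
    · rintro ⟨r, hr, s, hs, h, rfl, rfl⟩
      refine ⟨?_, ?_, ?_, ?_, ?_⟩ <;> linarith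
    · rintro ⟨h1, h2, h3, h4, h5⟩
      exact ⟨a.2 - Y, by linarith, X - a.1, by linarith, by linarith, by ring, by ring⟩

theorem mem_region_iff (δ : Bool) (w x : ℂ) (t : LTile) :
    x ∈ (t.place w).region δ ↔ HalfCell (t.cell δ) (t.ori δ) (x - w).re (x - w).im := by
  rw [region_eq, mem_hull_iff_halfCell, LTile.cell]

/-- A point inside the quarter `q` of the cell `z`. -/
noncomputable def quarterPoint (z : ℤ × ℤ) (q : Fin 4) : ℂ :=
  match q with
  | 0 => ⟨z.1 + 1 / 6, z.2 + 1 / 2⟩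
  | 1 => ⟨z.1 + 1 / 2, z.2 + 1 / 6⟩
  | 2 => ⟨z.1 + 5 / 6, z.2 + 1 / 2⟩
  | 3 => ⟨z.1 + 1 / 2, z.2 + 5 / 6⟩

theorem halfCell_eq_of_mem {c z : ℤ} {r : ℝ} (h0 : 0 < r) (h1 : r < 1) (h2 : (c : ℝ) ≤ z + r)
    (h3 : (z : ℝ) + r ≤ c + 1) : c = z := by
  have h4 : (c : ℝ) < (z + 1 : ℤ) := by push_cast; linarith
  have h5 : (z : ℝ) < (c + 1 : ℤ) := by push_cast; linarith
  have h6 := Int.cast_lt.1 h4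
  have h7 := Int.cast_lt.1 h5
  omega

/-- The test point avoids the sides and both diagonals of its cell, so it detects the combinatorial
relation `Covers` in the plane. -/
theorem quarterPoint_mem_region_iff (δ : Bool) (w : ℂ) (t : LTile) (z : ℤ × ℤ) (q : Fin 4) :
    w + quarterPoint z q ∈ (t.place w).region δ ↔ t.Covers δ z q := by
  rw [mem_region_iff, add_sub_cancel_left, LTile.Covers, ← LTile.cell]
  generalize t.cell δ = c
  generalize t.ori δ = k
  constructor
  · rintro ⟨h1, h2, h3, h4, h5⟩
    have e1 : c.1 = z.1 := by
      fin_cases q <;> simp only [quarterPoint] at h1 h2 <;>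
        exact halfCell_eq_of_mem (by norm_num) (by norm_num) h1 h2
    have e2 : c.2 = z.2 := by
      fin_cases q <;> simp only [quarterPoint] at h3 h4 <;>
        exact halfCell_eq_of_mem (by norm_num) (by norm_num) h3 h4
    refine ⟨Prod.ext e1 e2, ?_⟩
    rw [e1, e2] at h5
    fin_cases q <;> fin_cases k <;> simp [quarterPoint] at h5 ⊢ <;> norm_num at h5
  · rintro ⟨rfl, h⟩
    fin_cases k <;> rcases h with rfl | rfl <;> simp [HalfCell, quarterPoint] <;> norm_num

/-! ### Disjoint interiors -/

/-- A separating line: a surjective functional is open, so the interiors lie in the two open half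
planes. -/
theorem disjoint_interior_of_le {g : ℂ →L[ℝ] ℝ} (hg : Function.Surjective g) {A B : Set ℂ} {m : ℝ}
    (hA : ∀ x ∈ A, g x ≤ m) (hB : ∀ x ∈ B, m ≤ g x) : Disjoint (interior A) (interior B) := by
  have ho : IsOpenMap g := g.isOpenMap hg
  have h1 : interior A ⊆ g ⁻¹' Set.Iio m := by
    rw [← interior_Iic, ho.preimage_interior_eq_interior_preimage g.continuous]
    exact interior_mono hA
  have h2 : interior B ⊆ g ⁻¹' Set.Ioi m := by
    rw [← interior_Ici, ho.preimage_interior_eq_interior_preimage g.continuous]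
    exact interior_mono hB
  refine Set.disjoint_left.2 fun x hx hx' => ?_
  have h3 : g x < m := h1 hx
  have h4 : m < g x := h2 hx'
  exact lt_asymm h3 h4

/-- Two half cells that have no quarter in common: they are in different cells or opposite. -/
theorem cell_or_ori_of_not_covers {δ : Bool} {s t : LTile}
    (h : ∀ z q, s.Covers δ z q → ¬ t.Covers δ z q) (hc : s.cell δ = t.cell δ) :
    t.ori δ = s.ori δ + 2 := by
  have h1 := fun h' => h (s.cell δ) (s.ori δ) ⟨rfl, Or.inl rfl⟩ ⟨hc.symm, h'⟩
  have h2 := fun h' => h (s.cell δ) (s.ori δ + 1) ⟨rfl, Or.inr rfl⟩ ⟨hc.symm, h'⟩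
  generalize s.ori δ = k at *
  generalize t.ori δ = l at *
  revert h1 h2
  revert k l
  decide

/-- Triangles in different cells are separated by a vertical or horizontal grid line. Two triangles
in the same cell without a common quarter are opposite halves, separated by their hypotenuse. -/
theorem disjoint_interior_region {δ : Bool} {s t : LTile}
    (h : ∀ z q, s.Covers δ z q → ¬ t.Covers δ z q) (w : ℂ) :
    Disjoint (interior ((s.place w).region δ)) (interior ((t.place w).region δ)) := by
  have hs := fun x => (mem_region_iff δ w x s).1
  have ht := fun x => (mem_region_iff δ w x t).1
  have sre : Function.Surjective Complex.reCLM := fun r => ⟨r, by simp⟩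
  have sim : Function.Surjective Complex.imCLM := fun r => ⟨r * Complex.I, by simp⟩
  have cast : ∀ {a b : ℤ}, a < b → (a : ℝ) + 1 ≤ b := fun h => by exact_mod_cast h
  by_cases h1 : (s.cell δ).1 = (t.cell δ).1
  swap
  · rcases lt_or_gt_of_ne h1 with h1 | h1
    · refine disjoint_interior_of_le sre (m := (t.cell δ).1 + w.re) (fun x hx => ?_) fun x hx => ?_
      · have := (hs x hx).2.1
        simp only [Complex.sub_re] at this
        simp only [Complex.reCLM_apply]
        linarith [cast h1]
      · have := (ht x hx).1
        simp only [Complex.sub_re] at this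
        simp only [Complex.reCLM_apply]
        linarith
    · refine (disjoint_interior_of_le sre (m := (s.cell δ).1 + w.re) (fun x hx => ?_)
        fun x hx => ?_).symm
      · have := (ht x hx).2.1
        simp only [Complex.sub_re] at this
        simp only [Complex.reCLM_apply]
        linarith [cast h1]
      · have := (hs x hx).1
        simp only [Complex.sub_re] at this
        simp only [Complex.reCLM_apply]
        linarith
  by_cases h2 : (s.cell δ).2 = (t.cell δ).2
  swap
  · rcases lt_or_gt_of_ne h2 with h2 | h2
    · refine disjoint_interior_of_le sim (m := (t.cell δ).2 + w.im) (fun x hx => ?_) fun x hx => ?_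
      · have := (hs x hx).2.2.2.1
        simp only [Complex.sub_im] at this
        simp only [Complex.imCLM_apply]
        linarith [cast h2]
      · have := (ht x hx).2.2.1
        simp only [Complex.sub_im] at this
        simp only [Complex.imCLM_apply]
        linarith
    · refine (disjoint_interior_of_le sim (m := (s.cell δ).2 + w.im) (fun x hx => ?_)
        fun x hx => ?_).symm
      · have := (ht x hx).2.2.2.1
        simp only [Complex.sub_im] at this
        simp only [Complex.imCLM_apply]
        linarith [cast h2]
      · have := (hs x hx).2.2.1
        simp only [Complex.sub_im] at this
        simp only [Complex.imCLM_apply]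
        linarith
  have hc : s.cell δ = t.cell δ := Prod.ext h1 h2
  have hk := cell_or_ori_of_not_covers h hc
  have ssum : Function.Surjective (Complex.reCLM + Complex.imCLM) := fun r => ⟨r, by simp⟩
  have sdiff : Function.Surjective (Complex.reCLM - Complex.imCLM) := fun r => ⟨r, by simp⟩
  rw [hk, ← hc] at ht
  generalize s.cell δ = c at *
  generalize s.ori δ = k at *
  have key : ∀ {g : ℂ →L[ℝ] ℝ} (_ : Function.Surjective g) (m : ℝ),
      ((∀ x, HalfCell c k (x - w).re (x - w).im → g x ≤ m) ∧
        (∀ x, HalfCell c (k + 2) (x - w).re (x - w).im → m ≤ g x)) ∨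
      ((∀ x, HalfCell c k (x - w).re (x - w).im → m ≤ g x) ∧
        (∀ x, HalfCell c (k + 2) (x - w).re (x - w).im → g x ≤ m)) →
      Disjoint (interior ((s.place w).region δ)) (interior ((t.place w).region δ)) := by
    rintro g hg m (⟨k1, k2⟩ | ⟨k1, k2⟩)
    · exact disjoint_interior_of_le hg (fun x hx => k1 x (hs x hx)) fun x hx => k2 x (ht x hx)
    · exact (disjoint_interior_of_le hg (fun x hx => k2 x (ht x hx))
        fun x hx => k1 x (hs x hx)).symm
  fin_cases k
  · refine key ssum (c.1 + c.2 + 1 + w.re + w.im) (Or.inl ⟨?_, ?_⟩) <;>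
      · rintro x ⟨-, -, -, -, h⟩
        simp at h ⊢
        linarith
  · refine key sdiff (c.1 - c.2 + w.re - w.im) (Or.inr ⟨?_, ?_⟩) <;>
      · rintro x ⟨-, -, -, -, h⟩
        simp at h ⊢
        linarith
  · refine key ssum (c.1 + c.2 + 1 + w.re + w.im) (Or.inr ⟨?_, ?_⟩) <;>
      · rintro x ⟨-, -, -, -, h⟩
        simp at h ⊢
        linarith
  · refine key sdiff (c.1 - c.2 + w.re - w.im) (Or.inl ⟨?_, ?_⟩) <;>
      · rintro x ⟨-, -, -, -, h⟩
        simp at h ⊢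
        linarith

/-! ### Edge-to-edge -/

/-- `HalfCell` for lattice points. -/
def IntHalfCell (c : ℤ × ℤ) (k : Fin 4) (x y : ℤ) : Prop :=
  c.1 ≤ x ∧ x ≤ c.1 + 1 ∧ c.2 ≤ y ∧ y ≤ c.2 + 1 ∧
    match k with
    | 0 => (x - c.1) + (y - c.2) ≤ 1
    | 1 => y - c.2 ≤ x - c.1
    | 2 => 1 ≤ (x - c.1) + (y - c.2)
    | 3 => x - c.1 ≤ y - c.2

theorem mem_latticeCorners_iff (a : ℤ × ℤ) (k : Fin 4) (p : ℤ × ℤ) :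
    p ∈ latticeCorners a k ↔ IntHalfCell (cellOf a k) k p.1 p.2 := by
  obtain ⟨a, b⟩ := a
  obtain ⟨x, y⟩ := p
  fin_cases k <;> simp [latticeCorners, IntHalfCell, cellOf, step] <;> omega

theorem int_cast_cases {c m : ℤ} {x : ℝ} (h1 : (c : ℝ) ≤ x) (h2 : x ≤ c + 1) (h3 : (m : ℝ) ≤ x)
    (h4 : x < m + 1) : m = c ∨ m = c + 1 := by
  have h5 : (c : ℝ) < (m + 1 : ℤ) := by push_cast; linarith
  have h6 : (m : ℝ) ≤ (c + 1 : ℤ) := by push_cast; linarith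
  have h7 := Int.cast_lt.1 h5
  have h8 := Int.cast_le.1 h6
  omega

/-- A half cell contains with each point the smallest vertex, edge or cell around it. -/
theorem halfCell_vertical {c : ℤ × ℤ} {k : Fin 4} {m n : ℤ} {y : ℝ} (h : HalfCell c k m y)
    (h1 : (n : ℝ) < y) (h2 : y < n + 1) : IntHalfCell c k m n ∧ IntHalfCell c k m (n + 1) := by
  obtain ⟨a1, a2, a3, a4, a5⟩ := h
  have hn : n = c.2 := by
    rcases int_cast_cases a3 a4 h1.le h2 with h | h
    · exact h
    · rw [h] at h1; push_cast at h1; linarith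
  subst hn
  have b1 : c.1 ≤ m := by exact_mod_cast a1
  have b2 : m ≤ c.1 + 1 := by exact_mod_cast a2
  obtain rfl | rfl : m = c.1 ∨ m = c.1 + 1 := by omega
  · fin_cases k <;> simp [IntHalfCell] at a5 ⊢ <;> linarith
  · fin_cases k <;> simp [IntHalfCell] at a5 ⊢ <;> linarith

theorem halfCell_horizontal {c : ℤ × ℤ} {k : Fin 4} {m n : ℤ} {x : ℝ} (h : HalfCell c k x n)
    (h1 : (m : ℝ) < x) (h2 : x < m + 1) : IntHalfCell c k m n ∧ IntHalfCell c k (m + 1) n := by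
  obtain ⟨a1, a2, a3, a4, a5⟩ := h
  have hm : m = c.1 := by
    rcases int_cast_cases a1 a2 h1.le h2 with h | h
    · exact h
    · rw [h] at h1; push_cast at h1; linarith
  subst hm
  have b1 : c.2 ≤ n := by exact_mod_cast a3
  have b2 : n ≤ c.2 + 1 := by exact_mod_cast a4
  obtain rfl | rfl : n = c.2 ∨ n = c.2 + 1 := by omega
  · fin_cases k <;> simp [IntHalfCell] at a5 ⊢ <;> linarith
  · fin_cases k <;> simp [IntHalfCell] at a5 ⊢ <;> linarith

theorem halfCell_int {c : ℤ × ℤ} {k : Fin 4} {m n : ℤ} (h : HalfCell c k m n) :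
    IntHalfCell c k m n := by
  obtain ⟨a1, a2, a3, a4, a5⟩ := h
  refine ⟨by exact_mod_cast a1, by exact_mod_cast a2, by exact_mod_cast a3,
    by exact_mod_cast a4, ?_⟩
  fin_cases k <;> simp at a5 ⊢ <;> exact_mod_cast a5

theorem halfCell_interior {c : ℤ × ℤ} {k : Fin 4} {m n : ℤ} {x y : ℝ} (h : HalfCell c k x y)
    (h1 : (m : ℝ) < x) (h2 : x < m + 1) (h3 : (n : ℝ) < y) (h4 : y < n + 1) : c = (m, n) := by
  obtain ⟨a1, a2, a3, a4, -⟩ := h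
  refine Prod.ext ?_ ?_
  · rcases int_cast_cases a1 a2 h1.le h2 with h | h
    · exact h.symm
    · rw [h] at h1; push_cast at h1; linarith
  · rcases int_cast_cases a3 a4 h3.le h4 with h | h
    · exact h.symm
    · rw [h] at h3; push_cast at h3; linarith

theorem toPlane_injective (w : ℂ) : Function.Injective fun z => w + toPlane z := by
  intro u v h
  have h' := add_left_cancel h
  simp only [toPlane, Complex.ext_iff] at h'
  simp at h'
  exact Prod.ext h'.1 h'.2

theorem corners_inter (δ : Bool) (w : ℂ) (s t : LTile) :
    (s.place w).corners δ ∩ (t.place w).corners δ = (fun z => w + toPlane z) ''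
      ((latticeCorners (s.apex δ) (s.ori δ) ∩ latticeCorners (t.apex δ) (t.ori δ) :
        Finset (ℤ × ℤ)) : Set (ℤ × ℤ)) := by
  rw [corners_eq, corners_eq, triCorners_eq_image, triCorners_eq_image, Finset.coe_inter,
    Set.image_inter (toPlane_injective w)]

theorem mem_hull_of_segment {S : Set ℂ} {w x : ℂ} {p q : ℤ × ℤ} (hp : w + toPlane p ∈ S)
    (hq : w + toPlane q ∈ S) {r : ℝ} (h0 : 0 ≤ r) (h1 : r ≤ 1)
    (hre : (x - w).re = p.1 + r * (q.1 - p.1)) (him : (x - w).im = p.2 + r * (q.2 - p.2)) :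
    x ∈ convexHull ℝ S := by
  refine segment_subset_convexHull hp hq ⟨1 - r, r, by linarith, h0, by ring, ?_⟩
  simp only [Complex.sub_re, Complex.sub_im] at hre him
  apply Complex.ext
  · simp [toPlane]; linarith
  · simp [toPlane]; linarith

/-- A common point is a grid vertex, lies inside a grid edge, or lies inside a cell. In the first
two cases both triangles contain that vertex or both ends of that edge; in the last one they are
opposite halves and the point is on their common hypotenuse. -/
theorem region_inter {δ : Bool} {s t : LTile} (h : ∀ z q, s.Covers δ z q → ¬ t.Covers δ z q)
    (w : ℂ) : (s.place w).region δ ∩ (t.place w).region δ =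
      convexHull ℝ ((s.place w).corners δ ∩ (t.place w).corners δ) := by
  refine Set.Subset.antisymm ?_ (Set.subset_inter (convexHull_mono Set.inter_subset_left)
    (convexHull_mono Set.inter_subset_right))
  rintro x ⟨hs, ht⟩
  rw [mem_region_iff] at hs ht
  have corner : ∀ m n : ℤ, IntHalfCell (s.cell δ) (s.ori δ) m n →
      IntHalfCell (t.cell δ) (t.ori δ) m n →
      w + toPlane (m, n) ∈ (s.place w).corners δ ∩ (t.place w).corners δ := by
    intro m n h1 h2
    rw [corners_inter]
    exact ⟨(m, n), Finset.mem_inter.2 ⟨(mem_latticeCorners_iff _ _ _).2 h1,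
      (mem_latticeCorners_iff _ _ _).2 h2⟩, rfl⟩
  set X := (x - w).re with hX
  set Y := (x - w).im with hY
  have m1 := Int.floor_le X
  have m2 := Int.lt_floor_add_one X
  have n1 := Int.floor_le Y
  have n2 := Int.lt_floor_add_one Y
  set m := ⌊X⌋
  set n := ⌊Y⌋
  rcases m1.eq_or_lt with m1 | m1
  · rw [← m1] at hs ht
    rcases n1.eq_or_lt with n1 | n1
    · rw [← n1] at hs ht
      have hc := corner m n (halfCell_int hs) (halfCell_int ht)
      exact mem_hull_of_segment hc hc (r := 0) (by norm_num) (by norm_num) (by simp [m1, ← hX])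
        (by simp [n1, ← hY])
    · obtain ⟨a1, a2⟩ := halfCell_vertical hs n1 n2
      obtain ⟨b1, b2⟩ := halfCell_vertical ht n1 n2
      refine mem_hull_of_segment (corner _ _ a1 b1) (corner _ _ a2 b2) (r := Y - n)
        (by linarith) (by linarith) ?_ ?_
      · simp [m1, ← hX]
      · push_cast; linarith
  · rcases n1.eq_or_lt with n1 | n1
    · rw [← n1] at hs ht
      obtain ⟨a1, a2⟩ := halfCell_horizontal hs m1 m2
      obtain ⟨b1, b2⟩ := halfCell_horizontal ht m1 m2
      refine mem_hull_of_segment (corner _ _ a1 b1) (corner _ _ a2 b2) (r := X - m)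
        (by linarith) (by linarith) ?_ ?_
      · push_cast; linarith
      · simp [n1, ← hY]
    · have c1 := halfCell_interior hs m1 m2 n1 n2
      have c2 := halfCell_interior ht m1 m2 n1 n2
      have hk := cell_or_ori_of_not_covers h (c1.trans c2.symm)
      rw [hk] at ht corner
      rw [c1] at hs
      rw [c2] at ht
      rw [c1, c2] at corner
      obtain ⟨-, -, -, -, a⟩ := hs
      obtain ⟨-, -, -, -, b⟩ := ht
      generalize s.ori δ = k at *
      fin_cases k <;> simp at a b
      · exact mem_hull_of_segment (corner (m + 1) n (by simp [IntHalfCell]) (by simp [IntHalfCell]))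
          (corner m (n + 1) (by simp [IntHalfCell]) (by simp [IntHalfCell])) (r := Y - n)
          (by linarith) (by linarith) (by push_cast; linarith) (by push_cast; linarith)
      · exact mem_hull_of_segment (corner m n (by simp [IntHalfCell]) (by simp [IntHalfCell]))
          (corner (m + 1) (n + 1) (by simp [IntHalfCell]) (by simp [IntHalfCell])) (r := Y - n)
          (by linarith) (by linarith) (by push_cast; linarith) (by push_cast; linarith)
      · exact mem_hull_of_segment (corner (m + 1) n (by simp [IntHalfCell]) (by simp [IntHalfCell]))
          (corner m (n + 1) (by simp [IntHalfCell]) (by simp [IntHalfCell])) (r := Y - n)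
          (by linarith) (by linarith) (by push_cast; linarith) (by push_cast; linarith)
      · exact mem_hull_of_segment (corner m n (by simp [IntHalfCell]) (by simp [IntHalfCell]))
          (corner (m + 1) (n + 1) (by simp [IntHalfCell]) (by simp [IntHalfCell])) (r := Y - n)
          (by linarith) (by linarith) (by push_cast; linarith) (by push_cast; linarith)

theorem latticeCorners_subset {a b : ℤ × ℤ} {k l : Fin 4}
    (h : latticeCorners a k ⊆ latticeCorners b l) : cellOf a k = cellOf b l ∧ k = l := by
  have h1 := h (by simp [latticeCorners] : a ∈ latticeCorners a k)
  have h2 := h (by simp [latticeCorners] : a + step k ∈ latticeCorners a k)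
  have h3 := h (by simp [latticeCorners] : a + step (k + 1) ∈ latticeCorners a k)
  rw [mem_latticeCorners_iff] at h1 h2 h3
  generalize cellOf b l = c at *
  obtain ⟨x, y⟩ := a
  obtain ⟨u, v⟩ := c
  fin_cases k <;> fin_cases l <;>
    simp [IntHalfCell, step, cellOf] at h1 h2 h3 ⊢ <;> omega

theorem latticeCorners_card (a : ℤ × ℤ) (k : Fin 4) : (latticeCorners a k).card ≤ 3 :=
  Finset.card_le_three

theorem ncard_corners_inter {δ : Bool} {s t : LTile}
    (h : ∀ z q, s.Covers δ z q → ¬ t.Covers δ z q) (w : ℂ) :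
    ((s.place w).corners δ ∩ (t.place w).corners δ).ncard ≤ 2 := by
  rw [corners_inter, Set.ncard_image_of_injective _ (toPlane_injective w), Set.ncard_coe_finset]
  by_contra! hc
  have h1 : latticeCorners (s.apex δ) (s.ori δ) ∩ latticeCorners (t.apex δ) (t.ori δ) =
      latticeCorners (s.apex δ) (s.ori δ) :=
    Finset.eq_of_subset_of_card_le Finset.inter_subset_left
      ((latticeCorners_card _ _).trans hc)
  obtain ⟨h2, h3⟩ := latticeCorners_subset (Finset.inter_eq_left.1 h1)
  exact h _ _ (s.exists_covers δ) ⟨h2.symm, Or.inl h3⟩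

/-! ### Existence of a tiling -/

theorem not_covers_of_ne {ε δ : Bool} {κ : Kind} (hκ : κ.HasRule) {n : ℕ} {s t : LTile}
    (hs : s ∈ supertile ε δ κ n) (ht : t ∈ supertile ε δ κ n) (hst : s ≠ t) :
    ∀ z q, s.Covers δ z q → ¬ t.Covers δ z q := fun _ _ h h' =>
  hst (supertile_unique hκ hs ht h h')

theorem supertile_disjoint_interior {ε δ : Bool} {κ : Kind} (hκ : κ.HasRule) {n : ℕ} (w : ℂ) :
    (supertile ε δ κ n : Set LTile).Pairwise fun s t =>
      Disjoint (interior ((s.place w).region δ)) (interior ((t.place w).region δ)) :=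
  fun _ hs _ ht hst => disjoint_interior_region (not_covers_of_ne hκ hs ht hst) w

/-- One substitution may exchange the colours of the wheel, two restore it. This is why
`limitTiling` uses even levels only. -/
theorem patch_subset_add_two (ε δ : Bool) (n : ℕ) :
    patch ε δ false (2 * n) ⊆ patch ε δ false (2 * (n + 1)) := by
  intro t ht
  have h := patch_subset_succ ε δ _ _ (patch_subset_succ ε δ _ _ ht)
  rwa [Bool.xor_assoc, Bool.xor_self, Bool.xor_false] at h

theorem patch_mono (ε δ : Bool) {m n : ℕ} (h : m ≤ n) :
    patch ε δ false (2 * m) ⊆ patch ε δ false (2 * n) := by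
  induction n, h using Nat.le_induction with
  | base => exact fun _ h => h
  | succ n _ ih => exact fun _ h => patch_subset_add_two ε δ n (ih h)

/-- The union of the patches that grow from a wheel. -/
def limitTiling (ε δ : Bool) : Set PTile :=
  {t | ∃ n, ∃ s ∈ patch ε δ false (2 * n), t = s.place 0}

theorem place_act (w : ℂ) (q : Addr) (t : LTile) :
    (t.act false q).place w = t.place (w + reshape q) := by
  simp [LTile.place, LTile.act, halfTurn, reshape_add, add_assoc]

/-- The two halves of a cell fill it. -/
theorem halfCell_cover (c : ℤ × ℤ) (k : Fin 4) {x y : ℝ} (h1 : c.1 ≤ x) (h2 : x ≤ c.1 + 1)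
    (h3 : c.2 ≤ y) (h4 : y ≤ c.2 + 1) : HalfCell c k x y ∨ HalfCell c (k + 2) x y := by
  rcases le_total ((x - c.1) + (y - c.2)) 1 with h | h <;>
    rcases le_total (x - c.1) (y - c.2) with h' | h' <;>
    fin_cases k <;> simp only [HalfCell, h1, h2, h3, h4, true_and] <;>
    first
      | exact Or.inl h
      | exact Or.inr h
      | exact Or.inl h'
      | exact Or.inr h'

/-- A triangle with orientation `k` covers the quarters `k` and `k + 1` of its cell. So the quarter
`k + 2` needs another triangle, which can only be the opposite half. -/
theorem exists_opposite {ε δ : Bool} {n : ℕ} {z : ℤ × ℤ} (hx : |z.1| + 1 < n)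
    (hy : |z.2| + 1 < n) : ∃ s ∈ patch ε δ false n, ∃ t ∈ patch ε δ false n,
      s.cell δ = z ∧ t.cell δ = z ∧ t.ori δ = s.ori δ + 2 := by
  obtain ⟨s, hs, hs'⟩ := patch_exists_covers ε δ false hx hy 0
  obtain ⟨t, ht, ht'⟩ := patch_exists_covers ε δ false hx hy (s.ori δ + 2)
  refine ⟨s, hs, t, ht, hs'.1, ht'.1, ?_⟩
  refine cell_or_ori_of_not_covers (fun u q h h' => ?_) (hs'.1.trans ht'.1.symm)
  have e : u = z := h.1.symm.trans hs'.1
  subst e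
  obtain rfl := patch_unique hx hy hs ht h h'
  have := ht'.2
  revert this
  generalize s.ori δ = k
  revert k
  decide

/-- The patches are nested, so finitely many triangles lie in a common patch, which is part of a
supertile. Disjointness is inherited from supertiles, and every cell is filled once the patch is
large enough. -/
theorem exists_isGenerated (ε δ : Bool) : IsGenerated ε δ (limitTiling ε δ) := by
  have common : ∀ F : Set PTile, F.Finite → F ⊆ limitTiling ε δ →
      ∃ n, ∀ t ∈ F, ∃ s ∈ patch ε δ false (2 * n), t = s.place 0 := by
    intro F hF
    induction F, hF using Set.Finite.induction_on with
    | empty => exact fun _ => ⟨0, fun t ht => ht.elim⟩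
    | @insert a S _ _ ih =>
      intro h
      obtain ⟨n, hn⟩ := ih fun t ht => h (Set.mem_insert_of_mem _ ht)
      obtain ⟨m, s, hs, hsa⟩ := h (Set.mem_insert a S)
      refine ⟨max m n, ?_⟩
      rintro t (rfl | ht)
      · exact ⟨s, patch_mono ε δ (le_max_left m n) hs, hsa⟩
      · obtain ⟨u, hu, hut⟩ := hn t ht
        exact ⟨u, patch_mono ε δ (le_max_right m n) hu, hut⟩
  have generated : ∀ F : Set PTile, F.Finite → F ⊆ limitTiling ε δ →
      ∃ (κ : Kind) (n : ℕ) (w : ℂ), κ.HasRule ∧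
        F ⊆ LTile.place w '' (supertile ε δ κ n : Set LTile) := by
    intro F hF hF'
    obtain ⟨n, hn⟩ := common F hF hF'
    obtain ⟨Q, hQ⟩ := patch_subset_supertile ε δ (2 * n)
    refine ⟨.tri false false true true, 3 + 2 * n, - reshape Q, by decide, fun t ht => ?_⟩
    obtain ⟨s, hs, rfl⟩ := hn t ht
    exact ⟨s.act false Q, hQ s hs, by rw [place_act, neg_add_cancel]⟩
  refine ⟨⟨?_, ?_⟩, generated⟩
  · refine Set.eq_univ_of_forall fun x => ?_
    set z : ℤ × ℤ := (⌊x.re⌋, ⌊x.im⌋)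
    set n := (|z.1| + |z.2| + 2).toNat
    have h1 := abs_nonneg z.1
    have h2 := abs_nonneg z.2
    obtain ⟨s, hs, t, ht, hsz, htz, hst⟩ := exists_opposite (ε := ε) (δ := δ) (n := 2 * n) (z := z)
      (by push_cast; omega) (by push_cast; omega)
    simp only [Set.mem_iUnion]
    rcases halfCell_cover z (s.ori δ) (Int.floor_le x.re) (Int.lt_floor_add_one x.re).le
      (Int.floor_le x.im) (Int.lt_floor_add_one x.im).le with h | h
    · refine ⟨_, ⟨n, s, hs, rfl⟩, (mem_region_iff δ 0 x s).2 ?_⟩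
      rwa [hsz, sub_zero]
    · refine ⟨_, ⟨n, t, ht, rfl⟩, (mem_region_iff δ 0 x t).2 ?_⟩
      rwa [htz, hst, sub_zero]
  · intro s hs t ht hst
    obtain ⟨κ, n, w, hκ, hF⟩ := generated {s, t} (by simp) (by
      rintro u (rfl | rfl)
      · exact hs
      · exact ht)
    obtain ⟨s', hs', rfl⟩ := hF (Set.mem_insert _ _)
    obtain ⟨t', ht', rfl⟩ := hF (Set.mem_insert_of_mem _ rfl)
    exact supertile_disjoint_interior hκ w hs' ht' (by rintro rfl; exact hst rfl)

/-! ### Shape of the triangles of a generated tiling -/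

theorem IsGenerated.exists_shape {ε δ : Bool} {T : Set PTile} (hT : IsGenerated ε δ T) :
    ∀ t ∈ T, ∃ (v : ℂ) (k : ℕ),
      t.region δ = convexHull ℝ {v, v + Complex.I ^ k, v + Complex.I ^ (k + 1)} := by
  intro t ht
  obtain ⟨κ, n, w, -, hF⟩ := hT.2 {t} (by simp) (by simpa using ht)
  obtain ⟨s, -, rfl⟩ := hF rfl
  exact ⟨_, _, region_eq δ w s⟩

theorem IsGenerated.isEdgeToEdge {ε δ : Bool} {T : Set PTile} (hT : IsGenerated ε δ T) :
    IsEdgeToEdge δ T := by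
  intro s hs t ht hst
  obtain ⟨κ, n, w, hκ, hF⟩ := hT.2 {s, t} (by simp) (by
    rintro u (rfl | rfl)
    · exact hs
    · exact ht)
  obtain ⟨s', hs', rfl⟩ := hF (Set.mem_insert _ _)
  obtain ⟨t', ht', rfl⟩ := hF (Set.mem_insert_of_mem _ rfl)
  have h := not_covers_of_ne hκ hs' ht' (by rintro rfl; exact hst rfl)
  exact ⟨region_inter h w, ncard_corners_inter h w⟩

/-! ### Periods of labelled square grids -/

/-- The displacement of a lift `a` of the square lattice under a translation by `(p, q)`. -/
def displacement (a : ℤ → ℤ → Addr) (p q x y : ℤ) : Addr := a (x + p) (y + q) - a x y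

/-- If the vertical labels are invariant under a translation, then the displacement is constant
along columns. -/
theorem displacement_column {a : ℤ → ℤ → Addr} {N p q : ℤ}
    (hper : ∀ x y, |x| ≤ N → |y| ≤ N →
      a (x + p) (y + 1 + q) - a (x + p) (y + q) = a x (y + 1) - a x y)
    {x y : ℤ} (hx : |x| ≤ N) (j : ℕ) (h0 : -N ≤ y) (h1 : y + j ≤ N + 1) :
    displacement a p q x (y + j) = displacement a p q x y := by
  induction j with
  | zero => simp
  | succ j ih =>
    rw [← ih (by push_cast at h1; omega)]
    have h := hper x (y + j) hx (abs_le.2 ⟨by omega, by push_cast at h1; omega⟩)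
    have e : y + ((j + 1 : ℕ) : ℤ) = y + j + 1 := by push_cast; ring
    rw [e, displacement, displacement]
    exact sub_eq_sub_iff_sub_eq_sub.1 h

theorem add_le_of_steps {g : ℤ → ℝ} {y : ℤ} {M : ℕ}
    (h : ∀ j : ℕ, j < M → g (y + j) + 1 ≤ g (y + j + 1)) : g y + M ≤ g (y + M) := by
  induction M with
  | zero => simp
  | succ M ih =>
    have h1 := ih fun j hj => h j (by omega)
    have h2 := h M (by omega)
    have e : y + ((M + 1 : ℕ) : ℤ) = y + M + 1 := by push_cast; ring
    rw [e]
    push_cast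
    linarith

/-- A lift of a box of the square lattice has the same displacement everywhere if its vertical
labels are invariant, its horizontal labels have distinct differences, and along a column with
constant horizontal label some bounded function `f` would be strictly monotone. -/
theorem displacement_row {a : ℤ → ℤ → Addr} {N p q : ℤ} {M : ℕ} {C : ℝ} {f : Addr →+ ℝ}
    {S : Set Addr} {H K : Addr}
    (hS : ∀ s ∈ S, ∀ t ∈ S, ∀ s' ∈ S, ∀ t' ∈ S, s - t = s' - t' → s ≠ t → t = t')
    (hL : ∀ x y, |x| ≤ N → |y| ≤ N → a (x + 1) y - a x y ∈ S)
    (hV : ∀ x y, |x| ≤ N → |y| ≤ N →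
      (a x (y + 1) - a x y = K ∧ f (a x (y + 1) - a x y) ≤ -1) ∨
      (a x (y + 1) - a x y ≠ K ∧ 1 ≤ f (a x (y + 1) - a x y)))
    (hcell : ∀ x y, |x| ≤ N → |y| ≤ N →
      (a x (y + 1) - a x y = K ↔ a (x + 1) y - a x y = H) ∨
      (a (x + 1) (y + 1) - a (x + 1) y = K ↔ a (x + 1) y - a x y = H))
    (hper : ∀ x y, |x| ≤ N → |y| ≤ N →
      a (x + p) (y + 1 + q) - a (x + p) (y + q) = a x (y + 1) - a x y)
    (hC : ∀ x y, |x| ≤ N → |y| ≤ N → |f (a x y)| ≤ C) (hM : 2 * C < M)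
    {x y : ℤ} (hx : |x| + 1 + |p| ≤ N) (hy : |y| + M + |q| ≤ N) :
    displacement a p q (x + 1) y = displacement a p q x y := by
  have ap := abs_nonneg p
  have aq := abs_nonneg q
  have x1 : |x| ≤ N := by omega
  have x2 : |x + 1| ≤ N := by have := abs_add_le x 1; simp only [abs_one] at this; omega
  have x3 : |x + p| ≤ N := by have := abs_add_le x p; omega
  have yb := abs_le.1 (le_refl |y|)
  have qb := abs_le.1 (le_refl |q|)
  have y1 : ∀ j : ℕ, j ≤ M → |y + j| ≤ N := fun j hj => abs_le.2 ⟨by omega, by omega⟩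
  have y2 : ∀ j : ℕ, j ≤ M → |y + j + q| ≤ N := fun j hj => abs_le.2 ⟨by omega, by omega⟩
  by_contra hne
  -- The change of the displacement from column `x` to column `x + 1` is the difference of a
  -- translated horizontal label and the original one. Both displacements are constant along
  -- columns, so it is the same in all rows.
  have diff : ∀ j : ℕ, j ≤ M → (a (x + p + 1) (y + j + q) - a (x + p) (y + j + q)) -
      (a (x + 1) (y + j) - a x (y + j)) =
      displacement a p q (x + 1) y - displacement a p q x y := by
    intro j hj
    rw [← displacement_column hper x1 j (by omega) (by omega),
      ← displacement_column hper x2 j (by omega) (by omega), displacement, displacement,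
      add_right_comm x 1 p]
    abel
  -- A nonzero difference of two labels determines both of them, so the label itself is the same in
  -- all these rows.
  have label : ∀ j : ℕ, j ≤ M → a (x + 1) (y + j) - a x (y + j) = a (x + 1) y - a x y := by
    intro j hj
    have h0 := diff 0 (by omega)
    simp only [Nat.cast_zero, add_zero] at h0
    have y20 := y2 0 (by omega)
    have y10 := y1 0 (by omega)
    simp only [Nat.cast_zero, add_zero] at y20 y10
    refine hS _ (hL _ _ x3 (y2 j hj)) _ (hL _ _ x1 (y1 j hj)) _ (hL _ _ x3 y20) _
      (hL _ _ x1 y10) ((diff j hj).trans h0.symm) fun h => hne ?_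
    have := diff j hj
    rw [h, sub_self] at this
    exact (sub_eq_zero.1 this.symm)
  have vert : ∀ j : ℕ, j < M → (a x (y + j + 1) - a x (y + j) = K ↔
      a (x + 1) y - a x y = H) := by
    intro j hj
    have h1 := label j hj.le
    have h2 := label (j + 1) hj
    push_cast at h2
    rw [← add_assoc] at h2
    have h3 : a (x + 1) (y + j + 1) - a (x + 1) (y + j) = a x (y + j + 1) - a x (y + j) := by
      have h4 := h2.trans h1.symm
      exact sub_eq_sub_iff_sub_eq_sub.1 h4
    have h5 := hcell x (y + j) x1 (y1 j hj.le)
    -- With equal horizontal labels below and above, the vertical labels on the left and on the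
    -- right agree, so both alternatives of `hcell` say the same.
    rw [h1, h3, or_self] at h5
    exact h5
  have b0 := abs_le.1 (hC x y x1 (by simpa using y1 0 (by omega)))
  -- Along the column, `f` now moves by at least 1 in a fixed direction in each of `M` steps,
  -- although its values differ by at most `2 * C < M`.
  have b1 := abs_le.1 (hC x (y + M) x1 (y1 M le_rfl))
  by_cases hl : a (x + 1) y - a x y = H
  · have := add_le_of_steps (g := fun y => - f (a x y)) (y := y) (M := M) fun j hj => by
      rcases hV x (y + j) x1 (y1 j hj.le) with h | h
      · have := h.2
        rw [map_sub] at this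
        linarith
      · exact absurd ((vert j hj).2 hl) h.1
    linarith
  · have := add_le_of_steps (g := fun y => f (a x y)) (y := y) (M := M) fun j hj => by
      rcases hV x (y + j) x1 (y1 j hj.le) with h | h
      · exact absurd ((vert j hj).1 h.1) hl
      · have := h.2
        rw [map_sub] at this
        linarith
    linarith

/-- A nonzero address cannot be short in both embeddings. -/
theorem one_le_norm_mul_norm {b : Addr} (hb : b ≠ 0) : 1 ≤ ‖phys b‖ * ‖internal b‖ := by
  -- The squared lengths are conjugate elements of `ℤ[√3]`, so their product is an integer norm. It
  -- vanishes only for `b = 0`, because `√3` is irrational.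
  have h : ‖phys b‖ ^ 2 * ‖internal b‖ ^ 2 =
      ((ratPart b * ratPart b - 3 * (irrPart b * irrPart b) : ℤ) : ℝ) := by
    rw [norm_phys_sq, norm_internal_sq]
    push_cast
    linear_combination (- (irrPart b : ℝ) ^ 2) * sqrt_three_sq
  have h0 : 0 ≤ ratPart b * ratPart b - 3 * (irrPart b * irrPart b) := by
    have : (0 : ℝ) ≤ ((ratPart b * ratPart b - 3 * (irrPart b * irrPart b) : ℤ) : ℝ) := by
      rw [← h]; positivity
    exact_mod_cast this
  have hrat : 0 < ratPart b := by
    obtain ⟨a, b, c, d⟩ := b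
    have e : 4 * ratPart (a, b, c, d) =
        (2 * a + c) ^ 2 + 3 * c ^ 2 + (2 * b + d) ^ 2 + 3 * d ^ 2 := by
      simp only [ratPart]; ring
    by_contra hneg
    have := sq_nonneg (2 * a + c)
    have := sq_nonneg c
    have := sq_nonneg (2 * b + d)
    have := sq_nonneg d
    have hc : c = 0 := pow_eq_zero_iff (two_ne_zero) |>.1 (by omega)
    have hd : d = 0 := pow_eq_zero_iff (two_ne_zero) |>.1 (by omega)
    have ha : 2 * a + c = 0 := pow_eq_zero_iff (two_ne_zero) |>.1 (by omega)
    have hb' : 2 * b + d = 0 := pow_eq_zero_iff (two_ne_zero) |>.1 (by omega)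
    apply hb
    rw [Prod.ext_iff, Prod.ext_iff, Prod.ext_iff]
    refine ⟨?_, ?_, ?_, ?_⟩ <;> simp <;> omega
  have h1 : 1 ≤ ratPart b * ratPart b - 3 * (irrPart b * irrPart b) := by
    rcases h0.lt_or_eq with h0 | h0
    · exact h0
    · exfalso
      have irr : Irrational (√(3 : ℕ)) := Nat.Prime.irrational_sqrt (by norm_num)
      by_cases hi : irrPart b = 0
      · rw [hi] at h0
        nlinarith
      · refine irr ⟨|ratPart b| / |irrPart b|, ?_⟩
        have hi' : (0 : ℝ) < |(irrPart b : ℝ)| := abs_pos.2 (by exact_mod_cast hi)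
        push_cast
        rw [eq_comm, Real.sqrt_eq_iff_mul_self_eq (by norm_num) (by positivity), div_mul_div_comm,
          abs_mul_abs_self, abs_mul_abs_self, eq_div_iff (by
            have : (irrPart b : ℝ) ≠ 0 := by exact_mod_cast hi
            positivity)]
        have : 3 * (irrPart b * irrPart b) = ratPart b * ratPart b := by omega
        have h3 : ((3 * (irrPart b * irrPart b) : ℤ) : ℝ) = (ratPart b * ratPart b : ℤ) := by rw [this]
        push_cast at h3 ⊢
        linarith
  have h2 : (1 : ℝ) ≤ (‖phys b‖ * ‖internal b‖) ^ 2 := by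
    rw [mul_pow, h]
    exact_mod_cast h1
  nlinarith [norm_nonneg (phys b), norm_nonneg (internal b),
    mul_nonneg (norm_nonneg (phys b)) (norm_nonneg (internal b))]

/-- A lift of a box of the square lattice at bounded distance from the physical space has no
constant displacement, if the box is large. -/
theorem not_displacement_const {a : ℤ → ℤ → Addr} {p q : ℤ} (hpq : (p, q) ≠ (0, 0)) {C : ℝ}
    {n : ℕ} (hn : 2 * C * (4 * (|p| + |q|) + 2 * C) < n)
    (hflat : reshape (displacement a p q 0 0) = toPlane (2 * p, 2 * q))
    (hC : ∀ i : ℕ, i ≤ n → ‖internal (a (i * p) (i * q))‖ ≤ C)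
    (hconst : ∀ i : ℕ, i < n → displacement a p q (i * p) (i * q) = displacement a p q 0 0) :
    False := by
  set b := displacement a p q 0 0
  -- The conjugates along the orbit of the period form an arithmetic progression. Its boundedness
  -- over `n` steps forces its difference to be of size at most `2 * C / n`.
  have hsum : ∀ i : ℕ, i ≤ n →
      internal (a (i * p) (i * q)) = internal (a 0 0) + i * internal b := by
    intro i hi
    induction i with
    | zero => simp
    | succ i ih =>
      have h := hconst i hi
      rw [displacement, sub_eq_iff_eq_add] at h
      have e1 : ((i + 1 : ℕ) : ℤ) * p = i * p + p := by push_cast; ring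
      have e2 : ((i + 1 : ℕ) : ℤ) * q = i * q + q := by push_cast; ring
      rw [e1, e2, h, internal_add, ih (by omega)]
      push_cast
      ring
  have h0 : ‖internal (a 0 0)‖ ≤ C := by simpa using hC 0 (by omega)
  have hC0 : 0 ≤ C := (norm_nonneg _).trans h0
  have hlin : ∀ i : ℕ, i ≤ n → i * ‖internal b‖ ≤ 2 * C := by
    intro i hi
    have h1 : ‖(i : ℂ) * internal b‖ = ‖internal (a (i * p) (i * q)) - internal (a 0 0)‖ := by
      rw [hsum i hi, add_sub_cancel_left]
    rw [norm_mul, Complex.norm_natCast] at h1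
    rw [h1]
    linarith [norm_sub_le (internal (a (i * p) (i * q))) (internal (a 0 0)), hC i hi]
  have hb : b ≠ 0 := by
    intro hb
    rw [hb] at hflat
    have h1 := congrArg Complex.re hflat
    have h2 := congrArg Complex.im hflat
    simp [reshape, toPlane] at h1 h2
    apply hpq
    rw [h1, h2]
  have hn0 : 1 ≤ n := by
    have : (0 : ℝ) < n := lt_of_le_of_lt (by positivity) hn
    exact_mod_cast this
  have hi1 : ‖internal b‖ ≤ 2 * C := by simpa using hlin 1 hn0
  have hr : ‖reshape b‖ ≤ 2 * (|p| + |q|) := by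
    rw [hflat]
    refine (Complex.norm_le_abs_re_add_abs_im _).trans (le_of_eq ?_)
    simp [toPlane, abs_mul]
    ring
  -- The reshaped displacement is known and its conjugate part is bounded, which bounds the physical
  -- part as well.
  have hp : ‖phys b‖ ≤ 4 * (|p| + |q|) + 2 * C := by
    have := norm_reshape_ge b
    have h4 : (0 : ℝ) ≤ |p| := by positivity
    have h5 : (0 : ℝ) ≤ |q| := by positivity
    linarith
  have h1 := one_le_norm_mul_norm hb
  have h2 := hlin n le_rfl
  have h3 : (n : ℝ) ≤ n * ‖internal b‖ * ‖phys b‖ := by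
    have : (n : ℝ) * 1 ≤ n * (‖phys b‖ * ‖internal b‖) := by gcongr
    linarith
  have h4 : n * ‖internal b‖ * ‖phys b‖ ≤ 2 * C * (4 * (|p| + |q|) + 2 * C) := by
    gcongr
  linarith

/-! ### The lift of a supertile -/

/-- The lift of the leg on the side of the cell at the quarter `q`, upwards or from left to
right. -/
def Kind.side (κ : Kind) (q : Fin 4) : Addr :=
  match q with
  | 0 => κ.ver
  | 1 => κ.hor
  | 2 => κ.ver
  | 3 => κ.hor

/-- The lift of the lower or left end of the side of the cell at the quarter `q`, for a triangle
that covers this quarter. -/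
def LTile.sideStart (δ : Bool) (t : LTile) (q : Fin 4) : Addr :=
  match q with
  | 0 => if t.ori δ = 0 then t.apexLift δ else t.apexLift δ - t.kind.ver
  | 1 => if t.ori δ = 0 then t.apexLift δ else t.apexLift δ - t.kind.hor
  | 2 => if t.ori δ = 1 then t.apexLift δ else t.apexLift δ - t.kind.ver
  | 3 => if t.ori δ = 3 then t.apexLift δ else t.apexLift δ - t.kind.hor

/-- The lower or left end of the side of the cell at the quarter `q`. -/
def sideOrigin (z : ℤ × ℤ) (q : Fin 4) : ℤ × ℤ :=
  match q with
  | 0 => z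
  | 1 => z
  | 2 => z + (1, 0)
  | 3 => z + (0, 1)

/-- The side of a cell at the quarter `q` as a vector, in doubled coordinates. -/
def sideStep (q : Fin 4) : ℤ × ℤ :=
  match q with
  | 0 => (0, 2)
  | 1 => (2, 0)
  | 2 => (0, 2)
  | 3 => (2, 0)

theorem Kind.flat_side (κ : Kind) (q : Fin 4) : flat (κ.side q) = sideStep q := by
  have h0 := κ.flat_leg 0
  have h1 := κ.flat_leg 1
  fin_cases q
  · exact h1
  · exact h0
  · exact h1
  · exact h0

theorem flat_sub (p q : Addr) : flat (p - q) = flat p - flat q := by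
  rw [sub_eq_add_neg, flat_add, flat_neg, sub_eq_add_neg]

theorem LTile.flat_sideStart {δ : Bool} {t : LTile} {z : ℤ × ℤ} {q : Fin 4}
    (h : t.Covers δ z q) : flat (t.sideStart δ q) = sideOrigin z q + sideOrigin z q := by
  obtain ⟨rfl, h⟩ := h
  have hv := t.kind.flat_side 0
  have hh := t.kind.flat_side 1
  have ha := t.flat_apexLift δ
  generalize hk : t.ori δ = k at h
  simp only [Kind.side] at hv hh
  generalize t.apex δ = a at *
  obtain ⟨a, b⟩ := a
  fin_cases k <;> rcases h with rfl | rfl <;>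
    simp [LTile.sideStart, hk, sideOrigin, cellOf, flat_sub, hv, hh, ha, sideStep] <;> omega

/-- On a counterclockwise boundary the south and east sides are traversed in the positive direction,
the west and north sides in the negative one. -/
theorem LTile.side_mem_sides {δ : Bool} {t : LTile} {z : ℤ × ℤ} {q : Fin 4}
    (h : t.Covers δ z q) :
    (if q = 1 ∨ q = 2 then (t.sideStart δ q, t.sideStart δ q + t.kind.side q)
      else (t.sideStart δ q + t.kind.side q, t.sideStart δ q)) ∈
      sides (t.apexLift δ) (t.kind.leg (t.ori δ)) (t.kind.leg (t.ori δ + 1)) := by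
  obtain ⟨-, h⟩ := h
  generalize hk : t.ori δ = k at *
  fin_cases k <;> rcases h with rfl | rfl <;>
    simp [LTile.sideStart, hk, Kind.side, sides, Kind.leg, sub_eq_add_neg]

section
variable {ε δ : Bool} {κ : Kind} {n : ℕ} {s t : LTile}

/-- The lifts of two triangles agree on a common side of neighbouring cells. -/
theorem supertile_side (hκ : κ.HasRule) (hs : s ∈ supertile ε δ κ n)
    (ht : t ∈ supertile ε δ κ n) {z z' : ℤ × ℤ} {q : Fin 4} (hq : q = 0 ∨ q = 1)
    (hz : sideOrigin z' (q + 2) = z) (h : s.Covers δ z q) (h' : t.Covers δ z' (q + 2)) :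
    t.sideStart δ (q + 2) = s.sideStart δ q ∧ t.kind.side q = s.kind.side q := by
  have hs1 := LTile.side_mem_sides h
  have ht1 := LTile.side_mem_sides h'
  have hs2 := LTile.flat_sideStart h
  have ht2 := LTile.flat_sideStart h'
  have e : sideOrigin z q = z := by rcases hq with rfl | rfl <;> rfl
  have e' : t.kind.side (q + 2) = t.kind.side q := by rcases hq with rfl | rfl <;> rfl
  rw [e'] at ht1
  rw [e] at hs2
  rw [hz, ← hs2] at ht2
  have hb : flat (t.sideStart δ (q + 2) + t.kind.side q) =
      flat (s.sideStart δ q + s.kind.side q) := by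
    rw [flat_add, flat_add, ht2, Kind.flat_side, Kind.flat_side]
  have key : t.sideStart δ (q + 2) = s.sideStart δ q ∧
      t.sideStart δ (q + 2) + t.kind.side q = s.sideStart δ q + s.kind.side q := by
    rcases hq with rfl | rfl
    · exact supertile_match hκ ht hs ht1 hs1 ht2 hb
    · exact (supertile_match hκ ht hs ht1 hs1 hb ht2).symm
  refine ⟨key.1, ?_⟩
  have := key.2
  rw [key.1] at this
  exact add_left_cancel this

/-- The hypotenuse of a triangle with right angle `a` and orientation `k` and that of its opposite
triangle have the same lift. -/
theorem supertile_diag (hκ : κ.HasRule) (hs : s ∈ supertile ε δ κ n)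
    (ht : t ∈ supertile ε δ κ n) (hc : s.cell δ = t.cell δ) (ho : t.ori δ = s.ori δ + 2) :
    s.apexLift δ + s.kind.leg (s.ori δ) = t.apexLift δ - t.kind.leg (s.ori δ + 1) ∧
      s.apexLift δ + s.kind.leg (s.ori δ + 1) = t.apexLift δ - t.kind.leg (s.ori δ) := by
  have e : s.ori δ + 2 + 1 = s.ori δ + 1 + 2 := add_right_comm _ _ _
  have hfl : ∀ k, cellOf (s.apex δ) k = cellOf (t.apex δ) (k + 2) →
      s.apex δ + step k + step (k + 1) = t.apex δ := by
    generalize s.apex δ = a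
    generalize t.apex δ = b
    obtain ⟨a, a'⟩ := a
    obtain ⟨b, b'⟩ := b
    intro k
    fin_cases k <;> simp [cellOf, step] <;> omega
  have hc' := hfl (s.ori δ) (by rw [← ho]; exact hc)
  have h := supertile_match hκ hs ht (a := s.apexLift δ + s.kind.leg (s.ori δ))
    (b := s.apexLift δ + s.kind.leg (s.ori δ + 1)) (a' := t.apexLift δ - t.kind.leg (s.ori δ + 1))
    (b' := t.apexLift δ - t.kind.leg (s.ori δ)) (by simp [sides])
    (by rw [ho, e, Kind.leg_add_two, Kind.leg_add_two]; simp [sides, sub_eq_add_neg])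
    (by
      rw [flat_add, flat_sub, LTile.flat_apexLift, LTile.flat_apexLift, Kind.flat_leg,
        Kind.flat_leg, ← hc']
      abel)
    (by
      rw [flat_add, flat_sub, LTile.flat_apexLift, LTile.flat_apexLift, Kind.flat_leg,
        Kind.flat_leg, ← hc']
      abel)
  exact h

/-- Two triangles in the same cell are equal or opposite. -/
theorem eq_or_opposite (hκ : κ.HasRule) (hs : s ∈ supertile ε δ κ n)
    (ht : t ∈ supertile ε δ κ n) (hc : s.cell δ = t.cell δ) :
    s = t ∨ t.ori δ = s.ori δ + 2 := by
  by_cases hst : s = t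
  · exact Or.inl hst
  · exact Or.inr (cell_or_ori_of_not_covers (not_covers_of_ne hκ hs ht hst) hc)

/-- The lift of the lower left vertex is well defined within a cell: either one triangle has its
right angle there, or the two halves meet along the rising diagonal that starts there. The next two
lemmas treat the upper left and lower right vertices in the same way. -/
theorem supertile_west_south (hκ : κ.HasRule) (hs : s ∈ supertile ε δ κ n)
    (ht : t ∈ supertile ε δ κ n) {z : ℤ × ℤ} (h : s.Covers δ z 0) (h' : t.Covers δ z 1) :
    s.sideStart δ 0 = t.sideStart δ 1 := by
  have hc : s.cell δ = t.cell δ := h.1.trans h'.1.symm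
  have o := h.2
  have o' := h'.2
  rcases eq_or_opposite hκ hs ht hc with rfl | ho
  · have : s.ori δ = 0 := by
      generalize s.ori δ = k at *
      revert k; decide
    simp [LTile.sideStart, this]
  · have : s.ori δ = 3 ∧ t.ori δ = 1 := by
      generalize s.ori δ = k at *
      generalize t.ori δ = l at *
      revert k l; decide
    have hd := (supertile_diag hκ hs ht hc ho).1
    rw [this.1] at hd
    simpa [LTile.sideStart, this, Kind.leg, sub_eq_add_neg] using hd

theorem supertile_west_north (hκ : κ.HasRule) (hs : s ∈ supertile ε δ κ n)
    (ht : t ∈ supertile ε δ κ n) {z : ℤ × ℤ} (h : s.Covers δ z 0) (h' : t.Covers δ z 3) :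
    s.sideStart δ 0 + s.kind.ver = t.sideStart δ 3 := by
  have hc : s.cell δ = t.cell δ := h.1.trans h'.1.symm
  have o := h.2
  have o' := h'.2
  rcases eq_or_opposite hκ hs ht hc with rfl | ho
  · have : s.ori δ = 3 := by
      generalize s.ori δ = k at *
      revert k; decide
    simp [LTile.sideStart, this]
  · have : s.ori δ = 0 ∧ t.ori δ = 2 := by
      generalize s.ori δ = k at *
      generalize t.ori δ = l at *
      revert k l; decide
    have hd := (supertile_diag hκ hs ht hc ho).2
    rw [this.1] at hd
    simpa [LTile.sideStart, this, Kind.leg, sub_eq_add_neg] using hd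

theorem supertile_south_east (hκ : κ.HasRule) (hs : s ∈ supertile ε δ κ n)
    (ht : t ∈ supertile ε δ κ n) {z : ℤ × ℤ} (h : s.Covers δ z 1) (h' : t.Covers δ z 2) :
    s.sideStart δ 1 + s.kind.hor = t.sideStart δ 2 := by
  have hc : s.cell δ = t.cell δ := h.1.trans h'.1.symm
  have o := h.2
  have o' := h'.2
  rcases eq_or_opposite hκ hs ht hc with rfl | ho
  · have : s.ori δ = 1 := by
      generalize s.ori δ = k at *
      revert k; decide
    simp [LTile.sideStart, this]
  · have : s.ori δ = 0 ∧ t.ori δ = 2 := by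
      generalize s.ori δ = k at *
      generalize t.ori δ = l at *
      revert k l; decide
    have hd := (supertile_diag hκ hs ht hc ho).1
    rw [this.1] at hd
    simpa [LTile.sideStart, this, Kind.leg, sub_eq_add_neg] using hd

end

/-! ### Labels of the sides of cells -/

/-- The lift of a leg that ends in the centre of a square, on the sides at the quarter `q`. -/
def centreLabel (q : Fin 4) : Addr := (Kind.quarter false false false).side q

/-- Whether the hypotenuse of a triangle with orientation `k` falls from left to right. -/
def isFalling (k : Fin 4) : Bool := decide (k = 0 ∨ k = 2)

/-- The label of a side of a cell that does not end in the centre of a square, where `b` tells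
whether the hypotenuse at this side is falling. -/
def legLabel (δ b : Bool) : Addr :=
  if δ then (if b then (2, 0, 0, 0) else (0, 2, 0, -2))
  else (if b then (0, 0, 2, 0) else (0, 0, 0, 2))

/-- The direction of the sides whose labels are determined by the hypotenuses: vertical for
`δ = false` and horizontal for `δ = true`. -/
def mainQuarter (δ : Bool) : Fin 4 := if δ then 1 else 0

/-- The label of a side of a cell, given the two hypotenuses next to it. -/
def sideLabel (δ b b' : Bool) : Addr :=
  if b = b' then legLabel δ b else centreLabel (mainQuarter δ)

theorem Kind.hor_eq_or (κ : Kind) : κ.hor = legLabel true true ∨ κ.hor = legLabel true false ∨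
    κ.hor = centreLabel 1 := by
  revert κ; decide

theorem Kind.ver_eq_or (κ : Kind) : κ.ver = legLabel false true ∨ κ.ver = legLabel false false ∨
    κ.ver = centreLabel 0 := by
  revert κ; decide

theorem Kind.ver_eq_iff (κ : Kind) : κ.ver = centreLabel 0 ↔ κ.hor = centreLabel 1 := by
  revert κ; decide

/-- The way in which the unit squares are cut decides for which direction of sides the hypotenuse
determines the label; hence `mainQuarter` depends on `δ`. -/
theorem Kind.side_eq_legLabel : ∀ (δ r : Bool) (κ : Kind),
    κ.side (mainQuarter δ) ≠ centreLabel (mainQuarter δ) → κ.side (mainQuarter δ) =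
      legLabel δ (isFalling (κ.ori δ + if r then 2 else 0)) := by
  decide

/-- In doubled coordinates vertices of the lattice are even, whereas the centre of a square on `d₁,
d₄` has an odd first coordinate. A side that ends in such a centre belongs to a quarter of a square,
whose right angle is at the centre. -/
theorem Kind.odd_apexLift : ∀ (δ : Bool) (κ : Kind),
    κ.side (mainQuarter δ) = centreLabel (mainQuarter δ) → (κ.apexLift δ).1 % 2 = 1 := by
  decide

theorem LTile.odd_apexLift {δ : Bool} {t : LTile}
    (h : t.kind.side (mainQuarter δ) = centreLabel (mainQuarter δ)) :
    (t.apexLift δ).1 % 2 = 1 := by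
  have := Kind.odd_apexLift δ t.kind h
  cases hr : t.rot <;> simp [LTile.apexLift, halfTurn, hr] <;> omega

/-- The hypotenuses on both sides determine the label of a side. -/
theorem side_eq_sideLabel {δ : Bool} {s t : LTile} {z z' : ℤ × ℤ}
    (hs : s.Covers δ z (mainQuarter δ)) (ht : t.Covers δ z' (mainQuarter δ + 2))
    (h1 : t.sideStart δ (mainQuarter δ + 2) = s.sideStart δ (mainQuarter δ))
    (h2 : t.kind.side (mainQuarter δ) = s.kind.side (mainQuarter δ)) :
    s.kind.side (mainQuarter δ) = sideLabel δ (isFalling (s.ori δ)) (isFalling (t.ori δ)) := by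
  by_cases hc : s.kind.side (mainQuarter δ) = centreLabel (mainQuarter δ)
  · have os := LTile.odd_apexLift hc
    have ot := LTile.odd_apexLift (h2.trans hc)
    have hc' := h2.trans hc
    have k1 := hs.2
    have k2 := ht.2
    -- Parity tells which end of the common side is the centre. Both right angles are there, so the
    -- two triangles are mirror images in this side, and one hypotenuse rises while the other falls.
    have key : isFalling (s.ori δ) ≠ isFalling (t.ori δ) := by
      cases δ
      · have e : (t.sideStart false 2).1 = (s.sideStart false 0).1 := congrArg Prod.fst h1
        have c1 : s.kind.ver = (-1, 1, 1, 0) := hc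
        have c2 : t.kind.ver = (-1, 1, 1, 0) := hc'
        generalize hk : s.ori false = k at *
        generalize hl : t.ori false = l at *
        have a1 : k = 0 ∨ k = 3 := by revert k1; clear * -; revert k; decide
        have a2 : l = 2 ∨ l = 1 := by revert k2; clear * -; revert l; decide
        rcases a1 with rfl | rfl <;> rcases a2 with rfl | rfl <;>
          simp [LTile.sideStart, hk, hl, c1, c2, isFalling] at e ⊢ <;> omega
      · have e : (t.sideStart true 3).1 = (s.sideStart true 1).1 := congrArg Prod.fst h1
        have c1 : s.kind.hor = (1, 1, -1, 0) := hc
        have c2 : t.kind.hor = (1, 1, -1, 0) := hc'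
        generalize hk : s.ori true = k at *
        generalize hl : t.ori true = l at *
        have a1 : k = 1 ∨ k = 0 := by revert k1; clear * -; revert k; decide
        have a2 : l = 2 ∨ l = 3 := by revert k2; clear * -; revert l; decide
        rcases a1 with rfl | rfl <;> rcases a2 with rfl | rfl <;>
          simp [LTile.sideStart, hk, hl, c1, c2, isFalling] at e ⊢ <;> omega
    rw [sideLabel, if_neg key, hc]
  · have e1 := Kind.side_eq_legLabel δ s.rot s.kind hc
    have e2 := Kind.side_eq_legLabel δ t.rot t.kind (by rwa [h2])
    rw [← LTile.ori] at e1 e2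
    rw [h2, e1] at e2
    -- The two labels of legs are different, so a common label means equal directions of the
    -- hypotenuses.
    have key : isFalling (s.ori δ) = isFalling (t.ori δ) := by
      revert e2
      generalize isFalling (s.ori δ) = b
      generalize isFalling (t.ori δ) = b'
      clear * -
      revert δ b b'
      decide
    rw [sideLabel, if_pos key, e1]

/-! ### Bounds in the conjugate embedding -/

theorem norm_internal_le (p : Addr) :
    ‖internal p‖ ≤ 2 * (|p.1| + |p.2.1| + |p.2.2.1| + |p.2.2.2| : ℤ) := by
  refine (Complex.norm_le_abs_re_add_abs_im _).trans ?_
  obtain ⟨a, b, c, d⟩ := p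
  obtain ⟨s1, s2⟩ := sqrt_three_bounds
  simp only [internal]
  push_cast
  have hs : |√3 / 2| ≤ 1 := by rw [abs_le]; constructor <;> linarith
  have hb : |(b : ℝ) * (√3 / 2)| ≤ |(b : ℝ)| := by
    rw [abs_mul]; exact mul_le_of_le_one_right (abs_nonneg _) hs
  have hc : |(c : ℝ) * (√3 / 2)| ≤ |(c : ℝ)| := by
    rw [abs_mul]; exact mul_le_of_le_one_right (abs_nonneg _) hs
  have hb2 : |(b : ℝ) / 2| = |(b : ℝ)| / 2 := by rw [abs_div]; norm_num
  have hc2 : |(c : ℝ) / 2| = |(c : ℝ)| / 2 := by rw [abs_div]; norm_num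
  have h1 : |(a : ℝ) + c / 2 - b * (√3 / 2)| ≤ |(a : ℝ)| + |(c : ℝ)| / 2 + |(b : ℝ)| := by
    refine (abs_sub _ _).trans (add_le_add ((abs_add_le _ _).trans ?_) hb)
    rw [hc2]
  have h2 : |(b : ℝ) / 2 - c * (√3 / 2) + d| ≤ |(b : ℝ)| / 2 + |(c : ℝ)| + |(d : ℝ)| := by
    refine (abs_add_le _ _).trans (add_le_add_left ((abs_sub _ _).trans ?_) _)
    rw [hb2]
    linarith
  linarith [abs_nonneg (a : ℝ), abs_nonneg (b : ℝ), abs_nonneg (c : ℝ), abs_nonneg (d : ℝ)]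

theorem Kind.apexLift_small : ∀ (δ : Bool) (κ : Kind),
    |(κ.apexLift δ).1| + |(κ.apexLift δ).2.1| + |(κ.apexLift δ).2.2.1| +
      |(κ.apexLift δ).2.2.2| ≤ 4 := by
  decide

theorem Kind.ver_small : ∀ κ : Kind,
    |κ.ver.1| + |κ.ver.2.1| + |κ.ver.2.2.1| + |κ.ver.2.2.2| ≤ 3 := by
  decide

/-- In doubled coordinates the first corner contributes at most `2 * 1.9`, the way to the right
angle at most 8, and a vertical leg at most 6. -/
theorem LTile.Good.norm_internal_sideStart {t : LTile} (ht : t.Good) (δ : Bool) :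
    ‖internal (t.sideStart δ 0)‖ ≤ 18 := by
  have h1 : ‖internal (t.apexLift δ)‖ ≤ 11.8 := by
    rw [LTile.apexLift, internal_add, internal_add]
    refine (norm_add_le _ _).trans ?_
    rw [norm_internal_halfTurn]
    have h2 := norm_internal_le (t.kind.apexLift δ)
    have h3 : ((_ : ℤ) : ℝ) ≤ (4 : ℤ) := Int.cast_le.2 (Kind.apexLift_small δ t.kind)
    have h4 := norm_add_le (internal t.pos) (internal t.pos)
    have h5 := ht.2
    push_cast at h2 h3
    linarith
  have h2 : ‖internal t.kind.ver‖ ≤ 6 := by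
    have h2 := norm_internal_le t.kind.ver
    have h3 : ((_ : ℤ) : ℝ) ≤ (3 : ℤ) := Int.cast_le.2 (Kind.ver_small t.kind)
    push_cast at h2 h3
    linarith
  simp only [LTile.sideStart]
  split_ifs
  · linarith
  · rw [sub_eq_add_neg, internal_add, internal_neg]
    have := norm_sub_le (internal (t.apexLift δ)) (internal t.kind.ver)
    rw [← sub_eq_add_neg]
    linarith

/-! ### A supertile has no period on a large box -/

/-- A lift of the vertices with coordinates `|x|, |y| ≤ N` relative to `z₀`, whose labels are
determined by the directions of the hypotenuses. -/
structure IsLift (δ : Bool) (z₀ : ℤ × ℤ) (N : ℤ) (a : ℤ → ℤ → Addr) (φ : ℤ → ℤ → Bool) :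
    Prop where
  hor : ∀ x y, |x| ≤ N → |y| ≤ N → a (x + 1) y - a x y = legLabel true true ∨
    a (x + 1) y - a x y = legLabel true false ∨ a (x + 1) y - a x y = centreLabel 1
  ver : ∀ x y, |x| ≤ N → |y| ≤ N → a x (y + 1) - a x y = legLabel false true ∨
    a x (y + 1) - a x y = legLabel false false ∨ a x (y + 1) - a x y = centreLabel 0
  cell : ∀ x y, |x| ≤ N → |y| ≤ N →
    (a x (y + 1) - a x y = centreLabel 0 ↔ a (x + 1) y - a x y = centreLabel 1) ∨
    ((a (x + 1) (y + 1) - a (x + 1) y = centreLabel 0 ↔ a (x + 1) y - a x y = centreLabel 1) ∧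
      (a (x + 1) (y + 1) - a x (y + 1) = centreLabel 1 ↔ a x (y + 1) - a x y = centreLabel 0))
  main_ver : δ = false → ∀ x y, |x| ≤ N → |y| ≤ N →
    a x (y + 1) - a x y = sideLabel false (φ x y) (φ (x - 1) y)
  main_hor : δ = true → ∀ x y, |x| ≤ N → |y| ≤ N →
    a (x + 1) y - a x y = sideLabel true (φ x y) (φ x (y - 1))
  norm_le : ∀ x y, |x| ≤ N → |y| ≤ N → ‖internal (a x y)‖ ≤ 18
  flat_eq : ∀ x y, |x| ≤ N → |y| ≤ N → flat (a x y) = z₀ + (x, y) + (z₀ + (x, y))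

/-- Each grid point is lifted by means of the triangle at the west quarter of its cell. The matching
lemmas within a cell and between neighbouring cells show that all other triangles lead to the same
lift, so the differences are labels of actual legs. -/
theorem exists_lift {ε δ : Bool} {κ : Kind} (hκ : κ.HasRule) {n : ℕ} {z₀ : ℤ × ℤ} {N : ℤ}
    (hcov : ∀ x y, |x| ≤ N + 1 → |y| ≤ N + 1 → ∀ q,
      ∃ s ∈ supertile ε δ κ n, s.Covers δ (z₀ + (x, y)) q) :
    ∃ a φ, IsLift δ z₀ N a φ ∧ ∀ x y, |x| ≤ N + 1 → |y| ≤ N + 1 → ∀ q,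
      ∀ s ∈ supertile ε δ κ n, s.Covers δ (z₀ + (x, y)) q → isFalling (s.ori δ) = φ x y := by
  have : Nonempty LTile := ⟨⟨κ, false, 0⟩⟩
  choose! τ hτ using hcov
  have fall : ∀ x y, |x| ≤ N + 1 → |y| ≤ N + 1 → ∀ q, ∀ s ∈ supertile ε δ κ n,
      s.Covers δ (z₀ + (x, y)) q → isFalling (s.ori δ) = isFalling ((τ x y 0).ori δ) := by
    intro x y hx hy q s hs h
    obtain ⟨ht, h'⟩ := hτ x y hx hy 0
    rcases eq_or_opposite hκ ht hs (h'.1.trans h.1.symm) with h1 | h1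
    · rw [h1]
    · rw [h1]
      generalize (τ x y 0).ori δ = k
      revert k
      decide
  have up : ∀ x : ℤ, |x| ≤ N → |x| ≤ N + 1 ∧ |x + 1| ≤ N + 1 ∧ |x - 1| ≤ N + 1 := by
    intro x hx
    rw [abs_le] at hx
    simp only [abs_le]
    omega
  set a : ℤ → ℤ → Addr := fun x y => (τ x y 0).sideStart δ 0
  have south : ∀ x y, |x| ≤ N + 1 → |y| ≤ N + 1 → a x y = (τ x y 1).sideStart δ 1 := by
    intro x y hx hy
    obtain ⟨h0, h0'⟩ := hτ x y hx hy 0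
    obtain ⟨h1, h1'⟩ := hτ x y hx hy 1
    exact supertile_west_south hκ h0 h1 h0' h1'
  have east : ∀ x y, |x| ≤ N + 1 → |x + 1| ≤ N + 1 → |y| ≤ N + 1 →
      (τ x y 2).sideStart δ 2 = a (x + 1) y ∧ (τ x y 2).kind.ver = (τ (x + 1) y 0).kind.ver := by
    intro x y hx hx' hy
    obtain ⟨h0, h0'⟩ := hτ (x + 1) y hx' hy 0
    obtain ⟨h2, h2'⟩ := hτ x y hx hy 2
    exact supertile_side hκ h0 h2 (Or.inl rfl) (by simp [sideOrigin, add_assoc]) h0' h2'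
  have north : ∀ x y, |x| ≤ N + 1 → |y| ≤ N + 1 → |y + 1| ≤ N + 1 →
      (τ x y 3).sideStart δ 3 = a x (y + 1) ∧ (τ x y 3).kind.hor = (τ x (y + 1) 1).kind.hor := by
    intro x y hx hy hy'
    obtain ⟨h1, h1'⟩ := hτ x (y + 1) hx hy' 1
    obtain ⟨h3, h3'⟩ := hτ x y hx hy 3
    have := supertile_side hκ h1 h3 (Or.inr rfl) (by simp [sideOrigin, add_assoc]) h1' h3'
    rw [south x (y + 1) hx hy']
    exact this
  have horeq : ∀ x y, |x| ≤ N + 1 → |x + 1| ≤ N + 1 → |y| ≤ N + 1 →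
      a (x + 1) y - a x y = (τ x y 1).kind.hor := by
    intro x y hx hx' hy
    obtain ⟨h1, h1'⟩ := hτ x y hx hy 1
    obtain ⟨h2, h2'⟩ := hτ x y hx hy 2
    rw [← (east x y hx hx' hy).1, ← supertile_south_east hκ h1 h2 h1' h2', south x y hx hy]
    abel
  have vereq : ∀ x y, |x| ≤ N + 1 → |y| ≤ N + 1 → |y + 1| ≤ N + 1 →
      a x (y + 1) - a x y = (τ x y 0).kind.ver := by
    intro x y hx hy hy'
    obtain ⟨h0, h0'⟩ := hτ x y hx hy 0
    obtain ⟨h3, h3'⟩ := hτ x y hx hy 3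
    rw [← (north x y hx hy hy').1, ← supertile_west_north hκ h0 h3 h0' h3']
    abel
  refine ⟨a, fun x y => isFalling ((τ x y 0).ori δ), ⟨?_, ?_, ?_, ?_, ?_, ?_, ?_⟩, fall⟩
  · intro x y hx hy
    rw [horeq x y (up x hx).1 (up x hx).2.1 (up y hy).1]
    exact Kind.hor_eq_or _
  · intro x y hx hy
    rw [vereq x y (up x hx).1 (up y hy).1 (up y hy).2.1]
    exact Kind.ver_eq_or _
  · intro x y hx hy
    obtain ⟨x1, x2, -⟩ := up x hx
    obtain ⟨y1, y2, -⟩ := up y hy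
    rw [horeq x y x1 x2 y1, vereq x y x1 y1 y2, vereq (x + 1) y x2 y1 y2, horeq x (y + 1) x1 x2 y2]
    obtain ⟨h0, h0'⟩ := hτ x y x1 y1 0
    obtain ⟨h1, h1'⟩ := hτ x y x1 y1 1
    obtain ⟨h2, h2'⟩ := hτ x y x1 y1 2
    obtain ⟨h3, h3'⟩ := hτ x y x1 y1 3
    -- If the diagonal falls, one triangle has the west and south sides as legs. If it rises, one
    -- triangle has the west and north sides and the other one the south and east sides. The two
    -- legs of a triangle both end in a centre or neither does, which gives the two alternatives.
    have hk : (τ x y 0).ori δ = 0 ∨ (τ x y 0).ori δ = 3 := by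
      have := h0'.2
      generalize (τ x y 0).ori δ = k at *
      revert k; decide
    rcases hk with hk | hk
    · left
      have : τ x y 0 = τ x y 1 := supertile_unique hκ h0 h1 ⟨h0'.1, Or.inr (by rw [hk]; rfl)⟩ h1'
      rw [← this]
      exact Kind.ver_eq_iff _
    · right
      have e3 : τ x y 0 = τ x y 3 := supertile_unique hκ h0 h3 ⟨h0'.1, Or.inl hk.symm⟩ h3'
      have hk1 : (τ x y 1).ori δ = 1 := by
        rcases eq_or_opposite hκ h0 h1 (h0'.1.trans h1'.1.symm) with h | h
        · have := h1'.2
          rw [← h, hk] at this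
          exact absurd this (by decide)
        · rw [h, hk]; rfl
      have e2 : τ x y 1 = τ x y 2 :=
        supertile_unique hκ h1 h2 ⟨h1'.1, Or.inr (by rw [hk1]; rfl)⟩ h2'
      rw [← (east x y x1 x2 y1).2, ← (north x y x1 y1 y2).2, ← e2, ← e3]
      exact ⟨Kind.ver_eq_iff _, (Kind.ver_eq_iff _).symm⟩
  · rintro rfl x y hx hy
    obtain ⟨x1, -, x2⟩ := up x hx
    obtain ⟨y1, y2, -⟩ := up y hy
    obtain ⟨h0, h0'⟩ := hτ x y x1 y1 0
    obtain ⟨h2, h2'⟩ := hτ (x - 1) y x2 y1 2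
    rw [vereq x y x1 y1 y2, ← fall (x - 1) y x2 y1 2 _ h2 h2']
    obtain ⟨e1, e2⟩ := supertile_side hκ h0 h2 (Or.inl rfl) (by
      simp [sideOrigin, add_assoc]) h0' h2'
    exact side_eq_sideLabel (δ := false) h0' h2' e1 e2
  · rintro rfl x y hx hy
    obtain ⟨x1, x2, -⟩ := up x hx
    obtain ⟨y1, -, y2⟩ := up y hy
    obtain ⟨h1, h1'⟩ := hτ x y x1 y1 1
    obtain ⟨h3, h3'⟩ := hτ x (y - 1) x1 y2 3
    rw [horeq x y x1 x2 y1, ← fall x (y - 1) x1 y2 3 _ h3 h3', ← fall x y x1 y1 1 _ h1 h1']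
    obtain ⟨e1, e2⟩ := supertile_side hκ h1 h3 (Or.inr rfl) (by
      simp [sideOrigin, add_assoc]) h1' h3'
    exact side_eq_sideLabel (δ := true) h1' h3' e1 e2
  · intro x y hx hy
    exact (supertile_good hκ (hτ x y (up x hx).1 (up y hy).1 0).1).norm_internal_sideStart δ
  · intro x y hx hy
    exact LTile.flat_sideStart (hτ x y (up x hx).1 (up y hy).1 0).2

/-! ### From periodic hypotenuses to a constant displacement of the lift. -/

theorem eq_zero_of_steps {α : Type*} {g : ℤ → α} {m : ℤ}
    (h : ∀ x, |x| ≤ m → g (x + 1) = g x) {x : ℤ} (hx : |x| ≤ m) : g x = g 0 := by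
  induction x with
  | zero => rfl
  | succ i ih =>
    rw [abs_le] at hx
    rw [h i (abs_le.2 ⟨by omega, by omega⟩)]
    exact ih (abs_le.2 ⟨by omega, by omega⟩)
  | pred i ih =>
    have h1 := h (-i - 1) hx
    rw [abs_le] at hx
    rw [← h1, sub_add_cancel]
    exact ih (abs_le.2 ⟨by omega, by omega⟩)

/-- A linear function on the conjugate plane that is positive on the vertical labels of legs and
negative on that of centres. -/
noncomputable def verFunctional : Addr →+ ℝ :=
  AddMonoidHom.mk' (fun p => 3 * (internal p).re + (internal p).im) fun p q => by
    simp only [internal_add, Complex.add_re, Complex.add_im]; ring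

/-- A linear function on the conjugate plane that is positive on the horizontal labels of legs and
negative on that of centres. -/
noncomputable def horFunctional : Addr →+ ℝ :=
  AddMonoidHom.mk' (fun p => (internal p).re - 4 * (internal p).im) fun p q => by
    simp only [internal_add, Complex.add_re, Complex.add_im]; ring

theorem abs_verFunctional_le (p : Addr) : |verFunctional p| ≤ 5 * ‖internal p‖ := by
  have h1 := abs_le.1 (Complex.abs_re_le_norm (internal p))
  have h2 := abs_le.1 (Complex.abs_im_le_norm (internal p))
  change |3 * (internal p).re + (internal p).im| ≤ _
  rw [abs_le]
  constructor <;> linarith [norm_nonneg (internal p)]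

theorem abs_horFunctional_le (p : Addr) : |horFunctional p| ≤ 5 * ‖internal p‖ := by
  have h1 := abs_le.1 (Complex.abs_re_le_norm (internal p))
  have h2 := abs_le.1 (Complex.abs_im_le_norm (internal p))
  change |(internal p).re - 4 * (internal p).im| ≤ _
  rw [abs_le]
  constructor <;> linarith

theorem verFunctional_label {u : Addr} (hu : u = legLabel false true ∨ u = legLabel false false ∨
    u = centreLabel 0) : (u = centreLabel 0 ∧ verFunctional u ≤ -1) ∨
      (u ≠ centreLabel 0 ∧ 1 ≤ verFunctional u) := by
  obtain ⟨s1, s2⟩ := sqrt_three_bounds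
  have e : ∀ p, verFunctional p = 3 * (internal p).re + (internal p).im := fun _ => rfl
  rcases hu with rfl | rfl | rfl
  · refine Or.inr ⟨by decide, ?_⟩
    rw [e]
    simp [internal, legLabel]
    linarith
  · refine Or.inr ⟨by decide, ?_⟩
    rw [e]
    simp [internal, legLabel]
  · refine Or.inl ⟨rfl, ?_⟩
    rw [e]
    simp [internal, centreLabel, Kind.side, Kind.ver]
    linarith

theorem horFunctional_label {u : Addr} (hu : u = legLabel true true ∨ u = legLabel true false ∨
    u = centreLabel 1) : (u = centreLabel 1 ∧ horFunctional u ≤ -1) ∨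
      (u ≠ centreLabel 1 ∧ 1 ≤ horFunctional u) := by
  obtain ⟨s1, s2⟩ := sqrt_three_bounds
  have e : ∀ p, horFunctional p = (internal p).re - 4 * (internal p).im := fun _ => rfl
  rcases hu with rfl | rfl | rfl
  · refine Or.inr ⟨by decide, ?_⟩
    rw [e]
    simp [internal, legLabel]
  · refine Or.inr ⟨by decide, ?_⟩
    rw [e]
    simp [internal, legLabel]
    linarith
  · refine Or.inl ⟨rfl, ?_⟩
    rw [e]
    simp [internal, centreLabel, Kind.side, Kind.hor]
    linarith

/-- This is applied with the opposite value of `δ`, to the labels in the direction that the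
hypotenuses do not control. -/
theorem label_differences (δ : Bool) :
    ∀ s ∈ ({legLabel δ true, legLabel δ false, centreLabel (mainQuarter δ)} : Set Addr),
    ∀ t ∈ ({legLabel δ true, legLabel δ false, centreLabel (mainQuarter δ)} : Set Addr),
    ∀ s' ∈ ({legLabel δ true, legLabel δ false, centreLabel (mainQuarter δ)} : Set Addr),
    ∀ t' ∈ ({legLabel δ true, legLabel δ false, centreLabel (mainQuarter δ)} : Set Addr),
      s - t = s' - t' → s ≠ t → t = t' := by
  have h : ∀ δ : Bool,
      let S : Finset Addr := {legLabel δ true, legLabel δ false, centreLabel (mainQuarter δ)}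
      ∀ s ∈ S, ∀ t ∈ S, ∀ s' ∈ S, ∀ t' ∈ S, s - t = s' - t' → s ≠ t → t = t' := by
    decide
  intro s hs t ht s' hs' t' ht'
  exact h δ s (by simpa using hs) t (by simpa using ht) s' (by simpa using hs') t'
    (by simpa using ht')

/-- For `δ = false` the vertical labels are periodic, so the displacement is constant along columns,
and `displacement_row` compares neighbouring columns. For `δ = true` the two coordinates change
roles. -/
theorem IsLift.displacement_const {δ : Bool} {z₀ : ℤ × ℤ} {N p q m : ℤ} {a : ℤ → ℤ → Addr}
    {φ : ℤ → ℤ → Bool} (h : IsLift δ z₀ N a φ)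
    (hper : ∀ x y, |x| ≤ m + |p| + |q| + 183 → |y| ≤ m + |p| + |q| + 183 →
      φ (x + p) (y + q) = φ x y) (hN : m + 2 * |p| + 2 * |q| + 183 ≤ N) {x y : ℤ}
    (hx : |x| ≤ m) (hy : |y| ≤ m) : displacement a p q x y = displacement a p q 0 0 := by
  have ap := abs_nonneg p
  have aq := abs_nonneg q
  have hm : 0 ≤ m := (abs_nonneg x).trans hx
  have pb := abs_le.1 (le_refl |p|)
  have qb := abs_le.1 (le_refl |q|)
  have sub : ∀ x : ℤ, |x| ≤ m + |p| + |q| + 182 → |x| ≤ N ∧ |x + p| ≤ N ∧ |x + q| ≤ N ∧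
      |x| ≤ m + |p| + |q| + 183 ∧ |x - 1| ≤ m + |p| + |q| + 183 := by
    intro x hx
    rw [abs_le] at hx
    simp only [abs_le]
    omega
  cases δ
  · have per : ∀ x y, |x| ≤ m + |p| + |q| + 182 → |y| ≤ m + |p| + |q| + 182 →
        a (x + p) (y + 1 + q) - a (x + p) (y + q) = a x (y + 1) - a x y := by
      intro x y hx hy
      obtain ⟨x1, x2, -, x3, x4⟩ := sub x hx
      obtain ⟨y1, -, y2, y3, -⟩ := sub y hy
      rw [add_right_comm y 1 q, h.main_ver rfl _ _ x1 y1, h.main_ver rfl _ _ x2 y2,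
        hper x y x3 y3, add_sub_right_comm, hper (x - 1) y x4 y3]
    have row : ∀ x y, |x| ≤ m → |y| ≤ m →
        displacement a p q (x + 1) y = displacement a p q x y := by
      intro x y hx hy
      -- Conjugates are bounded by 18 and the functional by 5 times that, so `C = 90`, and 181 is
      -- the first height above `2 * C`.
      exact displacement_row (M := 181) (C := 90) (f := verFunctional) (H := centreLabel 1)
        (K := centreLabel 0) (label_differences true)
        (fun x y hx hy => h.hor x y (sub x hx).1 (sub y hy).1)
        (fun x y hx hy => verFunctional_label (h.ver x y (sub x hx).1 (sub y hy).1))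
        (fun x y hx hy => (h.cell x y (sub x hx).1 (sub y hy).1).imp_right And.left) per
        (fun x y hx hy => (abs_verFunctional_le _).trans (by
          linarith [h.norm_le x y (sub x hx).1 (sub y hy).1])) (by norm_num)
        (by omega) (by push_cast; omega)
    have col : ∀ y, |y| ≤ m → displacement a p q 0 (y + 1) = displacement a p q 0 y := by
      intro y hy
      rw [abs_le] at hy
      have := displacement_column per (x := 0) (y := y) (by simp; omega) 1 (by omega)
        (by push_cast; omega)
      simpa using this
    rw [eq_zero_of_steps (g := fun x => displacement a p q x y) (fun x hx => row x y hx hy) hx]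
    exact eq_zero_of_steps (g := fun y => displacement a p q 0 y) col hy
  · have per : ∀ y x, |y| ≤ m + |p| + |q| + 182 → |x| ≤ m + |p| + |q| + 182 →
        a (x + 1 + p) (y + q) - a (x + p) (y + q) = a (x + 1) y - a x y := by
      intro y x hy hx
      obtain ⟨x1, x2, -, x3, -⟩ := sub x hx
      obtain ⟨y1, -, y2, y3, y4⟩ := sub y hy
      rw [add_right_comm x 1 p, h.main_hor rfl _ _ x1 y1, h.main_hor rfl _ _ x2 y2,
        hper x y x3 y3, add_sub_right_comm, hper x (y - 1) x3 y4]
    have row : ∀ x y, |x| ≤ m → |y| ≤ m →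
        displacement a p q x (y + 1) = displacement a p q x y := by
      intro x y hx hy
      exact displacement_row (a := fun y x => a x y) (p := q) (q := p) (x := y) (y := x)
        (M := 181) (C := 90) (f := horFunctional) (H := centreLabel 0)
        (K := centreLabel 1) (label_differences false)
        (fun y x hy hx => h.ver x y (sub x hx).1 (sub y hy).1)
        (fun y x hy hx => horFunctional_label (h.hor x y (sub x hx).1 (sub y hy).1))
        (fun y x hy hx => (h.cell x y (sub x hx).1 (sub y hy).1).imp Iff.symm And.right) per
        (fun y x hy hx => (abs_horFunctional_le _).trans (by
          linarith [h.norm_le x y (sub x hx).1 (sub y hy).1])) (by norm_num)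
        (by omega) (by push_cast; omega)
    have col : ∀ x, |x| ≤ m → displacement a p q (x + 1) 0 = displacement a p q x 0 := by
      intro x hx
      rw [abs_le] at hx
      have := displacement_column (a := fun y x => a x y) per (x := 0) (y := x) (by simp; omega) 1
        (by omega) (by push_cast; omega)
      simp only [Nat.cast_one] at this
      exact this
    rw [eq_zero_of_steps (g := fun y => displacement a p q x y) (fun y hy => row x y hx hy) hy]
    exact eq_zero_of_steps (g := fun x => displacement a p q x 0) col hx

/-- The hypotenuses of a supertile have no period on a large box. -/
theorem exists_no_period {u : ℤ × ℤ} (hu : u ≠ 0) : ∃ N : ℕ, ∀ (ε δ : Bool) (κ : Kind) (n : ℕ)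
    (z₀ : ℤ × ℤ), κ.HasRule →
    (∀ x y, |x| ≤ (N : ℤ) → |y| ≤ (N : ℤ) → ∀ q,
      ∃ s ∈ supertile ε δ κ n, s.Covers δ (z₀ + (x, y)) q) →
    ¬ ∀ x y, |x| ≤ (N : ℤ) → |y| ≤ (N : ℤ) →
      ∃ s ∈ supertile ε δ κ n, s.Covers δ (z₀ + (x, y)) 0 ∧
        ∃ t ∈ supertile ε δ κ n, t.Covers δ (z₀ + (x, y) + u) 0 ∧ t.ori δ = s.ori δ := by
  obtain ⟨p, q⟩ := u
  -- This is the number of iterations required by `not_displacement_const` for `C = 18`; the box of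
  -- size `m` contains the first `n₀` multiples of the period. Nothing here depends on the supertile
  -- or on its level.
  obtain ⟨n₀, hn₀⟩ := exists_nat_gt (2 * (18 : ℝ) * (4 * (|p| + |q|) + 2 * 18))
  set m : ℤ := n₀ * (|p| + |q|) with hm
  have ap := abs_nonneg p
  have aq := abs_nonneg q
  have hm0 : 0 ≤ m := by positivity
  refine ⟨(m + 2 * |p| + 2 * |q| + 184).toNat, fun ε δ κ n z₀ hκ hcov hper => ?_⟩
  have hN : ((m + 2 * |p| + 2 * |q| + 184).toNat : ℤ) = m + 2 * |p| + 2 * |q| + 183 + 1 := by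
    omega
  rw [hN] at hcov hper
  obtain ⟨a, φ, hlift, hφ⟩ := exists_lift hκ hcov
  have pb := abs_le.1 (le_refl |p|)
  have qb := abs_le.1 (le_refl |q|)
  have hper' : ∀ x y, |x| ≤ m + |p| + |q| + 183 → |y| ≤ m + |p| + |q| + 183 →
      φ (x + p) (y + q) = φ x y := by
    intro x y hx hy
    rw [abs_le] at hx hy
    have x1 : |x| ≤ m + 2 * |p| + 2 * |q| + 183 + 1 := abs_le.2 ⟨by omega, by omega⟩
    have y1 : |y| ≤ m + 2 * |p| + 2 * |q| + 183 + 1 := abs_le.2 ⟨by omega, by omega⟩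
    obtain ⟨s, hs, hs', t, ht, ht', hst⟩ := hper x y x1 y1
    rw [← hφ x y x1 y1 0 s hs hs', ← hst]
    refine (hφ (x + p) (y + q) (abs_le.2 ⟨by omega, by omega⟩) (abs_le.2 ⟨by omega, by omega⟩) 0 t
      ht ?_).symm
    rwa [add_assoc, Prod.mk_add_mk] at ht'
  have hi : ∀ i : ℕ, i ≤ n₀ → |(i : ℤ) * p| ≤ m ∧ |(i : ℤ) * q| ≤ m := by
    intro i hi
    have hi' : (i : ℤ) ≤ n₀ := by exact_mod_cast hi
    rw [abs_mul, abs_mul, Nat.abs_cast, hm]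
    constructor <;> gcongr <;> omega
  refine not_displacement_const (a := a) (p := p) (q := q) hu hn₀ ?_ ?_ ?_
  · rw [displacement, ← toPlane_flat, flat_sub, hlift.flat_eq _ _ (by rw [zero_add]; omega)
      (by rw [zero_add]; omega), hlift.flat_eq _ _ (by simp; omega) (by simp; omega)]
    congr 1
    simp [Prod.ext_iff]
    omega
  · intro i h
    exact hlift.norm_le _ _ ((hi i h).1.trans (by omega)) ((hi i h).2.trans (by omega))
  · intro i h
    exact hlift.displacement_const hper' le_rfl (hi i h.le).1 (hi i h.le).2

/-! ### Aperiodicity -/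

theorem HalfCell.exists_left (c : ℤ × ℤ) (k : Fin 4) : ∃ y, HalfCell c k c.1 y := by
  fin_cases k
  · exact ⟨c.2, by simp [HalfCell]⟩
  · exact ⟨c.2, by simp [HalfCell]⟩
  · exact ⟨c.2 + 1, by simp [HalfCell]⟩
  · exact ⟨c.2 + 1, by simp [HalfCell]⟩

theorem HalfCell.exists_bottom (c : ℤ × ℤ) (k : Fin 4) : ∃ x, HalfCell c k x c.2 := by
  fin_cases k
  · exact ⟨c.1, by simp [HalfCell]⟩
  · exact ⟨c.1, by simp [HalfCell]⟩
  · exact ⟨c.1 + 1, by simp [HalfCell]⟩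
  · exact ⟨c.1, by simp [HalfCell]⟩

theorem quarterPoint_add (z u : ℤ × ℤ) (q : Fin 4) :
    quarterPoint (z + u) q = toPlane u + quarterPoint z q := by
  apply Complex.ext <;> fin_cases q <;> simp [quarterPoint, toPlane] <;> ring

/-- A translation between two triangles of a lattice is a lattice vector. -/
theorem eq_of_region_eq_translate {δ : Bool} {s t : LTile} {v w : ℂ}
    (h : (fun z => v + z) '' (s.place w).region δ = (t.place w).region δ) :
    v = toPlane (t.cell δ - s.cell δ) ∧ t.ori δ = s.ori δ := by
  have h1 : ∀ x y, HalfCell (s.cell δ) (s.ori δ) x y →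
      HalfCell (t.cell δ) (t.ori δ) (v.re + x) (v.im + y) := by
    intro x y hxy
    have : v + (w + ⟨x, y⟩) ∈ (t.place w).region δ := by
      rw [← h]
      refine ⟨_, (mem_region_iff δ w _ s).2 ?_, rfl⟩
      rwa [add_sub_cancel_left]
    rw [mem_region_iff, add_left_comm, add_sub_cancel_left] at this
    exact this
  have h2 : ∀ x y, HalfCell (t.cell δ) (t.ori δ) x y →
      HalfCell (s.cell δ) (s.ori δ) (x - v.re) (y - v.im) := by
    intro x y hxy
    have : w + ⟨x, y⟩ ∈ (t.place w).region δ := by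
      rw [mem_region_iff, add_sub_cancel_left]
      exact hxy
    rw [← h] at this
    obtain ⟨p, hp, e⟩ := this
    rw [mem_region_iff] at hp
    have e' : p - w = (⟨x, y⟩ : ℂ) - v := by linear_combination e
    rw [e'] at hp
    exact hp
  -- Every half cell touches the left and the bottom side of its cell. Comparing the leftmost and
  -- lowest points in both directions determines `v`.
  have hv : v = toPlane (t.cell δ - s.cell δ) := by
    obtain ⟨a1, b1⟩ := HalfCell.exists_left (s.cell δ) (s.ori δ)
    obtain ⟨a2, b2⟩ := HalfCell.exists_left (t.cell δ) (t.ori δ)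
    obtain ⟨a3, b3⟩ := HalfCell.exists_bottom (s.cell δ) (s.ori δ)
    obtain ⟨a4, b4⟩ := HalfCell.exists_bottom (t.cell δ) (t.ori δ)
    have c1 := (h1 _ _ b1).1
    have c2 := (h2 _ _ b2).1
    have c3 := (h1 _ _ b3).2.2.1
    have c4 := (h2 _ _ b4).2.2.1
    apply Complex.ext
    · simp [toPlane]; linarith
    · simp [toPlane]; linarith
  refine ⟨hv, ?_⟩
  have h3 : ∀ q, s.Covers δ (s.cell δ) q → t.Covers δ (t.cell δ) q := by
    intro q hq
    rw [← quarterPoint_mem_region_iff δ w] at hq ⊢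
    have e : t.cell δ = s.cell δ + (t.cell δ - s.cell δ) := (add_sub_cancel _ _).symm
    rw [e, quarterPoint_add, ← hv, ← h]
    exact ⟨_, hq, by ring⟩
  have k1 := (h3 (s.ori δ) ⟨rfl, Or.inl rfl⟩).2
  have k2 := (h3 (s.ori δ + 1) ⟨rfl, Or.inr rfl⟩).2
  generalize s.ori δ = k at *
  generalize t.ori δ = l at *
  clear * - k1 k2
  revert k l
  decide

theorem norm_sub_le_two_of_mem_region {δ : Bool} {w x y : ℂ} {t : LTile}
    (hx : x ∈ (t.place w).region δ) (hy : y ∈ (t.place w).region δ) : ‖x - y‖ ≤ 2 := by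
  rw [mem_region_iff] at hx hy
  obtain ⟨x1, x2, x3, x4, -⟩ := hx
  obtain ⟨y1, y2, y3, y4, -⟩ := hy
  simp only [Complex.sub_re, Complex.sub_im] at *
  refine (Complex.norm_le_abs_re_add_abs_im _).trans ?_
  have h1 : |(x - y).re| ≤ 1 := by rw [Complex.sub_re, abs_le]; constructor <;> linarith
  have h2 : |(x - y).im| ≤ 1 := by rw [Complex.sub_im, abs_le]; constructor <;> linarith
  linarith

theorem pos_mem_region (δ : Bool) (t : PTile) : t.pos ∈ t.region δ :=
  subset_convexHull ℝ _ (by simp [PTile.corners])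

/-- The triangles of a generated tiling that meet a disc belong to a common supertile. -/
theorem IsGenerated.exists_supertile_near {ε δ : Bool} {T : Set PTile} (hT : IsGenerated ε δ T)
    (x : ℂ) (R : ℝ) : ∃ (κ : Kind) (n : ℕ) (w : ℂ), κ.HasRule ∧
      ∀ t ∈ T, ∀ y ∈ t.region δ, ‖y - x‖ ≤ R → ∃ s ∈ supertile ε δ κ n, s.place w = t := by
  obtain ⟨t₀, ht₀, -⟩ : ∃ t ∈ T, x ∈ t.region δ := by
    have : x ∈ ⋃ t ∈ T, t.region δ := by rw [hT.1.1]; trivial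
    simpa using this
  set F : Set PTile := {t | t ∈ T ∧ ∃ y ∈ t.region δ, ‖y - x‖ ≤ R} with hF
  -- Each triangle of the tiling shares a supertile with the fixed triangle `t₀`. So its position
  -- differs from that of `t₀` by a grid vector, which is bounded here.
  have hfin : F.Finite := by
    obtain ⟨M, hM⟩ := exists_nat_ge (R + 2 + ‖x - t₀.pos‖)
    refine Set.Finite.subset (Set.Finite.image (fun i : Kind × Bool × ℤ × ℤ =>
      (⟨i.1, i.2.1, t₀.pos + toPlane i.2.2⟩ : PTile)) (Set.Finite.prod (Set.finite_univ)
        (Set.Finite.prod Set.finite_univ (Set.Finite.prod (Set.finite_Icc (-(M : ℤ)) M)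
          (Set.finite_Icc (-(M : ℤ)) M))))) ?_
    rintro t ⟨ht, y, hy, hyx⟩
    obtain ⟨κ, n, w, -, hsub⟩ := hT.2 {t₀, t} (by simp) (by
      rintro u (rfl | rfl)
      · exact ht₀
      · exact ht)
    obtain ⟨s₀, -, rfl⟩ := hsub (Set.mem_insert _ _)
    obtain ⟨s, -, rfl⟩ := hsub (Set.mem_insert_of_mem _ rfl)
    have e : (s.place w).pos = (s₀.place w).pos + toPlane (flat s.pos - flat s₀.pos) := by
      rw [← flat_sub, toPlane_flat, LTile.place, LTile.place, sub_eq_add_neg, reshape_add,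
        ← toPlane_flat (-s₀.pos), flat_neg]
      simp only [← toPlane_flat]
      simp [toPlane]
      ring
    have hn : ‖toPlane (flat s.pos - flat s₀.pos)‖ ≤ M := by
      have e' : toPlane (flat s.pos - flat s₀.pos) =
          ((s.place w).pos - y) + (y - x) + (x - (s₀.place w).pos) := by rw [e]; ring
      rw [e']
      have h1 := norm_sub_le_two_of_mem_region (pos_mem_region δ (s.place w)) hy
      have h2 := norm_add₃_le (a := (s.place w).pos - y) (b := y - x)
        (c := x - (s₀.place w).pos)
      linarith
    have b1 := (Complex.abs_re_le_norm _).trans hn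
    have b2 := (Complex.abs_im_le_norm _).trans hn
    simp only [toPlane, Complex.add_re, Complex.add_im, Complex.mul_re, Complex.mul_im,
      Complex.intCast_re, Complex.intCast_im, Complex.I_re, Complex.I_im, mul_zero, mul_one,
      sub_zero, zero_add, add_zero] at b1 b2
    refine ⟨(s.kind, s.rot, flat s.pos - flat s₀.pos), ⟨trivial, trivial, ?_, ?_⟩, ?_⟩
    · exact abs_le.1 (by exact_mod_cast b1)
    · exact abs_le.1 (by exact_mod_cast b2)
    · simp only [← e]
      rfl
  obtain ⟨κ, n, w, hκ, hsub⟩ := hT.2 F hfin fun t ht => ht.1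
  exact ⟨κ, n, w, hκ, fun t ht y hy hyx => hsub ⟨ht, y, hy, hyx⟩⟩

/-- A period of the plain triangles in a disc is a lattice vector, and a period of a box of a
supertile. -/
theorem IsGenerated.exists_periodic_box {ε δ : Bool} {T : Set PTile} (hT : IsGenerated ε δ T)
    {v x : ℂ} {N : ℕ} (hper : HasPeriodIn (fun s : Set ℂ => s) (fun v s => (fun z => v + z) '' s)
      (PTile.region δ '' T) v (Metric.closedBall x (2 * N + 4 + ‖v‖))) :
    ∃ (κ : Kind) (n : ℕ) (z₀ : ℤ × ℤ), κ.HasRule ∧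
      (∀ a b, |a| ≤ (N : ℤ) → |b| ≤ (N : ℤ) → ∀ q,
        ∃ s ∈ supertile ε δ κ n, s.Covers δ (z₀ + (a, b)) q) ∧
      ∀ a b, |a| ≤ (N : ℤ) → |b| ≤ (N : ℤ) → ∃ u, v = toPlane u ∧
        ∃ s ∈ supertile ε δ κ n, s.Covers δ (z₀ + (a, b)) 0 ∧
          ∃ t ∈ supertile ε δ κ n, t.Covers δ (z₀ + (a, b) + u) 0 ∧ t.ori δ = s.ori δ := by
  obtain ⟨κ, n, w, hκ, hnear⟩ := hT.exists_supertile_near x (2 * N + 4 + ‖v‖)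
  set z₀ : ℤ × ℤ := (⌊(x - w).re⌋, ⌊(x - w).im⌋) with hz₀
  -- The cells of the box are within `N + 2` of `x` in each coordinate. The additional `‖v‖` in the
  -- radius leaves room for the translated triangles.
  have near : ∀ a b, |a| ≤ (N : ℤ) → |b| ≤ (N : ℤ) → ∀ y : ℂ,
      ((z₀ + (a, b)).1 : ℝ) ≤ (y - w).re → (y - w).re ≤ (z₀ + (a, b)).1 + 1 →
      ((z₀ + (a, b)).2 : ℝ) ≤ (y - w).im → (y - w).im ≤ (z₀ + (a, b)).2 + 1 →
      ‖y - x‖ ≤ 2 * N + 4 := by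
    intro a b ha hb y h1 h2 h3 h4
    have ha' := abs_le.1 (show |(a : ℝ)| ≤ N by exact_mod_cast ha)
    have hb' := abs_le.1 (show |(b : ℝ)| ≤ N by exact_mod_cast hb)
    have f1 := Int.floor_le (x - w).re
    have f2 := Int.lt_floor_add_one (x - w).re
    have f3 := Int.floor_le (x - w).im
    have f4 := Int.lt_floor_add_one (x - w).im
    simp only [hz₀, Prod.mk_add_mk, Int.cast_add, Complex.sub_re, Complex.sub_im] at *
    refine (Complex.norm_le_abs_re_add_abs_im _).trans ?_
    have k1 : |(y - x).re| ≤ N + 2 := by rw [Complex.sub_re, abs_le]; constructor <;> linarith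
    have k2 : |(y - x).im| ≤ N + 2 := by rw [Complex.sub_im, abs_le]; constructor <;> linarith
    linarith
  have tile : ∀ a b, |a| ≤ (N : ℤ) → |b| ≤ (N : ℤ) → ∀ q,
      ∃ s ∈ supertile ε δ κ n, s.Covers δ (z₀ + (a, b)) q ∧ s.place w ∈ T := by
    intro a b ha hb q
    obtain ⟨t, ht, hx⟩ : ∃ t ∈ T, w + quarterPoint (z₀ + (a, b)) q ∈ t.region δ := by
      have : w + quarterPoint (z₀ + (a, b)) q ∈ ⋃ t ∈ T, t.region δ := by rw [hT.1.1]; trivial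
      simpa using this
    obtain ⟨s, hs, rfl⟩ := hnear t ht _ hx (by
      refine (near a b ha hb _ ?_ ?_ ?_ ?_).trans (by linarith [norm_nonneg v]) <;>
        rw [add_sub_cancel_left] <;> fin_cases q <;> simp [quarterPoint] <;> linarith)
    exact ⟨s, hs, (quarterPoint_mem_region_iff δ w s _ q).1 hx, ht⟩
  refine ⟨κ, n, z₀, hκ, fun a b ha hb q => ?_, fun a b ha hb => ?_⟩
  · obtain ⟨s, hs, hs', -⟩ := tile a b ha hb q
    exact ⟨s, hs, hs'⟩
  · obtain ⟨s, hs, hs', hsT⟩ := tile a b ha hb 0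
    have hball : ∀ y ∈ (s.place w).region δ, ‖y - x‖ ≤ 2 * N + 4 := by
      intro y hy
      rw [mem_region_iff] at hy
      have hc : s.cell δ = z₀ + (a, b) := hs'.1
      rw [hc] at hy
      exact near a b ha hb y hy.1 hy.2.1 hy.2.2.1 hy.2.2.2.1
    have hball' : ∀ y ∈ (s.place w).region δ, ‖v + y - x‖ ≤ 2 * N + 4 + ‖v‖ := by
      intro y hy
      have := norm_add_le v (y - x)
      rw [add_sub_assoc]
      linarith [hball y hy]
    obtain ⟨t, ht, htr⟩ := (hper ((s.place w).region δ)
      (fun y hy => by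
        rw [Metric.mem_closedBall, dist_eq_norm]
        linarith [hball y hy, norm_nonneg v])
      (by
        rintro _ ⟨y, hy, rfl⟩
        rw [Metric.mem_closedBall, dist_eq_norm]
        exact hball' y hy)).1 ⟨_, hsT, rfl⟩
    obtain ⟨t, ht', rfl⟩ := hnear t ht (v + (s.place w).pos) (by
      rw [htr]; exact ⟨_, pos_mem_region δ _, rfl⟩) (hball' _ (pos_mem_region δ _))
    obtain ⟨hv, ho⟩ := eq_of_region_eq_translate htr.symm
    refine ⟨_, hv, s, hs, hs', t, ht', ⟨?_, ?_⟩, ho⟩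
    · have hc : s.cell δ = z₀ + (a, b) := hs'.1
      rw [← hc, add_sub_cancel]
      rfl
    · rw [ho]
      exact hs'.2

theorem IsAperiodic.of_local {α : Type} {region : α → Set ℂ} {shift : ℂ → α → α} {T : Set α}
    (h : ∀ v : ℂ, v ≠ 0 → ∃ R : ℝ, ∀ x : ℂ,
      ¬ HasPeriodIn region shift T v (Metric.closedBall x R)) : IsAperiodic region shift T := by
  refine ⟨fun v hv hper => ?_, h⟩
  obtain ⟨R, hR⟩ := h v hv
  exact hR 0 fun t _ _ => hper t (Set.subset_univ _) (Set.subset_univ _)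

/-- A period of a disc that contains a single cell and its translate is already a grid vector. For
grid vectors `exists_no_period` provides a box, and hence a disc, that works everywhere. -/
theorem IsGenerated.isAperiodic_region {ε δ : Bool} {T : Set PTile} (hT : IsGenerated ε δ T) :
    IsAperiodic (fun s : Set ℂ => s) (fun v s => (fun z => v + z) '' s)
      (PTile.region δ '' T) := by
  refine IsAperiodic.of_local fun v hv => ?_
  by_cases hu : ∃ u, v = toPlane u
  · obtain ⟨u, rfl⟩ := hu
    obtain ⟨N, hN⟩ := exists_no_period (u := u) (by
      rintro rfl
      exact hv (by simp [toPlane]))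
    refine ⟨2 * N + 4 + ‖toPlane u‖, fun x hper => ?_⟩
    obtain ⟨κ, n, z₀, hκ, hcov, hbox⟩ := hT.exists_periodic_box hper
    refine hN ε δ κ n z₀ hκ hcov fun a b ha hb => ?_
    obtain ⟨u', hu', h⟩ := hbox a b ha hb
    obtain rfl := toPlane_injective 0 (congrArg (0 + ·) hu')
    exact h
  · refine ⟨2 * (0 : ℕ) + 4 + ‖v‖, fun x hper => hu ?_⟩
    obtain ⟨κ, n, z₀, -, -, hbox⟩ := hT.exists_periodic_box hper
    obtain ⟨u, h, -⟩ := hbox 0 0 (by simp) (by simp)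
    exact ⟨u, h⟩

theorem region_shift (δ : Bool) (v : ℂ) (t : PTile) :
    (t.shift v).region δ = (fun z => v + z) '' t.region δ := by
  have h : (t.shift v).corners δ = (fun z => v + z) '' t.corners δ := by
    obtain ⟨κ, r, p⟩ := t
    cases κ <;>
      simp only [PTile.corners, PTile.shift, Set.image_insert_eq, Set.image_singleton, add_assoc] <;>
      rfl
  rw [PTile.region, h, PTile.region]
  exact ((AffineEquiv.constVAdd ℝ ℂ v).toAffineMap.image_convexHull _).symm

/-- A period of the marked triangles in a disc is also a period of the plain ones there, so the
stronger statement without marks suffices. -/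
theorem IsGenerated.isAperiodic {ε δ : Bool} {T : Set PTile} (hT : IsGenerated ε δ T) :
    IsAperiodic (PTile.region δ) PTile.shift T := by
  refine IsAperiodic.of_local fun v hv => ?_
  obtain ⟨R, hR⟩ := hT.isAperiodic_region.2 v hv
  refine ⟨R, fun x hper => hR x fun s hs hs' => ⟨?_, ?_⟩⟩
  · rintro ⟨t, ht, rfl⟩
    exact ⟨_, (hper t hs (by rwa [region_shift])).1 ht, region_shift δ v t⟩
  · rintro ⟨t, ht, hts⟩
    have e : (t.shift (-v)).region δ = s := by
      rw [region_shift, hts, Set.image_image]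
      simp
    have e' : (t.shift (-v)).shift v = t := by simp [PTile.shift]
    refine ⟨_, (hper (t.shift (-v)) (by rwa [e]) ?_).2 (by rwa [e']), e⟩
    rw [e', hts]
    exact hs'

end OneTriangle

open OneTriangle in
theorem mainTheorem1 (ε δ : Bool) :
    -- there are 17 pairs of rules, each rule being the mirror image of the other one of its pair
    ((Finset.univ.filter Kind.HasRule).card = 34 ∧
      ∀ κ : Kind, κ.HasRule →
        (∀ t ∈ rule ε δ κ, t.kind.HasRule) ∧
        (mirror δ ⟨κ, false, 0⟩).kind.HasRule ∧
        (mirror δ ⟨κ, false, 0⟩).kind ≠ κ ∧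
        mirror δ (mirror δ ⟨κ, false, 0⟩) = ⟨κ, false, 0⟩ ∧
        subst ε δ (mirror δ ⟨κ, false, 0⟩) = (subst ε δ ⟨κ, false, 0⟩).image (mirror δ)) ∧
    -- the rules do not overlap
    (∀ κ : Kind, κ.HasRule → ∀ n : ℕ,
      (supertile ε δ κ n : Set LTile).PairwiseDisjoint (subst ε δ) ∧
      (supertile ε δ κ n : Set LTile).Pairwise fun s t =>
        Disjoint (interior ((s.place 0).region δ)) (interior ((t.place 0).region δ))) ∧
    -- they generate a tiling of the plane
    (∃ T : Set PTile, IsGenerated ε δ T) ∧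
    -- which consists of copies of one isosceles right triangle in four orientations, is
    -- edge-to-edge, and is aperiodic, with the marks and without them
    ∀ T : Set PTile, IsGenerated ε δ T →
      (∀ t ∈ T, ∃ (v : ℂ) (k : ℕ),
        t.region δ = convexHull ℝ {v, v + Complex.I ^ k, v + Complex.I ^ (k + 1)}) ∧
      IsEdgeToEdge δ T ∧
      IsAperiodic (PTile.region δ) PTile.shift T ∧
      IsAperiodic (fun s : Set ℂ => s) (fun v s => (fun z => v + z) '' s) (PTile.region δ '' T) := by
  refine ⟨⟨card_hasRule, fun κ hκ => ?_⟩, fun κ hκ n => ?_, ⟨_, exists_isGenerated ε δ⟩,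
    fun T hT => ?_⟩
  · obtain ⟨h1, h2, h3⟩ := mirror_pairs δ κ hκ
    exact ⟨hasRule_of_mem_rule ε δ κ hκ, h1, h2, h3, subst_mirror ε δ κ hκ⟩
  · exact ⟨supertile_subst_disjoint hκ, supertile_disjoint_interior hκ 0⟩
  · exact ⟨hT.exists_shape, hT.isEdgeToEdge, hT.isAperiodic, hT.isAperiodic_region⟩
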